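/- Theorem 2.6. Let $n\ge 1$, write $\xi=(\xi',\xi_n)\in\mathbb R^{n-1}\times\mathbb R$, $\langle\xi\rangle=(1+|\xi|^2)^{1/2}$, $\mathbb C_\pm=\{z\in\mathbb C: \operatorname{Im}z\gtrless 0\}$. *Function spaces.* $\mathcal H^+$ is the set of functions $t\mapsto\int_0^\infty e^{-ist}\varphi(s)\,ds$ on $\mathbb R$ with $\varphi\in\mathcal S(\mathbb R)$. $\mathcal H_{-1}$ is the set of $C^\infty$-functions $f$ on $\mathbb R$ such that $\tau^{-1}f(\tau^{-1})$ coincides for $0<|\tau|<1$ with a $C^\infty$-function on $(-1,1)$. For $f=g+P$ with $g\in\mathcal H_{-1}$ and $P$ a polynomial (both are then unique), $h_{-1}f=g$. For $d\in\mathbb R$, $S^d_{1,0}(\mathbb R^n,\mathbb R^{n-1},\mathcal H^+)$ is the set of $C^\infty$-functions $f(x,\xi',\xi_n)$ that are in $\mathcal H^+$ as functions of $\xi_n$, such that for all $k'\in\mathbb N_0$ the function $h_{-1}(\xi_n^{k'}f)$ (with $h_{-1}$ acting in $\xi_n$) is $C^\infty$ in $(x,\xi',\xi_n)$, and for all $\alpha\in\mathbb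 N_0^{n-1}$, $\beta\in\mathbb N_0^n$, $k,k'\in\mathbb N_0$, $$\|\partial_x^\beta\partial_{\xi'}^\alpha\partial_{\xi_n}^k h_{-1}(\xi_n^{k'}f(x,\xi',\xi_n))\|_{L_2(\mathbb R,\,d\xi_n)}\le C_{\alpha,\beta,k,k'}\,\langle\xi'\rangle^{d+\frac12-k+k'-|\alpha|}\quad\text{for all }x,\xi',$$ where the $C_{\alpha,\beta,k,k'}$ are continuous functions of $x$ (estimates local in $x$), respectively constants (estimates global in $x$). *Hypotheses.* Let $q(x,\xi)$ be a pseudodifferential symbol on $\mathbb R^n\times\mathbb R^n$ of order $0$, i.e. $q$ is a complex-valued $C^\infty$-function with $|\partial_x^\beta\partial_\xi^\alpha q(x,\xi)|\le C_{\alpha,\beta}\langle\xi\rangle^{-|\alpha|}$ for all $\alpha,\beta\in\mathbb N_0^n$, with $C_{\alpha,\beta}$ continuous functions of $x$. Assume that $q$ is homogeneous in $\xi$ of degree $0$ for $|\xi|\ge 1$ (that is, $q(x,s\xi)=q(x,\xi)$ for $|\xi|\ge1$, $s\ge1$), that it has the $0$-transmission property at all hyperplanes $\{x_n=c\}$, $$\partial_x^\beta\partial_\xi^\alpha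 q(x,0,-\xi_n)=(-1)^{|\alpha|}\partial_x^\beta\partial_\xi^\alpha q(x,0,\xi_n)\quad\text{for all }\alpha,\beta\in\mathbb N_0^n,\ x\in\mathbb R^n,\ |\xi_n|\ge1,$$ and that for some $\theta\in\mathbb R$ the values $q(x,\xi)$, for all $x,\xi\in\mathbb R^n$, avoid the ray $\{re^{i\theta}: r\ge0\}$. Let $s_0(x)=q(x,0,1)$. *Conclusion.* There are functions $q^\pm(x,\xi',\xi_n)$ with $$q(x,\xi)=s_0(x)\,q^-(x,\xi)\,q^+(x,\xi)\quad\text{for all }x,\xi\in\mathbb R^n,$$ such that for all $x,\xi'$ the function $q^{\pm}$ of $\xi_n$ extends from $\mathbb R$ to a function that is continuous and nowhere zero on $\overline{\mathbb C}_{\mp}$ and holomorphic in $\mathbb C_\mp$. Moreover $q^+=1+f$ and $\overline{q^-}=1+g$, where $f$ and $g$ belong to $S^0_{1,0}(\mathbb R^n,\mathbb R^{n-1},\mathcal H^+)$ with estimates local in $x$, and are homogeneous of degree $0$ in $\xi$ for $|\xi'|\ge1$. If in addition the $C_{\alpha,\beta}$ in the estimates of $q$ can be taken to be constants and $\inf_{x,\xi}|q(x,\xi)|>0$,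 then the estimates of $f$ and $g$ hold globally in $x$. -/

import Mathlib

open scoped ContDiff

noncomputable section

/-- `ℝᵏ` with its Euclidean norm. -/
abbrev Eu (k : ℕ) : Type := EuclideanSpace ℝ (Fin k)

/-- The partial derivative `∂_i g`. -/
def pderivCoord {k : ℕ} (i : Fin k) (g : Eu k → ℂ) : Eu k → ℂ :=
  fun x => fderiv ℝ g x (EuclideanSpace.single i 1)

/-- The derivative `∂^α g = ∂_1^{α_1} ⋯ ∂_k^{α_k} g` for a multi-index `α`. -/
def multiDeriv {k : ℕ} (α : Fin k → ℕ) (g : Eu k → ℂ) : Eu k → ℂ :=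
  (List.finRange k).foldr (fun i h => (pderivCoord i)^[α i] h) g

/-- The mixed derivative `∂_X^β ∂_{ξ'}^α ∂_{ξ_n}^k a (X, ξ', ξ_n)`. -/
def symDeriv {M m : ℕ} (β : Fin M → ℕ) (α : Fin m → ℕ) (k : ℕ)
    (a : Eu M → Eu m → ℝ → ℂ) (X : Eu M) (η : Eu m) (t : ℝ) : ℂ :=
  multiDeriv β (fun Y => multiDeriv α (fun ζ => iteratedDeriv k (a Y ζ) t) η) X

/-- `a (X, ξ', ξ_n)` is a `C^∞`-function of all variables jointly. -/
def JointlySmooth {M m : ℕ} (a : Eu M → Eu m → ℝ → ℂ) : Prop :=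
  ContDiff ℝ ∞ (fun p : Eu M × Eu m × ℝ => a p.1 p.2.1 p.2.2)

/-- `⟨ξ'⟩ = (1 + |ξ'|²)^{1/2}`. -/
def bracket {m : ℕ} (η : Eu m) : ℝ := Real.sqrt (1 + ‖η‖ ^ 2)

/-- `⟨ξ⟩ = (1 + |ξ|²)^{1/2}` for `ξ = (ξ', ξ_n)`. -/
def bracketFull {m : ℕ} (η : Eu m) (t : ℝ) : ℝ := Real.sqrt (1 + (‖η‖ ^ 2 + t ^ 2))

/-- `|ξ| ≥ 1` for `ξ = (ξ', ξ_n)`. -/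
def OutsideUnitBall {m : ℕ} (η : Eu m) (t : ℝ) : Prop := 1 ≤ Real.sqrt (‖η‖ ^ 2 + t ^ 2)

/-- The symbol space `S^r_{1,0}(ℝ^M × ℝ^{m+1})`, with estimates that are global in `X`. -/
def IsSymbol {M m : ℕ} (r : ℝ) (p : Eu M → Eu m → ℝ → ℂ) : Prop :=
  JointlySmooth p ∧
  ∀ (β : Fin M → ℕ) (α : Fin m → ℕ) (k : ℕ), ∃ C : ℝ, ∀ X η t,
    ‖symDeriv β α k p X η t‖ ≤ C * bracketFull η t ^ (r - ((∑ i, α i : ℕ) + k : ℝ))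

/-- The symbol space `S^r_{1,0}(ℝ^M × ℝ^{m+1})`, with estimates that are local in `X`: the
constants are continuous functions of `X`. -/
def IsSymbolLoc {M m : ℕ} (r : ℝ) (p : Eu M → Eu m → ℝ → ℂ) : Prop :=
  JointlySmooth p ∧
  ∀ (β : Fin M → ℕ) (α : Fin m → ℕ) (k : ℕ), ∃ C : Eu M → ℝ, Continuous C ∧ ∀ X η t,
    ‖symDeriv β α k p X η t‖ ≤ C X * bracketFull η t ^ (r - ((∑ i, α i : ℕ) + k : ℝ))

/-- The space `𝓗_d`: the `C^∞`-functions `f` on `ℝ` such that `τ^d f(τ⁻¹)` coincides with a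
`C^∞`-function for `-1 < τ < 1`. -/
def MemH (d : ℤ) (f : ℝ → ℂ) : Prop :=
  ContDiff ℝ ∞ f ∧
  ∃ k : ℝ → ℂ, ContDiffOn ℝ ∞ k (Set.Ioo (-1) 1) ∧
    ∀ τ ∈ Set.Ioo (-1 : ℝ) 1, τ ≠ 0 → k τ = (τ : ℂ) ^ d * f τ⁻¹

/-- The space `𝓗⁺ = 𝓕(e⁺ 𝓢₊)`: the Fourier transforms (with kernel `e^{-ixt}`) of the extensions
by zero of restrictions to `ℝ₊` of Schwartz functions. -/
def MemHPlus (f : ℝ → ℂ) : Prop :=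
  ∃ φ : SchwartzMap ℝ ℂ, ∀ t : ℝ,
    f t = ∫ x in Set.Ioi (0 : ℝ), Complex.exp (-Complex.I * x * t) * φ x

/-- A polynomial whose subtraction takes `f` into `𝓗_{-1}` is unique. -/
theorem polynomialPart_unique {f : ℝ → ℂ} {p r : Polynomial ℂ}
    (hp : MemH (-1) (fun t => f t - p.eval (t : ℂ)))
    (hr : MemH (-1) (fun t => f t - r.eval (t : ℂ))) : p = r := by
  have key : ∀ g : ℝ → ℂ, MemH (-1) g → Filter.Tendsto g Filter.atTop (nhds 0) := by
    rintro g ⟨-, k, hk, hkg⟩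
    have h0 : ContinuousAt k 0 :=
      hk.continuousOn.continuousAt (Ioo_mem_nhds (by norm_num) (by norm_num))
    have h1 : Filter.Tendsto (fun t : ℝ => ((t⁻¹ : ℝ) : ℂ) * k t⁻¹) Filter.atTop
        (nhds (((0 : ℝ) : ℂ) * k 0)) :=
      ((Complex.continuous_ofReal.tendsto 0).comp tendsto_inv_atTop_zero).mul
        (h0.tendsto.comp tendsto_inv_atTop_zero)
    rw [Complex.ofReal_zero, zero_mul] at h1
    refine h1.congr' ?_
    filter_upwards [Filter.eventually_gt_atTop 1] with t ht
    have ht0 : t ≠ 0 := by positivity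
    rw [hkg t⁻¹ ⟨by have : 0 < t⁻¹ := by positivity
                    linarith, inv_lt_one_of_one_lt₀ ht⟩ (inv_ne_zero ht0)]
    have : (t : ℂ) ≠ 0 := by exact_mod_cast ht0
    simp [this]
  have h := (key _ hr).sub (key _ hp)
  by_contra hne
  have hd : p - r ≠ 0 := sub_ne_zero.2 hne
  have h' : Filter.Tendsto (fun t : ℝ => (p - r).eval (t : ℂ)) Filter.atTop (nhds 0) := by
    simpa using h
  have hnorm : Filter.Tendsto (fun t : ℝ => ‖((t : ℝ) : ℂ)‖) Filter.atTop Filter.atTop := by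
    simpa using Filter.tendsto_abs_atTop_atTop (G := ℝ)
  rcases le_or_gt (p - r).degree 0 with hdeg | hdeg
  · rw [Polynomial.eq_C_of_degree_le_zero hdeg] at h' hd
    simp only [Polynomial.eval_C] at h'
    exact hd (by rw [tendsto_nhds_unique tendsto_const_nhds h', Polynomial.C_0])
  · exact not_tendsto_atTop_of_tendsto_nhds h'.norm
      (Polynomial.tendsto_norm_atTop (p - r) hdeg hnorm)

open Classical in
/-- The projection `h_{-1}`, which removes the polynomial part: on a sum of a function in `𝓗_{-1}`
and a polynomial it returns the function in `𝓗_{-1}`. -/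
def hMinusOne (f : ℝ → ℂ) : ℝ → ℂ :=
  if h : ∃ p : Polynomial ℂ, MemH (-1) (fun t => f t - p.eval (t : ℂ)) then
    fun t => f t - h.choose.eval (t : ℂ)
  else f

/-- The function `h_{-1}(ξ_n^{k'} f(X, ξ', ξ_n))`, with `h_{-1}` acting in `ξ_n`. -/
def hMinusOneMul {M m : ℕ} (k' : ℕ) (f : Eu M → Eu m → ℝ → ℂ) : Eu M → Eu m → ℝ → ℂ :=
  fun X η => hMinusOne (fun t => (t : ℂ) ^ k' * f X η t)

/-- What the spaces `S^d_{1,0}(ℝ^M, ℝ^m, 𝓗⁺)` with global and with local estimates have in common: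
`f` is smooth and in `𝓗⁺` with respect to `ξ_n`, and the functions `h_{-1}(ξ_n^{k'} f)` whose
derivatives are to be estimated are smooth. -/
def SmoothHPlusValued {M m : ℕ} (f : Eu M → Eu m → ℝ → ℂ) : Prop :=
  JointlySmooth f ∧ (∀ X η, MemHPlus (f X η)) ∧ ∀ k' : ℕ, JointlySmooth (hMinusOneMul k' f)

/-- The `L₂(ℝ)`-norm in `ξ_n` of `∂_X^β ∂_{ξ'}^α ∂_{ξ_n}^k h_{-1}(ξ_n^{k'} f)`. -/
def seminormHPlus {M m : ℕ} (β : Fin M → ℕ) (α : Fin m → ℕ) (k k' : ℕ)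
    (f : Eu M → Eu m → ℝ → ℂ) (X : Eu M) (η : Eu m) : ENNReal :=
  MeasureTheory.eLpNorm (fun t : ℝ => symDeriv β α k (hMinusOneMul k' f) X η t) 2
    MeasureTheory.volume

/-- The space `S^d_{1,0}(ℝ^M, ℝ^m, 𝓗⁺)`, with estimates that are global in `X`. -/
def MemSHPlus {M m : ℕ} (d : ℝ) (f : Eu M → Eu m → ℝ → ℂ) : Prop :=
  SmoothHPlusValued f ∧
  ∀ (β : Fin M → ℕ) (α : Fin m → ℕ) (k k' : ℕ), ∃ C : ℝ, ∀ X η,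
    seminormHPlus β α k k' f X η ≤
      ENNReal.ofReal (C * bracket η ^ (d + 1 / 2 - k + k' - (∑ i, α i : ℕ) : ℝ))

/-- The space `S^d_{1,0}(ℝ^M, ℝ^m, 𝓗⁺)`, with estimates that are local in `X`: the constants are
continuous functions of `X`. -/
def MemSHPlusLoc {M m : ℕ} (d : ℝ) (f : Eu M → Eu m → ℝ → ℂ) : Prop :=
  SmoothHPlusValued f ∧
  ∀ (β : Fin M → ℕ) (α : Fin m → ℕ) (k k' : ℕ), ∃ C : Eu M → ℝ, Continuous C ∧ ∀ X η,
    seminormHPlus β α k k' f X η ≤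
      ENNReal.ofReal (C X * bracket η ^ (d + 1 / 2 - k + k' - (∑ i, α i : ℕ) : ℝ))

/-- `q(x, ξ)` is homogeneous of degree `0` in `ξ` for `|ξ| ≥ 1`. -/
def HomogeneousZero {M m : ℕ} (q : Eu M → Eu m → ℝ → ℂ) : Prop :=
  ∀ x η t, OutsideUnitBall η t → ∀ s : ℝ, 1 ≤ s → q x (s • η) (s * t) = q x η t

/-- `f(x, ξ', ξ_n)` is homogeneous of degree `0` in `ξ = (ξ', ξ_n)` for `|ξ'| ≥ 1`. -/
def HomogeneousZeroTangential {M m : ℕ} (f : Eu M → Eu m → ℝ → ℂ) : Prop :=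
  ∀ x (η : Eu m) (t : ℝ), 1 ≤ ‖η‖ → ∀ s : ℝ, 1 ≤ s → f x (s • η) (s * t) = f x η t

/-- The `0`-transmission property at all hyperplanes `{x_n = c}`, for a symbol that is homogeneous
of degree `0`. The multi-index of the `ξ`-derivative is `(α, k)`. -/
def ZeroTransmission {M m : ℕ} (q : Eu M → Eu m → ℝ → ℂ) : Prop :=
  ∀ (β : Fin M → ℕ) (α : Fin m → ℕ) (k : ℕ) (x : Eu M) (t : ℝ), 1 ≤ |t| →
    symDeriv β α k q x 0 (-t) = (-1) ^ ((∑ i, α i) + k) * symDeriv β α k q x 0 t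

/-- All values of `q` avoid the ray `{r e^{iθ} ∣ r ≥ 0}`. -/
def AvoidsRay {M m : ℕ} (θ : ℝ) (q : Eu M → Eu m → ℝ → ℂ) : Prop :=
  ∀ x η t, ∀ r : ℝ, 0 ≤ r → q x η t ≠ r * Complex.exp (θ * Complex.I)

/-- The function `u` on `ℝ` extends to a function that is continuous on the closure of the
half-plane `U`, holomorphic in `U`, and without zeros on the closure. -/
def InvertibleHolomorphicExtension (U : Set ℂ) (u : ℝ → ℂ) : Prop :=
  ∃ g : ℂ → ℂ, DiffContOnCl ℂ g U ∧ (∀ t : ℝ, g t = u t) ∧ ∀ z ∈ closure U, g z ≠ 0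

end

open Set Filter Topology

/-!
For fixed `x` and `ξ'`, the substitution `ξ_n = cot (φ / 2)` turns the real line into the circle and
the half-planes into the inside and the outside of the disc. By homogeneity and the transmission
property `q` becomes smooth on the whole circle, jointly in all variables and including the point
`φ = 0` that represents `ξ_n = ∞`; its value there is `s_0(x)`, whatever `ξ'` is.

Since `q` avoids a ray, it has a smooth logarithm. The Hardy projections, normalized to vanish at
`φ = 0`, split this logarithm into a constant and two parts that extend holomorphically to the disc
and to its complement; exponentials of these parts are the factors. The second factor is the
conjugate of the first factor of the conjugate logarithm. The factors inherit the homogeneity of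
`q`, because a dilation of `ξ_n` acts on the disc as an automorphism that fixes the point at
infinity.

For `|ξ'| ≥ 1` homogeneity reduces the symbol estimates to bounded `ξ'`, where they follow from the
smoothness in `1 / ξ_n` at infinity: `h_{-1}` subtracts the leading Taylor coefficients. Membership
in `𝓗⁺` comes from Borel's lemma, which provides a half-line Schwartz function with the right
asymptotic expansion, and a Fourier inversion that absorbs the rapidly decreasing remainder.
-/

noncomputable section

section SmoothBddOn

variable {P R G H G' : Type*} [NormedAddCommGroup P] [NormedSpace ℝ P]
  [NormedAddCommGroup R] [NormedSpace ℝ R] [NormedAddCommGroup G] [NormedSpace ℝ G]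
  [NormedAddCommGroup H] [NormedSpace ℝ H] [NormedAddCommGroup G'] [NormedSpace ℝ G']
  {A B K : Set P}

/-- `F` is smooth on `A` and each of its derivatives is bounded on `A`. The derivatives are those
of `F` on the whole space, so the notion is meant for open sets `A`. -/
structure SmoothBddOn (A : Set P) (F : P → G) : Prop where
  contDiffOn : ContDiffOn ℝ ∞ F A
  exists_bound : ∀ n : ℕ, ∃ C : ℝ, ∀ p ∈ A, ‖iteratedFDeriv ℝ n F p‖ ≤ C

lemma exists_forall_le_bound {ι : Type*} {s : Set ι} {u : ℕ → ι → ℝ}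
    (h : ∀ n, ∃ C : ℝ, ∀ p ∈ s, u n p ≤ C) (n : ℕ) :
    ∃ C : ℝ, 1 ≤ C ∧ ∀ i ≤ n, ∀ p ∈ s, u i p ≤ C := by
  induction n with
  | zero =>
    obtain ⟨C, hC⟩ := h 0
    refine ⟨max 1 C, le_max_left _ _, fun i hi p hp => ?_⟩
    rw [Nat.le_zero.1 hi]
    exact (hC p hp).trans (le_max_right _ _)
  | succ n ih =>
    obtain ⟨C, hC1, hC⟩ := ih
    obtain ⟨D, hD⟩ := h (n + 1)
    refine ⟨max C D, hC1.trans (le_max_left _ _), fun i hi p hp => ?_⟩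
    rcases Nat.le_succ_iff.1 hi with hi | rfl
    · exact (hC i hi p hp).trans (le_max_left _ _)
    · exact (hD p hp).trans (le_max_right _ _)

lemma exists_bound_iteratedFDeriv_of_isCompact {F : P → G} (hB : IsOpen B)
    (hF : ContDiffOn ℝ ∞ F B) (hK : IsCompact K) (hKB : K ⊆ B) (n : ℕ) :
    ∃ C : ℝ, ∀ p ∈ K, ‖iteratedFDeriv ℝ n F p‖ ≤ C := by
  have hcont : ContinuousOn (iteratedFDerivWithin ℝ n F B) B :=
    hF.continuousOn_iteratedFDerivWithin (mod_cast le_top) hB.uniqueDiffOn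
  exact hK.exists_bound_of_continuousOn
    ((hcont.congr fun x hx => (iteratedFDerivWithin_of_isOpen n hB hx).symm).mono hKB)

lemma smoothBddOn_of_subset_isCompact {F : P → G} (hB : IsOpen B) (hF : ContDiffOn ℝ ∞ F B)
    (hK : IsCompact K) (hKB : K ⊆ B) (hAK : A ⊆ K) : SmoothBddOn A F where
  contDiffOn := hF.mono (hAK.trans hKB)
  exists_bound n := (exists_bound_iteratedFDeriv_of_isCompact hB hF hK hKB n).imp
    fun _ hC p hp => hC p (hAK hp)

namespace SmoothBddOn

lemma mono {F : P → G} (hF : SmoothBddOn B F) (hAB : A ⊆ B) : SmoothBddOn A F :=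
  ⟨hF.contDiffOn.mono hAB, fun n => (hF.exists_bound n).imp fun _ hC p hp => hC p (hAB hp)⟩

lemma contDiffAt {F : P → G} (hF : SmoothBddOn A F) (hA : IsOpen A) {p : P} (hp : p ∈ A) :
    ContDiffAt ℝ ∞ F p :=
  hF.contDiffOn.contDiffAt (hA.mem_nhds hp)

lemma hasFDerivAt {F : P → G} (hF : SmoothBddOn A F) (hA : IsOpen A) {p : P} (hp : p ∈ A) :
    HasFDerivAt F (fderiv ℝ F p) p :=
  ((hF.contDiffAt hA hp).differentiableAt (by simp)).hasFDerivAt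

lemma congr {F F' : P → G} (hF : SmoothBddOn A F) (hA : IsOpen A) (h : EqOn F' F A) :
    SmoothBddOn A F' where
  contDiffOn := hF.contDiffOn.congr h
  exists_bound n := (hF.exists_bound n).imp fun C hC p hp => by
    rw [((h.eventuallyEq_of_mem (hA.mem_nhds hp)).iteratedFDeriv ℝ n).eq_of_nhds]
    exact hC p hp

lemma exists_norm_le {F : P → G} (hF : SmoothBddOn A F) : ∃ C : ℝ, ∀ p ∈ A, ‖F p‖ ≤ C := by
  simpa only [norm_iteratedFDeriv_zero] using hF.exists_bound 0

lemma empty (F : P → G) : SmoothBddOn ∅ F :=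
  ⟨contDiffOn_empty, fun _ => ⟨0, by simp⟩⟩

lemma const (A : Set P) (c : G) : SmoothBddOn A (fun _ => c) := by
  refine ⟨contDiffOn_const, fun n => ⟨‖c‖, fun p _ => ?_⟩⟩
  rcases n with _ | n
  · simp
  · simp [iteratedFDeriv_succ_const]

lemma union {F : P → G} (hFA : SmoothBddOn A F) (hFB : SmoothBddOn B F) (hA : IsOpen A)
    (hB : IsOpen B) : SmoothBddOn (A ∪ B) F where
  contDiffOn := by
    rintro p (hp | hp)
    exacts [(hFA.contDiffAt hA hp).contDiffWithinAt, (hFB.contDiffAt hB hp).contDiffWithinAt]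
  exists_bound n := by
    obtain ⟨C, hC⟩ := hFA.exists_bound n
    obtain ⟨D, hD⟩ := hFB.exists_bound n
    refine ⟨max C D, ?_⟩
    rintro p (hp | hp)
    exacts [(hC p hp).trans (le_max_left _ _), (hD p hp).trans (le_max_right _ _)]

lemma bilinear {F : P → G} {F' : P → H} (hF : SmoothBddOn A F) (hF' : SmoothBddOn A F')
    (hA : IsOpen A) (L : G →L[ℝ] H →L[ℝ] G') : SmoothBddOn A (fun p => L (F p) (F' p)) := by
  refine ⟨L.isBoundedBilinearMap.contDiff.comp₂_contDiffOn hF.contDiffOn hF'.contDiffOn,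
    fun n => ?_⟩
  obtain ⟨C, hC1, hC⟩ := exists_forall_le_bound hF.exists_bound n
  obtain ⟨D, -, hD⟩ := exists_forall_le_bound hF'.exists_bound n
  refine ⟨‖L‖ * ∑ i ∈ Finset.range (n + 1), (n.choose i : ℝ) * C * D, fun p hp => ?_⟩
  have leibniz := L.norm_iteratedFDerivWithin_le_of_bilinear hF.contDiffOn hF'.contDiffOn
    hA.uniqueDiffOn hp (n := n) (mod_cast le_top)
  simp only [iteratedFDerivWithin_of_isOpen _ hA hp] at leibniz
  refine leibniz.trans ?_
  gcongr with i hi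
  · exact hC i (Finset.mem_range_succ_iff.1 hi) p hp
  · exact hD _ (Nat.sub_le n i) p hp

lemma clm_comp {F : P → G} (hF : SmoothBddOn A F) (hA : IsOpen A) (L : G →L[ℝ] G') :
    SmoothBddOn A (fun p => L (F p)) := by
  refine ⟨L.contDiff.comp_contDiffOn hF.contDiffOn, fun n => ?_⟩
  obtain ⟨C, hC⟩ := hF.exists_bound n
  refine ⟨‖L‖ * C, fun p hp => ?_⟩
  refine (L.norm_iteratedFDeriv_comp_left (hF.contDiffAt hA hp) (mod_cast le_top)).trans ?_
  gcongr
  exact hC p hp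

lemma add {F F' : P → G} (hF : SmoothBddOn A F) (hF' : SmoothBddOn A F') (hA : IsOpen A) :
    SmoothBddOn A (fun p => F p + F' p) := by
  refine ⟨hF.contDiffOn.add hF'.contDiffOn, fun n => ?_⟩
  obtain ⟨C, hC⟩ := hF.exists_bound n
  obtain ⟨D, hD⟩ := hF'.exists_bound n
  refine ⟨C + D, fun p hp => ?_⟩
  have hsum : iteratedFDeriv ℝ n (fun p => F p + F' p) p = _ :=
    iteratedFDeriv_add_apply ((hF.contDiffAt hA hp).of_le (mod_cast le_top))
      ((hF'.contDiffAt hA hp).of_le (mod_cast le_top))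
  grw [hsum, norm_add_le, hC p hp, hD p hp]

protected lemma fderiv {F : P → G} (hF : SmoothBddOn A F) (hA : IsOpen A) :
    SmoothBddOn A (fderiv ℝ F) where
  contDiffOn := hF.contDiffOn.fderiv_of_isOpen hA (by norm_cast)
  exists_bound n := by simpa only [norm_iteratedFDeriv_fderiv] using hF.exists_bound (n + 1)

lemma of_hasFDerivAt {F : P → G} {F' : P → P →L[ℝ] G} (hA : IsOpen A)
    (hd : ∀ p ∈ A, HasFDerivAt F (F' p) p) (hb : ∃ C : ℝ, ∀ p ∈ A, ‖F p‖ ≤ C)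
    (hF' : SmoothBddOn A F') : SmoothBddOn A F := by
  have h : SmoothBddOn A (fderiv ℝ F) := hF'.congr hA fun p hp => (hd p hp).fderiv
  refine ⟨(contDiffOn_infty_iff_fderiv_of_isOpen hA).2
    ⟨fun p hp => (hd p hp).differentiableAt.differentiableWithinAt, h.contDiffOn⟩, fun n => ?_⟩
  rcases n with _ | n
  · simpa only [norm_iteratedFDeriv_zero] using hb
  · simpa only [norm_iteratedFDeriv_fderiv] using h.exists_bound n

lemma comp_of_bound {B : Set R} {F : R → G} {γ : P → R} (hA : IsOpen A) (hB : IsOpen B)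
    (hF : ContDiffOn ℝ ∞ F B)
    (hFb : ∀ n : ℕ, ∃ C : ℝ, ∀ p ∈ A, ‖iteratedFDeriv ℝ n F (γ p)‖ ≤ C)
    (hγ : ContDiffOn ℝ ∞ γ A) (hγ' : SmoothBddOn A (fderiv ℝ γ)) (hm : MapsTo γ A B) :
    SmoothBddOn A (fun p => F (γ p)) := by
  refine ⟨hF.comp hγ hm, fun n => ?_⟩
  obtain ⟨C, -, hC⟩ := exists_forall_le_bound hFb n
  obtain ⟨D, hD1, hD⟩ := exists_forall_le_bound hγ'.exists_bound n
  refine ⟨n.factorial * C * D ^ n, fun p hp => ?_⟩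
  rw [← iteratedFDerivWithin_of_isOpen n hA hp]
  refine norm_iteratedFDerivWithin_comp_le hF hγ (mod_cast le_top) hB.uniqueDiffOn
    hA.uniqueDiffOn hm hp (fun i hi => ?_) fun i hi1 hi => ?_
  · rw [iteratedFDerivWithin_of_isOpen i hB (hm hp)]
    exact hC i hi p hp
  · obtain ⟨j, rfl⟩ := Nat.exists_eq_add_of_le' hi1
    rw [iteratedFDerivWithin_of_isOpen _ hA hp, ← norm_iteratedFDeriv_fderiv]
    exact (hD j (by lia) p hp).trans (le_self_pow₀ hD1 (by lia))

lemma comp {B : Set R} {F : R → G} {γ : P → R} (hF : SmoothBddOn B F) (hA : IsOpen A)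
    (hB : IsOpen B) (hγ : ContDiffOn ℝ ∞ γ A) (hγ' : SmoothBddOn A (fderiv ℝ γ))
    (hm : MapsTo γ A B) : SmoothBddOn A (fun p => F (γ p)) :=
  comp_of_bound hA hB hF.contDiffOn
    (fun n => (hF.exists_bound n).imp fun _ hC _ hp => hC _ (hm hp)) hγ hγ' hm

lemma comp_clm {B : Set R} {F : R → G} (hF : SmoothBddOn B F) (hA : IsOpen A) (hB : IsOpen B)
    (L : P →L[ℝ] R) (hm : MapsTo L A B) : SmoothBddOn A (fun p => F (L p)) :=
  hF.comp hA hB L.contDiff.contDiffOn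
    ((const A L).congr hA fun _ _ => L.fderiv) hm

lemma comp_left {B K : Set G} {F : G → H} {γ : P → G} (hγ : SmoothBddOn A γ) (hA : IsOpen A)
    (hB : IsOpen B) (hF : ContDiffOn ℝ ∞ F B) (hK : IsCompact K) (hKB : K ⊆ B)
    (hm : MapsTo γ A K) : SmoothBddOn A (fun p => F (γ p)) :=
  comp_of_bound hA hB hF
    (fun n => (exists_bound_iteratedFDeriv_of_isCompact hB hF hK hKB n).imp
      fun _ hC _ hp => hC _ (hm hp))
    hγ.contDiffOn (hγ.fderiv hA) (hm.mono_right hKB)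

lemma exists_annulus {F : P → ℂ} (hF : SmoothBddOn A F) {c : ℝ} (hlow : ∀ p ∈ A, c ≤ ‖F p‖) :
    ∃ C : ℝ, MapsTo F A {z : ℂ | c ≤ ‖z‖ ∧ ‖z‖ ≤ C} :=
  hF.exists_norm_le.imp fun _ hC p hp => ⟨hlow p hp, hC p hp⟩

lemma inv {F : P → ℂ} (hF : SmoothBddOn A F) (hA : IsOpen A) {c : ℝ} (hc : 0 < c)
    (hlow : ∀ p ∈ A, c ≤ ‖F p‖) : SmoothBddOn A (fun p => (F p)⁻¹) := by
  obtain ⟨C, hC⟩ := hF.exists_annulus hlow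
  have hK : IsCompact {z : ℂ | c ≤ ‖z‖ ∧ ‖z‖ ≤ C} :=
    (isCompact_closedBall (0 : ℂ) C).of_isClosed_subset
      ((isClosed_le continuous_const continuous_norm).inter
        (isClosed_le continuous_norm continuous_const)) fun z hz => by simpa using hz.2
  refine hF.comp_left (F := (·⁻¹)) hA (isOpen_compl_singleton (x := 0))
    (fun z hz => (contDiffAt_inv ℝ hz).contDiffWithinAt) hK ?_ hC
  rintro z ⟨hz, -⟩ rfl
  exact absurd hz (by simpa using hc)

/-- The values of `F` may accumulate at the cut of the logarithm. The derivatives stay bounded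
because `d log F = F⁻¹ dF`. -/
lemma log {F : P → ℂ} (hF : SmoothBddOn A F) (hA : IsOpen A)
    (hslit : ∀ p ∈ A, F p ∈ Complex.slitPlane) {c : ℝ} (hc : 0 < c)
    (hlow : ∀ p ∈ A, c ≤ ‖F p‖) : SmoothBddOn A (fun p => Complex.log (F p)) := by
  have hd : ∀ p ∈ A, HasFDerivAt (fun p => Complex.log (F p)) ((F p)⁻¹ • fderiv ℝ F p) p :=
    fun p hp => (((Complex.hasStrictDerivAt_log (hslit p hp)).hasDerivAt.comp_hasFDerivAt p
      (hF.hasFDerivAt hA hp)))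
  refine of_hasFDerivAt hA hd ?_
    ((hF.inv hA hc hlow).bilinear (hF.fderiv hA) hA (ContinuousLinearMap.lsmul ℝ ℂ))
  obtain ⟨C, hC⟩ := hF.exists_annulus hlow
  refine ⟨|Real.log c| + |Real.log C| + Real.pi, fun p hp => ?_⟩
  have hlog_low := Real.log_le_log hc (hC hp).1
  have hlog_up := Real.log_le_log (hc.trans_le (hC hp).1) (hC hp).2
  have hre : |Real.log ‖F p‖| ≤ |Real.log c| + |Real.log C| :=
    (abs_le_max_abs_abs hlog_low hlog_up).trans
      (max_le_add_of_nonneg (abs_nonneg _) (abs_nonneg _))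
  calc ‖Complex.log (F p)‖ ≤ |(Complex.log (F p)).re| + |(Complex.log (F p)).im| :=
        Complex.norm_le_abs_re_add_abs_im _
    _ ≤ |Real.log c| + |Real.log C| + Real.pi := by
        rw [Complex.log_re, Complex.log_im]
        exact add_le_add hre (Complex.abs_arg_le_pi _)

end SmoothBddOn

end SmoothBddOn

section ParametricIntegral

universe u

open MeasureTheory

namespace SmoothBddOn

variable {P G : Type u} [NormedAddCommGroup P] [NormedSpace ℝ P]
  [NormedAddCommGroup G] [NormedSpace ℝ G] {A : Set P} {J : Set ℝ} {a b : ℝ} {k : ℝ → ℝ}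
  {H : P × ℝ → G}

lemma fderiv_comp_inl (hH : SmoothBddOn (A ×ˢ J) H) (hA : IsOpen A) (hJ : IsOpen J) :
    SmoothBddOn (A ×ˢ J) (fun z => (fderiv ℝ H z).comp (ContinuousLinearMap.inl ℝ P ℝ)) :=
  (hH.fderiv (hA.prod hJ)).clm_comp (hA.prod hJ)
    ((ContinuousLinearMap.compL ℝ P (P × ℝ) G).flip (ContinuousLinearMap.inl ℝ P ℝ))

lemma continuousOn_slice (hH : SmoothBddOn (A ×ˢ J) H) (hab : uIcc a b ⊆ J) {p : P} (hp : p ∈ A) :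
    ContinuousOn (fun s => H (p, s)) (uIcc a b) :=
  hH.contDiffOn.continuousOn.comp (by fun_prop) fun _ hs => ⟨hp, hab hs⟩

lemma hasFDerivAt_integral (hH : SmoothBddOn (A ×ˢ J) H) (hA : IsOpen A) (hJ : IsOpen J)
    (hab : uIcc a b ⊆ J) (hk : IntervalIntegrable k volume a b) {p : P} (hp : p ∈ A) :
    HasFDerivAt (fun p => ∫ s in a..b, k s • H (p, s))
      (∫ s in a..b, k s • (fderiv ℝ H (p, s)).comp (ContinuousLinearMap.inl ℝ P ℝ)) p := by
  have hH' := hH.fderiv_comp_inl hA hJ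
  obtain ⟨C, hC⟩ := hH'.exists_norm_le
  have hsub : uIoc a b ⊆ J := uIoc_subset_uIcc.trans hab
  refine intervalIntegral.hasFDerivAt_integral_of_dominated_of_fderiv_le
    (bound := fun s => |k s| * C) (F := fun p s => k s • H (p, s))
    (F' := fun p s => k s • (fderiv ℝ H (p, s)).comp (ContinuousLinearMap.inl ℝ P ℝ))
    (hA.mem_nhds hp) ?_ (hk.smul_continuousOn (hH.continuousOn_slice hab hp))
    (hk.smul_continuousOn (hH'.continuousOn_slice hab hp)).def'.aestronglyMeasurable
    (Eventually.of_forall fun s hs p hp => ?_) (hk.abs.mul_const _)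
    (Eventually.of_forall fun s hs p hp => ?_)
  · filter_upwards [hA.mem_nhds hp] with p hp
    exact (hk.smul_continuousOn (hH.continuousOn_slice hab hp)).def'.aestronglyMeasurable
  · rw [norm_smul, Real.norm_eq_abs]
    gcongr
    exact hC (p, s) ⟨hp, hsub hs⟩
  · exact ((hH.hasFDerivAt (hA.prod hJ) ⟨hp, hsub hs⟩).comp p
      (hasFDerivAt_prodMk_left p s)).const_smul (k s)

lemma exists_norm_integral_le (hH : SmoothBddOn (A ×ˢ J) H) (hab : uIcc a b ⊆ J)
    (hk : IntervalIntegrable k volume a b) :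
    ∃ C : ℝ, ∀ p ∈ A, ‖∫ s in a..b, k s • H (p, s)‖ ≤ C := by
  obtain ⟨C, hC⟩ := hH.exists_norm_le
  refine ⟨|∫ s in a..b, |k s| * C|, fun p hp =>
    intervalIntegral.norm_integral_le_abs_of_norm_le ?_ (hk.abs.mul_const _)⟩
  refine (ae_restrict_iff' measurableSet_uIoc).2 (Eventually.of_forall fun s hs => ?_)
  rw [norm_smul, Real.norm_eq_abs]
  gcongr
  exact hC (p, s) ⟨hp, hab (uIoc_subset_uIcc hs)⟩

lemma contDiffOn_integral (hH : SmoothBddOn (A ×ˢ J) H) (hA : IsOpen A) (hJ : IsOpen J)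
    (hab : uIcc a b ⊆ J) (hk : IntervalIntegrable k volume a b) :
    ContDiffOn ℝ ∞ (fun p => ∫ s in a..b, k s • H (p, s)) A := by
  refine contDiffOn_infty.2 fun n => ?_
  have hd := fun (G : Type u) [NormedAddCommGroup G] [NormedSpace ℝ G] (H : P × ℝ → G)
    (hH : SmoothBddOn (A ×ˢ J) H) p (hp : p ∈ A) => hH.hasFDerivAt_integral hA hJ hab hk hp
  induction n generalizing G with
  | zero => exact contDiffOn_zero.2 fun p hp => (hd G H hH p hp).continuousAt.continuousWithinAt
  | succ n ih =>
    refine (contDiffOn_succ_iff_fderiv_of_isOpen hA).2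
      ⟨fun p hp => (hd G H hH p hp).differentiableAt.differentiableWithinAt,
        fun h => absurd h (WithTop.natCast_ne_top n), ?_⟩
    exact (ih (hH.fderiv_comp_inl hA hJ)).congr fun p hp => (hd G H hH p hp).fderiv

lemma integral (hH : SmoothBddOn (A ×ˢ J) H) (hA : IsOpen A) (hJ : IsOpen J)
    (hab : uIcc a b ⊆ J) (hk : IntervalIntegrable k volume a b) :
    SmoothBddOn A (fun p => ∫ s in a..b, k s • H (p, s)) := by
  refine ⟨hH.contDiffOn_integral hA hJ hab hk, fun n => ?_⟩
  induction n generalizing G with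
  | zero => simpa only [norm_iteratedFDeriv_zero] using hH.exists_norm_integral_le hab hk
  | succ n ih =>
    obtain ⟨C, hC⟩ := ih (hH.fderiv_comp_inl hA hJ)
    have hd : EqOn (fderiv ℝ fun p => ∫ s in a..b, k s • H (p, s)) (fun p => ∫ s in a..b,
        k s • (fderiv ℝ H (p, s)).comp (ContinuousLinearMap.inl ℝ P ℝ)) A :=
      fun p hp => (hH.hasFDerivAt_integral hA hJ hab hk hp).fderiv
    refine ⟨C, fun p hp => ?_⟩
    rw [← norm_iteratedFDeriv_fderiv,
      ((hd.eventuallyEq_of_mem (hA.mem_nhds hp)).iteratedFDeriv ℝ n).eq_of_nhds]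
    exact hC p hp

end SmoothBddOn

end ParametricIntegral

section LocSmoothBdd

universe u

variable {E V V' G G' H : Type*} [NormedAddCommGroup E] [NormedSpace ℝ E]
  [NormedAddCommGroup V] [NormedSpace ℝ V] [NormedAddCommGroup V'] [NormedSpace ℝ V']
  [NormedAddCommGroup G] [NormedSpace ℝ G] [NormedAddCommGroup G'] [NormedSpace ℝ G']
  [NormedAddCommGroup H] [NormedSpace ℝ H]

/-- Near `v`, the function `F (x, v')` is smooth with derivatives bounded uniformly in `x ∈ S`. -/
def LocSmoothBddAt (S : Set E) (F : E × V → G) (v : V) : Prop :=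
  ∃ N : Set V, IsOpen N ∧ v ∈ N ∧ SmoothBddOn (S ×ˢ N) F

/-- `F (x, v)` is smooth for `x ∈ S`, with derivatives bounded uniformly in `x ∈ S` and locally
in `v`. With `S` the whole space this encodes estimates global in `x`, and with `S` running
through the balls it encodes estimates local in `x`. -/
def LocSmoothBdd (S : Set E) (F : E × V → G) : Prop := ∀ v, LocSmoothBddAt S F v

variable {S : Set E} {v : V} {F : E × V → G}

namespace LocSmoothBddAt

lemma contDiffAt (hF : LocSmoothBddAt S F v) (hS : IsOpen S) {x : E} (hx : x ∈ S) :
    ContDiffAt ℝ ∞ F (x, v) := by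
  obtain ⟨N, hN, hv, hFN⟩ := hF
  exact hFN.contDiffAt (hS.prod hN) ⟨hx, hv⟩

lemma exists_of_eventually (hF : LocSmoothBddAt S F v) {p : V → Prop} (hp : ∀ᶠ v' in 𝓝 v, p v') :
    ∃ N : Set V, IsOpen N ∧ v ∈ N ∧ SmoothBddOn (S ×ˢ N) F ∧ ∀ v' ∈ N, p v' := by
  obtain ⟨N, hN, hv, hFN⟩ := hF
  obtain ⟨N', hpN', hN', hv'⟩ := eventually_nhds_iff.1 hp
  exact ⟨N ∩ N', hN.inter hN', ⟨hv, hv'⟩, hFN.mono (prod_mono_right inter_subset_left),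
    fun w hw => hpN' w hw.2⟩

lemma congr (hF : LocSmoothBddAt S F v) (hS : IsOpen S) {F' : E × V → G}
    (h : ∀ᶠ v' in 𝓝 v, ∀ x ∈ S, F' (x, v') = F (x, v')) : LocSmoothBddAt S F' v := by
  obtain ⟨N, hN, hv, hFN, hFF'⟩ := hF.exists_of_eventually h
  exact ⟨N, hN, hv, hFN.congr (hS.prod hN) fun p hp => hFF' p.2 hp.2 p.1 hp.1⟩

lemma const (c : G) : LocSmoothBddAt S (fun _ : E × V => c) v :=
  ⟨univ, isOpen_univ, mem_univ v, .const _ c⟩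

lemma bilinear {F' : E × V → H} (hF : LocSmoothBddAt S F v) (hF' : LocSmoothBddAt S F' v)
    (hS : IsOpen S) (L : G →L[ℝ] H →L[ℝ] G') :
    LocSmoothBddAt S (fun p => L (F p) (F' p)) v := by
  obtain ⟨N, hN, hv, hFN⟩ := hF
  obtain ⟨N', hN', hv', hFN'⟩ := hF'
  exact ⟨N ∩ N', hN.inter hN', ⟨hv, hv'⟩,
    (hFN.mono (prod_mono_right inter_subset_left)).bilinear
      (hFN'.mono (prod_mono_right inter_subset_right)) (hS.prod (hN.inter hN')) L⟩

lemma mul {F F' : E × V → ℂ} (hF : LocSmoothBddAt S F v) (hF' : LocSmoothBddAt S F' v)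
    (hS : IsOpen S) : LocSmoothBddAt S (fun p => F p * F' p) v :=
  hF.bilinear hF' hS (ContinuousLinearMap.mul ℝ ℂ)

lemma add {F' : E × V → G} (hF : LocSmoothBddAt S F v) (hF' : LocSmoothBddAt S F' v)
    (hS : IsOpen S) : LocSmoothBddAt S (fun p => F p + F' p) v := by
  obtain ⟨N, hN, hv, hFN⟩ := hF
  obtain ⟨N', hN', hv', hFN'⟩ := hF'
  exact ⟨N ∩ N', hN.inter hN', ⟨hv, hv'⟩, (hFN.mono (prod_mono_right inter_subset_left)).add
    (hFN'.mono (prod_mono_right inter_subset_right)) (hS.prod (hN.inter hN'))⟩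

lemma clm_comp (hF : LocSmoothBddAt S F v) (hS : IsOpen S) (L : G →L[ℝ] G') :
    LocSmoothBddAt S (fun p => L (F p)) v := by
  obtain ⟨N, hN, hv, hFN⟩ := hF
  exact ⟨N, hN, hv, hFN.clm_comp (hS.prod hN) L⟩

lemma sub {F' : E × V → G} (hF : LocSmoothBddAt S F v) (hF' : LocSmoothBddAt S F' v)
    (hS : IsOpen S) : LocSmoothBddAt S (fun p => F p - F' p) v := by
  simpa [sub_eq_add_neg] using hF.add (hF'.clm_comp hS (-ContinuousLinearMap.id ℝ G)) hS

lemma fderiv_apply (hF : LocSmoothBddAt S F v) (hS : IsOpen S) (w : E × V) :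
    LocSmoothBddAt S (fun p => fderiv ℝ F p w) v := by
  obtain ⟨N, hN, hv, hFN⟩ := hF
  exact ⟨N, hN, hv, (hFN.fderiv (hS.prod hN)).clm_comp (hS.prod hN)
    (ContinuousLinearMap.apply ℝ G w)⟩

end LocSmoothBddAt

lemma exists_isOpen_smoothBddOn_prod (hS : IsOpen S) {K : Set V} (hK : IsCompact K)
    (h : ∀ v ∈ K, LocSmoothBddAt S F v) :
    ∃ N : Set V, IsOpen N ∧ K ⊆ N ∧ SmoothBddOn (S ×ˢ N) F := by
  refine hK.induction_on (p := fun K => ∃ N : Set V, IsOpen N ∧ K ⊆ N ∧ SmoothBddOn (S ×ˢ N) F)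
    ⟨∅, isOpen_empty, subset_rfl, by simpa using SmoothBddOn.empty F⟩ ?_ ?_ ?_
  · rintro s t hst ⟨N, hN, htN, hFN⟩
    exact ⟨N, hN, hst.trans htN, hFN⟩
  · rintro s t ⟨N, hN, hsN, hFN⟩ ⟨N', hN', htN', hFN'⟩
    refine ⟨N ∪ N', hN.union hN', union_subset_union hsN htN', ?_⟩
    rw [prod_union]
    exact hFN.union hFN' (hS.prod hN) (hS.prod hN')
  · intro v hv
    obtain ⟨N, hN, hvN, hFN⟩ := h v hv
    exact ⟨N, mem_nhdsWithin_of_mem_nhds (hN.mem_nhds hvN), N, hN, subset_rfl, hFN⟩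

lemma exists_isOpen_smoothBddOn [ProperSpace V] {U : Set V} (hU : IsOpen U) (hv : v ∈ U)
    {γ : V → G} (hγ : ContDiffOn ℝ ∞ γ U) :
    ∃ N ⊆ U, IsOpen N ∧ v ∈ N ∧ SmoothBddOn N γ := by
  obtain ⟨r, hr, hrU⟩ := Metric.nhds_basis_closedBall.mem_iff.1 (hU.mem_nhds hv)
  exact ⟨Metric.ball v r, Metric.ball_subset_closedBall.trans hrU, Metric.isOpen_ball,
    Metric.mem_ball_self hr, smoothBddOn_of_subset_isCompact hU hγ (isCompact_closedBall v r) hrU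
      Metric.ball_subset_closedBall⟩

lemma SmoothBddOn.comp_snd {N : Set V} {γ : V → G} (hγ : SmoothBddOn N γ) (hS : IsOpen S)
    (hN : IsOpen N) : SmoothBddOn (S ×ˢ N) (fun p => γ p.2) :=
  hγ.comp_clm (hS.prod hN) hN (ContinuousLinearMap.snd ℝ E V) fun _ hp => hp.2

lemma LocSmoothBdd.of_snd [ProperSpace V] (hS : IsOpen S) {γ : V → G} (hγ : ContDiff ℝ ∞ γ) :
    LocSmoothBdd S (fun p => γ p.2) := fun v => by
  obtain ⟨N, -, hN, hvN, hγN⟩ := exists_isOpen_smoothBddOn isOpen_univ (mem_univ v) hγ.contDiffOn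
  exact ⟨N, hN, hvN, hγN.comp_snd hS hN⟩

lemma SmoothBddOn.fderiv_prodMap_id {N : Set V'} {γ : V' → V} (hS : IsOpen S) (hN : IsOpen N)
    (hγ : ContDiffOn ℝ ∞ γ N) (hγ' : SmoothBddOn N (fderiv ℝ γ)) :
    SmoothBddOn (S ×ˢ N) (fderiv ℝ fun p : E × V' => (p.1, γ p.2)) := by
  have hSN := hS.prod hN
  have hadd := (SmoothBddOn.const (S ×ˢ N)
    ((ContinuousLinearMap.inl ℝ E V).comp (ContinuousLinearMap.fst ℝ E V'))).add
    ((hγ'.comp_snd hS hN).clm_comp hSN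
      ((ContinuousLinearMap.compL ℝ (E × V') V (E × V) (ContinuousLinearMap.inr ℝ E V)).comp
        ((ContinuousLinearMap.compL ℝ (E × V') V' V).flip (ContinuousLinearMap.snd ℝ E V')))) hSN
  refine hadd.congr hSN fun p hp => ?_
  have hγp : HasFDerivAt γ (fderiv ℝ γ p.2) p.2 :=
    ((hγ.contDiffAt (hN.mem_nhds hp.2)).differentiableAt (by simp)).hasFDerivAt
  refine (hasFDerivAt_fst.prodMk (hγp.comp p hasFDerivAt_snd)).fderiv.trans ?_
  ext z <;> simp

lemma LocSmoothBddAt.comp_right [ProperSpace V'] {U : Set V'} {w : V'} {γ : V' → V}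
    (hF : LocSmoothBddAt S F (γ w)) (hS : IsOpen S) (hU : IsOpen U) (hw : w ∈ U)
    (hγ : ContDiffOn ℝ ∞ γ U) : LocSmoothBddAt S (fun p => F (p.1, γ p.2)) w := by
  obtain ⟨N, hN, hwN, hFN⟩ := hF
  obtain ⟨N', hN'U, hN', hwN', hγ'⟩ :=
    exists_isOpen_smoothBddOn hU hw (hγ.fderiv_of_isOpen (m := ∞) hU (by norm_cast))
  have hγN' := hγ.mono hN'U
  have hM : IsOpen (N' ∩ γ ⁻¹' N) := hγN'.continuousOn.isOpen_inter_preimage hN' hN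
  have hγM := hγN'.mono (inter_subset_left (t := γ ⁻¹' N))
  exact ⟨N' ∩ γ ⁻¹' N, hM, ⟨hwN', hwN⟩, hFN.comp (hS.prod hM) (hS.prod hN)
    (contDiff_fst.contDiffOn.prodMk (hγM.comp contDiff_snd.contDiffOn fun _ hp => hp.2))
    (.fderiv_prodMap_id hS hM hγM (hγ'.mono inter_subset_left)) fun _ hp => ⟨hp.1, hp.2.2⟩⟩

lemma LocSmoothBdd.comp_right [ProperSpace V'] {γ : V' → V} (hF : LocSmoothBdd S F)
    (hS : IsOpen S) (hγ : ContDiff ℝ ∞ γ) : LocSmoothBdd S (fun p => F (p.1, γ p.2)) :=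
  fun w => (hF (γ w)).comp_right hS isOpen_univ (mem_univ w) hγ.contDiffOn

lemma LocSmoothBddAt.integral {E V G : Type u} [NormedAddCommGroup E] [NormedSpace ℝ E]
    [NormedAddCommGroup V] [NormedSpace ℝ V] [NormedAddCommGroup G] [NormedSpace ℝ G]
    {S : Set E} {v : V} {F : E × (V × ℝ) → G} {a b : ℝ} {k : ℝ → ℝ}
    (hF : ∀ s ∈ uIcc a b, LocSmoothBddAt S F (v, s)) (hS : IsOpen S)
    (hk : IntervalIntegrable k MeasureTheory.volume a b) :
    LocSmoothBddAt S (fun p => ∫ s in a..b, k s • F (p.1, (p.2, s))) v := by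
  obtain ⟨N, hN, hKN, hFN⟩ := exists_isOpen_smoothBddOn_prod hS
    (isCompact_singleton.prod isCompact_uIcc) (K := {v} ×ˢ uIcc a b) (F := F) (by
      rintro ⟨_, s⟩ ⟨rfl, hs⟩
      exact hF s hs)
  obtain ⟨N', J, hN', hJ, hvN', hJs, hsub⟩ :=
    generalized_tube_lemma isCompact_singleton isCompact_uIcc hN hKN
  have hprod : SmoothBddOn ((S ×ˢ N') ×ˢ J) (fun z => F (z.1.1, (z.1.2, z.2))) :=
    hFN.comp_clm ((hS.prod hN').prod hJ) (hS.prod hN)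
      (ContinuousLinearEquiv.prodAssoc ℝ E V ℝ : ((E × V) × ℝ) →L[ℝ] E × (V × ℝ))
      fun _ hz => ⟨hz.1.1, hsub ⟨hz.1.2, hz.2⟩⟩
  exact ⟨N', hN', hvN' rfl, hprod.integral (hS.prod hN') hJ hJs hk⟩

lemma LocSmoothBddAt.comp_contDiff [ProperSpace G] {γ : G → G'} (hF : LocSmoothBddAt S F v)
    (hS : IsOpen S) (hγ : ContDiff ℝ ∞ γ) : LocSmoothBddAt S (fun p => γ (F p)) v := by
  obtain ⟨N, hN, hv, hFN⟩ := hF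
  obtain ⟨C, hC⟩ := hFN.exists_norm_le
  exact ⟨N, hN, hv, hFN.comp_left (hS.prod hN) isOpen_univ hγ.contDiffOn
    (isCompact_closedBall (0 : G) C) (subset_univ _) fun p hp => by simpa using hC p hp⟩

lemma LocSmoothBddAt.log {F : E × V → ℂ} (hF : LocSmoothBddAt S F v) (hS : IsOpen S)
    (hslit : ∀ x ∈ S, ∀ v, F (x, v) ∈ Complex.slitPlane) {c : ℝ} (hc : 0 < c)
    (hlow : ∀ᶠ v' in 𝓝 v, ∀ x ∈ S, c ≤ ‖F (x, v')‖) :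
    LocSmoothBddAt S (fun p => Complex.log (F p)) v := by
  obtain ⟨N, hN, hv, hFN, hlowN⟩ := hF.exists_of_eventually hlow
  exact ⟨N, hN, hv, hFN.log (hS.prod hN) (fun p hp => hslit p.1 hp.1 p.2) hc
    fun p hp => hlowN p.2 hp.2 p.1 hp.1⟩

lemma locSmoothBdd_ball_of_contDiff [ProperSpace E] [ProperSpace V] (hF : ContDiff ℝ ∞ F)
    (R : ℝ) : LocSmoothBdd (Metric.ball 0 R) F := fun v =>
  ⟨Metric.ball v 1, Metric.isOpen_ball, Metric.mem_ball_self one_pos,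
    smoothBddOn_of_subset_isCompact isOpen_univ hF.contDiffOn
      ((isCompact_closedBall (0 : E) R).prod (isCompact_closedBall v 1)) (subset_univ _)
      (prod_mono Metric.ball_subset_closedBall Metric.ball_subset_closedBall)⟩

lemma contDiff_of_locSmoothBdd_ball (hF : ∀ R : ℝ, LocSmoothBdd (Metric.ball 0 R) F) :
    ContDiff ℝ ∞ F :=
  contDiff_iff_contDiffAt.2 fun ⟨x, v⟩ =>
    (hF (‖x‖ + 1) v).contDiffAt Metric.isOpen_ball (by simp)

end LocSmoothBdd

section DirDeriv

variable {P P' ι : Type*} [NormedAddCommGroup P] [NormedSpace ℝ P]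
  [NormedAddCommGroup P'] [NormedSpace ℝ P']

/-- The derivative of `F` in the direction `v`. -/
def dirDeriv (v : P) (F : P → ℂ) : P → ℂ := fun p => fderiv ℝ F p v

/-- The iterated derivative of `F`, of order `α i` in the direction `e i` for each `i` in the
list `l`. -/
def dirMultiDeriv (e : ι → P) (α : ι → ℕ) (l : List ι) (F : P → ℂ) : P → ℂ :=
  l.foldr (fun i h => (dirDeriv (e i))^[α i] h) F

variable {F : P → ℂ}

lemma contDiff_dirDeriv (hF : ContDiff ℝ ∞ F) (v : P) : ContDiff ℝ ∞ (dirDeriv v F) :=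
  (hF.fderiv_right (m := ∞) (by norm_cast)).clm_apply contDiff_const

lemma contDiff_iterate_dirDeriv (hF : ContDiff ℝ ∞ F) (v : P) (k : ℕ) :
    ContDiff ℝ ∞ ((dirDeriv v)^[k] F) := by
  induction k with
  | zero => exact hF
  | succ k ih => simpa only [Function.iterate_succ_apply'] using contDiff_dirDeriv ih v

lemma dirMultiDeriv_cons (e : ι → P) (α : ι → ℕ) (i : ι) (l : List ι) (F : P → ℂ) :
    dirMultiDeriv e α (i :: l) F = (dirDeriv (e i))^[α i] (dirMultiDeriv e α l F) := rfl

lemma dirMultiDeriv_zero (e : ι → P) (l : List ι) (F : P → ℂ) : dirMultiDeriv e 0 l F = F := by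
  induction l with
  | nil => rfl
  | cons i l ih => rw [dirMultiDeriv_cons, Pi.zero_apply, Function.iterate_zero_apply, ih]

lemma contDiff_dirMultiDeriv (hF : ContDiff ℝ ∞ F) (e : ι → P) (α : ι → ℕ) (l : List ι) :
    ContDiff ℝ ∞ (dirMultiDeriv e α l F) := by
  induction l with
  | nil => exact hF
  | cons i l ih => exact contDiff_iterate_dirDeriv ih _ _

lemma dirDeriv_dirDeriv (hF : ContDiff ℝ ∞ F) (v w p : P) :
    dirDeriv v (dirDeriv w F) p = fderiv ℝ (fderiv ℝ F) p v w := by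
  have hd : DifferentiableAt ℝ (fderiv ℝ F) p :=
    (hF.fderiv_right (m := ∞) (by norm_cast)).differentiable (by simp) p
  unfold dirDeriv
  rw [fderiv_clm_apply hd (differentiableAt_const w)]
  simp

lemma dirDeriv_comm (hF : ContDiff ℝ ∞ F) (v w : P) :
    dirDeriv v (dirDeriv w F) = dirDeriv w (dirDeriv v F) := by
  have hsymm (p : P) : IsSymmSndFDerivAt ℝ F p := hF.contDiffAt.isSymmSndFDerivAt (by
    rw [minSmoothness_of_isRCLikeNormedField]
    exact WithTop.coe_le_coe.2 le_top)
  ext p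
  rw [dirDeriv_dirDeriv hF, dirDeriv_dirDeriv hF, (hsymm p).eq v w]

lemma dirDeriv_iterate_comm (hF : ContDiff ℝ ∞ F) (v w : P) (k : ℕ) :
    dirDeriv v ((dirDeriv w)^[k] F) = (dirDeriv w)^[k] (dirDeriv v F) := by
  induction k with
  | zero => rfl
  | succ k ih =>
    rw [Function.iterate_succ_apply', dirDeriv_comm (contDiff_iterate_dirDeriv hF w k), ih,
      ← Function.iterate_succ_apply' (dirDeriv w)]

lemma dirDeriv_dirMultiDeriv_comm (hF : ContDiff ℝ ∞ F) (e : ι → P) (α : ι → ℕ) (l : List ι)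
    (v : P) : dirDeriv v (dirMultiDeriv e α l F) = dirMultiDeriv e α l (dirDeriv v F) := by
  induction l with
  | nil => rfl
  | cons i l ih =>
    rw [dirMultiDeriv_cons, dirMultiDeriv_cons,
      dirDeriv_iterate_comm (contDiff_dirMultiDeriv hF e α l), ih]

lemma dirMultiDeriv_congr {e : ι → P} {α β : ι → ℕ} {l : List ι} (h : ∀ i ∈ l, α i = β i)
    (F : P → ℂ) : dirMultiDeriv e α l F = dirMultiDeriv e β l F := by
  induction l with
  | nil => rfl
  | cons i l ih =>
    rw [dirMultiDeriv_cons, dirMultiDeriv_cons, ih fun j hj => h j (List.mem_cons_of_mem _ hj),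
      h i List.mem_cons_self]

lemma dirMultiDeriv_add_single [DecidableEq ι] (hF : ContDiff ℝ ∞ F) (e : ι → P) (α : ι → ℕ)
    {l : List ι} (hl : l.Nodup) {i : ι} (hi : i ∈ l) :
    dirMultiDeriv e (α + Pi.single i 1) l F = dirMultiDeriv e α l (dirDeriv (e i) F) := by
  induction l with
  | nil => simp at hi
  | cons j l ih =>
    rw [List.nodup_cons] at hl
    rw [dirMultiDeriv_cons, dirMultiDeriv_cons]
    by_cases hij : j = i
    · subst hij
      rw [dirMultiDeriv_congr (β := α) (fun k hk => by
        simp [show k ≠ j from fun h => hl.1 (h ▸ hk)]), ← dirDeriv_dirMultiDeriv_comm hF e α l]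
      simp
    · rw [ih hl.2 ((List.mem_cons.1 hi).resolve_left (Ne.symm hij))]
      simp [hij]

lemma dirDeriv_comp_affine (hF : ContDiff ℝ ∞ F) (L : P' →L[ℝ] P) (c : P) (v : P') :
    (fun z => dirDeriv (L v) F (L z + c)) = dirDeriv v (fun z => F (L z + c)) := by
  ext z
  have hFz : HasFDerivAt F (fderiv ℝ F (L z + c)) (L z + c) :=
    (hF.differentiable (by simp) _).hasFDerivAt
  have hcomp : HasFDerivAt (fun z => F (L z + c)) ((fderiv ℝ F (L z + c)).comp L) z :=
    hFz.comp z (L.hasFDerivAt.add_const c)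
  simp only [dirDeriv, hcomp.fderiv, ContinuousLinearMap.comp_apply]

lemma iterate_dirDeriv_comp_affine (hF : ContDiff ℝ ∞ F) (L : P' →L[ℝ] P) (c : P) (v : P')
    (k : ℕ) :
    (fun z => (dirDeriv (L v))^[k] F (L z + c)) = (dirDeriv v)^[k] (fun z => F (L z + c)) := by
  induction k with
  | zero => rfl
  | succ k ih =>
    simp only [Function.iterate_succ_apply']
    rw [← ih, ← dirDeriv_comp_affine (contDiff_iterate_dirDeriv hF _ _)]

lemma dirMultiDeriv_comp_affine (hF : ContDiff ℝ ∞ F) (e : ι → P') (α : ι → ℕ) (l : List ι)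
    (L : P' →L[ℝ] P) (c : P) :
    (fun z => dirMultiDeriv (fun i => L (e i)) α l F (L z + c)) =
      dirMultiDeriv e α l (fun z => F (L z + c)) := by
  induction l with
  | nil => rfl
  | cons i l ih =>
    simp only [dirMultiDeriv_cons]
    rw [iterate_dirDeriv_comp_affine (contDiff_dirMultiDeriv hF _ _ _), ih]

lemma iterate_dirDeriv_sub {H : P → ℂ} (hF : ContDiff ℝ ∞ F) (hH : ContDiff ℝ ∞ H) (v : P)
    (k : ℕ) : (dirDeriv v)^[k] (fun p => F p - H p) =
      fun p => (dirDeriv v)^[k] F p - (dirDeriv v)^[k] H p := by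
  induction k with
  | zero => rfl
  | succ k ih =>
    simp only [Function.iterate_succ_apply']
    rw [ih]
    exact funext fun p => congrArg (· v)
      (fderiv_fun_sub ((contDiff_iterate_dirDeriv hF v k).differentiable (by simp) p)
        ((contDiff_iterate_dirDeriv hH v k).differentiable (by simp) p))

lemma dirMultiDeriv_sub {H : P → ℂ} (hF : ContDiff ℝ ∞ F) (hH : ContDiff ℝ ∞ H) (e : ι → P)
    (α : ι → ℕ) (l : List ι) : dirMultiDeriv e α l (fun p => F p - H p) =
      fun p => dirMultiDeriv e α l F p - dirMultiDeriv e α l H p := by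
  induction l with
  | nil => rfl
  | cons i l ih =>
    simp only [dirMultiDeriv_cons]
    rw [ih, iterate_dirDeriv_sub (contDiff_dirMultiDeriv hF _ _ _)
      (contDiff_dirMultiDeriv hH _ _ _)]

lemma iterate_dirDeriv_neg_const_mul (hF : ContDiff ℝ ∞ F) (v : P) (c : ℂ) (k : ℕ) :
    (dirDeriv (-v))^[k] (fun p => c * F p) = fun p => (-1) ^ k * c * (dirDeriv v)^[k] F p := by
  induction k with
  | zero => simp
  | succ k ih =>
    simp only [Function.iterate_succ_apply']
    rw [ih]
    funext p
    refine (congrArg (· (-v)) (fderiv_const_mul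
      ((contDiff_iterate_dirDeriv hF v k).differentiable (by simp) p) _)).trans ?_
    simp [pow_succ, dirDeriv]

lemma dirMultiDeriv_neg (hF : ContDiff ℝ ∞ F) (e : ι → P) (α : ι → ℕ) (l : List ι) :
    dirMultiDeriv (fun i => -e i) α l F =
      fun p => (-1) ^ (l.map α).sum * dirMultiDeriv e α l F p := by
  induction l with
  | nil => simp [dirMultiDeriv]
  | cons i l ih =>
    rw [dirMultiDeriv_cons, ih,
      iterate_dirDeriv_neg_const_mul (contDiff_dirMultiDeriv hF _ _ _)]
    simp only [List.map_cons, List.sum_cons, pow_add, dirMultiDeriv_cons]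

lemma exists_norm_iteratedFDeriv_succ_le [Fintype ι] [FiniteDimensional ℝ P]
    (b : Module.Basis ι ℝ P) : ∃ C : ι → ℝ, ∀ (n : ℕ) (F : P → ℂ), ContDiff ℝ ∞ F → ∀ p : P,
      ‖iteratedFDeriv ℝ (n + 1) F p‖ ≤ ∑ i, C i * ‖iteratedFDeriv ℝ n (dirDeriv (b i) F) p‖ := by
  let Λ : ι → (ℂ →L[ℝ] (P →L[ℝ] ℂ)) := fun i =>
    ContinuousLinearMap.smulRightL ℝ P ℂ (LinearMap.toContinuousLinearMap (b.coord i))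
  refine ⟨fun i => ‖Λ i‖, fun n F hF p => ?_⟩
  have hfderiv : fderiv ℝ F = fun p => ∑ i, Λ i (dirDeriv (b i) F p) := by
    ext p v
    conv_lhs => rw [← b.sum_repr v, map_sum]
    simp [Λ, dirDeriv]
  have hΛ (i : ι) : ContDiff ℝ ∞ (fun p => Λ i (dirDeriv (b i) F p)) :=
    (Λ i).contDiff.comp (contDiff_dirDeriv hF (b i))
  rw [← norm_iteratedFDeriv_fderiv, hfderiv,
    iteratedFDeriv_fun_sum_apply fun i _ => (hΛ i).contDiffAt.of_le (mod_cast le_top)]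
  exact (norm_sum_le _ _).trans (Finset.sum_le_sum fun i _ =>
    (Λ i).norm_iteratedFDeriv_comp_left (contDiff_dirDeriv hF (b i)).contDiffAt
      (mod_cast le_top))

lemma exists_bound_iteratedFDeriv_of_dirDeriv [Finite ι] [FiniteDimensional ℝ P]
    (b : Module.Basis ι ℝ P) {W : Set (P → ℂ)} (hW : ∀ F ∈ W, ContDiff ℝ ∞ F)
    (hWb : ∀ F ∈ W, ∀ i, dirDeriv (b i) F ∈ W) {A : Set P}
    (hA : ∀ F ∈ W, ∃ C : ℝ, ∀ p ∈ A, ‖F p‖ ≤ C) (n : ℕ) :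
    ∀ F ∈ W, ∃ C : ℝ, ∀ p ∈ A, ‖iteratedFDeriv ℝ n F p‖ ≤ C := by
  have := Fintype.ofFinite ι
  obtain ⟨c, hc⟩ := exists_norm_iteratedFDeriv_succ_le b
  induction n with
  | zero => simpa using hA
  | succ n ih =>
    intro F hF
    choose C hC using fun i => ih _ (hWb F hF i)
    refine ⟨∑ i, |c i| * C i, fun p hp => (hc n F (hW F hF) p).trans ?_⟩
    exact Finset.sum_le_sum fun i _ =>
      mul_le_mul (le_abs_self _) (hC i p hp) (norm_nonneg _) (abs_nonneg _)

lemma iteratedFDeriv_eq_zero_of_dirDeriv [Finite ι] [FiniteDimensional ℝ P]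
    (b : Module.Basis ι ℝ P) {W : Set (P → ℂ)} (hW : ∀ F ∈ W, ContDiff ℝ ∞ F)
    (hWb : ∀ F ∈ W, ∀ i, dirDeriv (b i) F ∈ W) {p : P} (hp : ∀ F ∈ W, F p = 0) (n : ℕ) :
    ∀ F ∈ W, iteratedFDeriv ℝ n F p = 0 := by
  have := Fintype.ofFinite ι
  obtain ⟨c, hc⟩ := exists_norm_iteratedFDeriv_succ_le b
  induction n with
  | zero =>
    intro F hF
    rw [← norm_eq_zero, norm_iteratedFDeriv_zero, hp F hF, norm_zero]
  | succ n ih =>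
    intro F hF
    rw [← norm_le_zero_iff]
    refine (hc n F (hW F hF) p).trans (le_of_eq (Finset.sum_eq_zero fun i _ => ?_))
    rw [ih _ (hWb F hF i), norm_zero, mul_zero]

end DirDeriv

section Flat

universe u

variable {P R G : Type u} [NormedAddCommGroup P] [NormedSpace ℝ P] [NormedAddCommGroup R]
  [NormedSpace ℝ R] [NormedAddCommGroup G] [NormedSpace ℝ G]

/-- `F` vanishes to infinite order at `p`. -/
def FlatAt (F : P → G) (p : P) : Prop := ∀ n : ℕ, iteratedFDeriv ℝ n F p = 0

namespace FlatAt

variable {F : P → G} {p : P}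

lemma apply_eq_zero (hF : FlatAt F p) : F p = 0 := by
  rw [← norm_eq_zero, ← norm_iteratedFDeriv_zero (𝕜 := ℝ), hF 0, norm_zero]

protected lemma fderiv (hF : FlatAt F p) : FlatAt (fderiv ℝ F) p := fun n => by
  rw [← norm_eq_zero, norm_iteratedFDeriv_fderiv, hF, norm_zero]

lemma comp {F : R → G} {γ : P → R} (hFγ : FlatAt F (γ p)) (hF : ContDiff ℝ ∞ F)
    (hγ : ContDiff ℝ ∞ γ) : FlatAt (fun z => F (γ z)) p := fun n => by
  change iteratedFDeriv ℝ n (F ∘ γ) p = 0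
  rw [iteratedFDeriv_comp (hF.contDiffAt) (hγ.contDiffAt) (mod_cast le_top)]
  ext v
  simp [FormalMultilinearSeries.taylorComp, ftaylorSeries, hFγ _]

end FlatAt

variable {F : P → G} {s : Set P}

lemma hasFDerivAt_indicator_of_flatAt (hF : ContDiff ℝ ∞ F) (hs : ∀ p ∈ frontier s, FlatAt F p)
    (p : P) : HasFDerivAt (s.indicator F) (s.indicator (fderiv ℝ F) p) p := by
  have hFp : HasFDerivAt F (fderiv ℝ F p) p := (hF.differentiable (by simp) p).hasFDerivAt
  by_cases hp : p ∈ frontier s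
  · have hF0 := (hs p hp).apply_eq_zero
    have hF0' := (hs p hp).fderiv.apply_eq_zero
    have hval : s.indicator F p = 0 := indicator_apply_eq_zero.2 fun _ => hF0
    rw [indicator_apply_eq_zero.2 fun _ => hF0', hasFDerivAt_iff_isLittleO]
    rw [hF0', hasFDerivAt_iff_isLittleO] at hFp
    refine (Asymptotics.isBigO_of_le _ fun z => ?_).trans_isLittleO hFp
    simpa [hF0, hval] using norm_indicator_le_norm_self F z
  by_cases hps : p ∈ s
  · rw [indicator_of_mem hps]
    refine hFp.congr_of_eventuallyEq ?_
    filter_upwards [mem_interior_iff_mem_nhds.1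
      (by_contra fun h => hp ⟨subset_closure hps, h⟩)] with z hz
    exact indicator_of_mem hz F
  · rw [indicator_of_notMem hps]
    refine (hasFDerivAt_const (0 : G) p).congr_of_eventuallyEq ?_
    filter_upwards [mem_interior_iff_mem_nhds.1
      (by_contra fun h => hp (frontier_compl s ▸ ⟨subset_closure hps, h⟩))] with z hz
    exact indicator_of_notMem hz F

lemma fderiv_indicator_of_flatAt (hF : ContDiff ℝ ∞ F) (hs : ∀ p ∈ frontier s, FlatAt F p) :
    fderiv ℝ (s.indicator F) = s.indicator (fderiv ℝ F) :=
  funext fun p => (hasFDerivAt_indicator_of_flatAt hF hs p).fderiv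

lemma contDiff_indicator_of_flatAt (hF : ContDiff ℝ ∞ F) (hs : ∀ p ∈ frontier s, FlatAt F p) :
    ContDiff ℝ ∞ (s.indicator F) := by
  refine contDiff_infty.2 fun n => ?_
  have hd := hasFDerivAt_indicator_of_flatAt hF hs
  induction n generalizing G with
  | zero => exact contDiff_zero.2 (continuous_iff_continuousAt.2 fun p => (hd p).continuousAt)
  | succ n ih =>
    refine contDiff_succ_iff_fderiv.2 ⟨fun p => (hd p).differentiableAt,
      fun h => absurd h (WithTop.natCast_ne_top n), ?_⟩
    rw [fderiv_indicator_of_flatAt hF hs]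
    have hF' := hF.fderiv_right (m := ∞) (by norm_cast)
    have hs' := fun p hp => (hs p hp).fderiv
    exact ih hF' hs' (hasFDerivAt_indicator_of_flatAt hF' hs')

lemma norm_iteratedFDeriv_indicator_le (hF : ContDiff ℝ ∞ F)
    (hs : ∀ p ∈ frontier s, FlatAt F p) (n : ℕ) (p : P) :
    ‖iteratedFDeriv ℝ n (s.indicator F) p‖ ≤ ‖iteratedFDeriv ℝ n F p‖ := by
  induction n generalizing G with
  | zero => simpa only [norm_iteratedFDeriv_zero] using norm_indicator_le_norm_self F p
  | succ n ih =>
    rw [← norm_iteratedFDeriv_fderiv, ← norm_iteratedFDeriv_fderiv (f := F),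
      fderiv_indicator_of_flatAt hF hs]
    exact ih (hF.fderiv_right (m := ∞) (by norm_cast)) fun p hp => (hs p hp).fderiv

lemma SmoothBddOn.indicator {A : Set P} (hFA : SmoothBddOn A F) (hF : ContDiff ℝ ∞ F)
    (hs : ∀ p ∈ frontier s, FlatAt F p) : SmoothBddOn A (s.indicator F) where
  contDiffOn := (contDiff_indicator_of_flatAt hF hs).contDiffOn
  exists_bound n := (hFA.exists_bound n).imp fun _ hC p hp =>
    (norm_iteratedFDeriv_indicator_le hF hs n p).trans (hC p hp)

end Flat

section Symbols

variable {M m : ℕ}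

/-- The function of the pair `(X, (ξ', ξ_n))` given by `a (X, ξ', ξ_n)`. -/
def joint (a : Eu M → Eu m → ℝ → ℂ) : Eu M × (Eu m × ℝ) → ℂ := fun p => a p.1 p.2.1 p.2.2

/-- The `i`-th coordinate direction in `X`. -/
def dirX (M m : ℕ) (i : Fin M) : Eu M × (Eu m × ℝ) := (EuclideanSpace.single i 1, 0, 0)

/-- The `i`-th coordinate direction in `ξ'`. -/
def dirXi (M m : ℕ) (i : Fin m) : Eu M × (Eu m × ℝ) := (0, EuclideanSpace.single i 1, 0)

/-- The direction of `ξ_n`. -/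
def dirXin (M m : ℕ) : Eu M × (Eu m × ℝ) := (0, 0, 1)

/-- The derivative `∂_X^β ∂_{ξ'}^α ∂_{ξ_n}^k` of a function of all variables. -/
def jointDeriv (β : Fin M → ℕ) (α : Fin m → ℕ) (k : ℕ) (F : Eu M × (Eu m × ℝ) → ℂ) :
    Eu M × (Eu m × ℝ) → ℂ :=
  dirMultiDeriv (dirX M m) β (List.finRange M)
    (dirMultiDeriv (dirXi M m) α (List.finRange m) ((dirDeriv (dirXin M m))^[k] F))

lemma multiDeriv_eq_dirMultiDeriv {k : ℕ} (α : Fin k → ℕ) (g : Eu k → ℂ) :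
    multiDeriv α g =
      dirMultiDeriv (fun i => EuclideanSpace.single i (1 : ℝ)) α (List.finRange k) g := rfl

lemma iteratedDeriv_eq_iterate_dirDeriv (k : ℕ) (g : ℝ → ℂ) :
    iteratedDeriv k g = (dirDeriv (1 : ℝ))^[k] g := by
  rw [iteratedDeriv_eq_iterate]
  congr 1

variable {F : Eu M × (Eu m × ℝ) → ℂ}

lemma iteratedDeriv_slice_xin (hF : ContDiff ℝ ∞ F) (k : ℕ) (X : Eu M) (η : Eu m) (t : ℝ) :
    iteratedDeriv k (fun s => F (X, η, s)) t = (dirDeriv (dirXin M m))^[k] F (X, η, t) := by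
  have hcomp := congrFun (iterate_dirDeriv_comp_affine hF
    ((ContinuousLinearMap.inr ℝ (Eu M) (Eu m × ℝ)).comp (ContinuousLinearMap.inr ℝ (Eu m) ℝ))
    (X, η, 0) 1 k) t
  rw [iteratedDeriv_eq_iterate_dirDeriv]
  simpa [dirXin] using hcomp.symm

lemma multiDeriv_slice_xi (hF : ContDiff ℝ ∞ F) (α : Fin m → ℕ) (X : Eu M) (η : Eu m) (t : ℝ) :
    multiDeriv α (fun ζ => F (X, ζ, t)) η =
      dirMultiDeriv (dirXi M m) α (List.finRange m) F (X, η, t) := by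
  have hcomp := congrFun (dirMultiDeriv_comp_affine hF
    (fun i => EuclideanSpace.single i (1 : ℝ)) α (List.finRange m)
    ((ContinuousLinearMap.inr ℝ (Eu M) (Eu m × ℝ)).comp (ContinuousLinearMap.inl ℝ (Eu m) ℝ))
    (X, 0, t)) η
  simpa [show dirXi M m = fun i => (0, EuclideanSpace.single i 1, 0) from rfl,
    multiDeriv_eq_dirMultiDeriv] using hcomp.symm

lemma multiDeriv_slice_x (hF : ContDiff ℝ ∞ F) (β : Fin M → ℕ) (X : Eu M) (η : Eu m) (t : ℝ) :
    multiDeriv β (fun Y => F (Y, η, t)) X =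
      dirMultiDeriv (dirX M m) β (List.finRange M) F (X, η, t) := by
  have hcomp := congrFun (dirMultiDeriv_comp_affine hF
    (fun i => EuclideanSpace.single i (1 : ℝ)) β (List.finRange M)
    (ContinuousLinearMap.inl ℝ (Eu M) (Eu m × ℝ)) (0, η, t)) X
  simpa [show dirX M m = fun i => (EuclideanSpace.single i 1, 0) from rfl,
    multiDeriv_eq_dirMultiDeriv] using hcomp.symm

lemma symDeriv_eq_jointDeriv {a : Eu M → Eu m → ℝ → ℂ} (ha : JointlySmooth a)
    (β : Fin M → ℕ) (α : Fin m → ℕ) (k : ℕ) (X : Eu M) (η : Eu m) (t : ℝ) :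
    symDeriv β α k a X η t = jointDeriv β α k (joint a) (X, η, t) := by
  have ha' : ContDiff ℝ ∞ (joint a) := ha
  have hk := contDiff_iterate_dirDeriv ha' (dirXin M m) k
  rw [jointDeriv, ← multiDeriv_slice_x (contDiff_dirMultiDeriv hk _ _ _)]
  simp_rw [← multiDeriv_slice_xi hk, ← iteratedDeriv_slice_xin ha']
  rfl

/-- The standard basis of the space of all variables. -/
def jointBasis (M m : ℕ) : Module.Basis (Fin M ⊕ (Fin m ⊕ Fin 1)) ℝ (Eu M × (Eu m × ℝ)) :=
  (EuclideanSpace.basisFun (Fin M) ℝ).toBasis.prod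
    ((EuclideanSpace.basisFun (Fin m) ℝ).toBasis.prod (Module.Basis.singleton (Fin 1) ℝ))

lemma jointBasis_inl (i : Fin M) : jointBasis M m (Sum.inl i) = dirX M m i := by
  simp [jointBasis, dirX, Module.Basis.prod_apply, Prod.mk_zero_zero]

lemma jointBasis_inr_inl (i : Fin m) : jointBasis M m (Sum.inr (Sum.inl i)) = dirXi M m i := by
  simp [jointBasis, dirXi]

lemma jointBasis_inr_inr (i : Fin 1) : jointBasis M m (Sum.inr (Sum.inr i)) = dirXin M m := by
  simp [jointBasis, dirXin]

lemma contDiff_jointDeriv (hF : ContDiff ℝ ∞ F) (β : Fin M → ℕ) (α : Fin m → ℕ) (k : ℕ) :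
    ContDiff ℝ ∞ (jointDeriv β α k F) :=
  contDiff_dirMultiDeriv (contDiff_dirMultiDeriv (contDiff_iterate_dirDeriv hF _ _) _ _ _) _ _ _

lemma jointDeriv_zero (F : Eu M × (Eu m × ℝ) → ℂ) : jointDeriv 0 0 0 F = F := by
  simp only [jointDeriv, dirMultiDeriv_zero, Function.iterate_zero_apply]

lemma exists_dirDeriv_jointBasis_jointDeriv (hF : ContDiff ℝ ∞ F) (β : Fin M → ℕ)
    (α : Fin m → ℕ) (k : ℕ) (i : Fin M ⊕ (Fin m ⊕ Fin 1)) :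
    ∃ (β' : Fin M → ℕ) (α' : Fin m → ℕ) (k' : ℕ),
      dirDeriv (jointBasis M m i) (jointDeriv β α k F) = jointDeriv β' α' k' F := by
  have hk := contDiff_iterate_dirDeriv hF (dirXin M m) k
  have hαk := contDiff_dirMultiDeriv hk (dirXi M m) α (List.finRange m)
  rcases i with i | i | i
  · refine ⟨β + Pi.single i 1, α, k, ?_⟩
    rw [jointBasis_inl, jointDeriv, dirDeriv_dirMultiDeriv_comm hαk,
      ← dirMultiDeriv_add_single hαk _ _ (List.nodup_finRange _) (List.mem_finRange i), jointDeriv]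
  · refine ⟨β, α + Pi.single i 1, k, ?_⟩
    rw [jointBasis_inr_inl, jointDeriv, dirDeriv_dirMultiDeriv_comm hαk,
      dirDeriv_dirMultiDeriv_comm hk,
      ← dirMultiDeriv_add_single hk _ _ (List.nodup_finRange _) (List.mem_finRange i), jointDeriv]
  · refine ⟨β, α, k + 1, ?_⟩
    rw [jointBasis_inr_inr, jointDeriv, dirDeriv_dirMultiDeriv_comm hαk,
      dirDeriv_dirMultiDeriv_comm hk, ← Function.iterate_succ_apply' (dirDeriv (dirXin M m)),
      jointDeriv]

lemma bracketFull_rpow_le_one (η : Eu m) (t : ℝ) {r : ℝ} (hr : r ≤ 0) :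
    bracketFull η t ^ r ≤ 1 :=
  Real.rpow_le_one_of_one_le_of_nonpos
    (Real.one_le_sqrt.2 (le_add_of_nonneg_right (by positivity))) hr

lemma IsSymbol.exists_norm_jointDeriv_le {q : Eu M → Eu m → ℝ → ℂ} {r : ℝ} (hr : r ≤ 0)
    (hq : IsSymbol r q) (β : Fin M → ℕ) (α : Fin m → ℕ) (k : ℕ) :
    ∃ C : ℝ, ∀ p, ‖jointDeriv β α k (joint q) p‖ ≤ C := by
  obtain ⟨C, hC⟩ := hq.2 β α k
  refine ⟨|C|, fun ⟨X, η, t⟩ => ?_⟩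
  rw [← symDeriv_eq_jointDeriv hq.1]
  have hexp : r - ((∑ i, α i : ℕ) + k : ℝ) ≤ 0 := sub_nonpos.2 (hr.trans (by positivity))
  calc ‖symDeriv β α k q X η t‖
      ≤ C * bracketFull η t ^ (r - ((∑ i, α i : ℕ) + k : ℝ)) := hC X η t
    _ ≤ |C| * bracketFull η t ^ (r - ((∑ i, α i : ℕ) + k : ℝ)) :=
        mul_le_mul_of_nonneg_right (le_abs_self C) (Real.rpow_nonneg (Real.sqrt_nonneg _) _)
    _ ≤ |C| := mul_le_of_le_one_right (abs_nonneg C) (bracketFull_rpow_le_one η t hexp)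

lemma IsSymbol.locSmoothBdd_joint {q : Eu M → Eu m → ℝ → ℂ} {r : ℝ} (hr : r ≤ 0)
    (hq : IsSymbol r q) : LocSmoothBdd univ (joint q) := by
  have hq' : ContDiff ℝ ∞ (joint q) := hq.1
  refine fun v => ⟨univ, isOpen_univ, mem_univ v, hq'.contDiffOn, fun n => ?_⟩
  refine exists_bound_iteratedFDeriv_of_dirDeriv (jointBasis M m)
    (W := {F | ∃ β α k, F = jointDeriv β α k (joint q)}) ?_ ?_ ?_ n (joint q)
      ⟨0, 0, 0, (jointDeriv_zero _).symm⟩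
  · rintro F ⟨β, α, k, rfl⟩
    exact contDiff_jointDeriv hq' β α k
  · rintro F ⟨β, α, k, rfl⟩ i
    exact exists_dirDeriv_jointBasis_jointDeriv hq' β α k i
  · rintro F ⟨β, α, k, rfl⟩
    exact (hq.exists_norm_jointDeriv_le hr β α k).imp fun _ hC p _ => hC p

end Symbols

section Transmission

variable {M m : ℕ} {q : Eu M → Eu m → ℝ → ℂ}

/-- The jump `q (x, -ζ, -1) - q (x, ζ, 1)` across `ξ_n = ∞` of a symbol that is homogeneous of
degree `0`; the transmission property makes it vanish to infinite order at `ζ = 0`. -/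
def transmissionDefect (q : Eu M → Eu m → ℝ → ℂ) : Eu M × Eu m → ℂ :=
  fun z => q z.1 (-z.2) (-1) - q z.1 z.2 1

lemma contDiff_transmissionDefect (hq : JointlySmooth q) :
    ContDiff ℝ ∞ (transmissionDefect q) := by
  have hq' : ContDiff ℝ ∞ (joint q) := hq
  exact (hq'.comp (contDiff_fst.prodMk (contDiff_snd.neg.prodMk contDiff_const))).sub
    (hq'.comp (contDiff_fst.prodMk (contDiff_snd.prodMk contDiff_const)))

lemma multiDeriv_comp_neg {k : ℕ} {g : Eu k → ℂ} (hg : ContDiff ℝ ∞ g) (α : Fin k → ℕ) :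
    multiDeriv α (fun ζ => g (-ζ)) = fun ζ => (-1) ^ (∑ i, α i) * multiDeriv α g (-ζ) := by
  have hcomp := dirMultiDeriv_comp_affine hg (fun i => EuclideanSpace.single i (1 : ℝ)) α
    (List.finRange k) (-ContinuousLinearMap.id ℝ (Eu k)) 0
  simp only [neg_apply, ContinuousLinearMap.id_apply, add_zero] at hcomp
  rw [multiDeriv_eq_dirMultiDeriv, ← hcomp, dirMultiDeriv_neg hg, ← Fin.sum_univ_def,
    multiDeriv_eq_dirMultiDeriv]

lemma multiDeriv_transmissionDefect_zero (hq : JointlySmooth q) (ht : ZeroTransmission q)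
    (α : Fin m → ℕ) (x : Eu M) : multiDeriv α (fun ζ => transmissionDefect q (x, ζ)) 0 = 0 := by
  have hq' : ContDiff ℝ ∞ (joint q) := hq
  have hslice (t : ℝ) : ContDiff ℝ ∞ (fun ζ => q x ζ t) :=
    hq'.comp (contDiff_const.prodMk (contDiff_id.prodMk contDiff_const))
  have htα := ht 0 α 0 x 1 (by simp)
  simp only [symDeriv, iteratedDeriv_zero, add_zero, multiDeriv_eq_dirMultiDeriv (0 : Fin M → ℕ),
    dirMultiDeriv_zero] at htα
  have hsub := congrFun (dirMultiDeriv_sub ((hslice (-1)).comp contDiff_neg) (hslice 1)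
    (fun i => EuclideanSpace.single i (1 : ℝ)) α (List.finRange m)) 0
  refine hsub.trans ?_
  rw [← multiDeriv_eq_dirMultiDeriv, ← multiDeriv_eq_dirMultiDeriv]
  change multiDeriv α (fun ζ => q x (-ζ) (-1)) 0 - _ = 0
  rw [congrFun (multiDeriv_comp_neg (hslice (-1)) α) 0, neg_zero, htα, ← mul_assoc, ← mul_pow]
  simp

lemma flatAt_of_multiDeriv_slice_eq_zero {F : Eu M × Eu m → ℂ} (hF : ContDiff ℝ ∞ F)
    (h : ∀ α x, multiDeriv α (fun ζ => F (x, ζ)) 0 = 0) (x : Eu M) : FlatAt F (x, 0) := by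
  let b := (EuclideanSpace.basisFun (Fin M) ℝ).toBasis.prod
    (EuclideanSpace.basisFun (Fin m) ℝ).toBasis
  let e : Fin m → Eu M × Eu m := fun i => (0, EuclideanSpace.single i 1)
  have hslice (α : Fin m → ℕ) (x : Eu M) :
      dirMultiDeriv e α (List.finRange m) F (x, 0) = 0 := by
    have hcomp := congrFun (dirMultiDeriv_comp_affine hF
      (fun i => EuclideanSpace.single i (1 : ℝ)) α (List.finRange m)
      (ContinuousLinearMap.inr ℝ (Eu M) (Eu m)) (x, 0)) 0
    simp only [ContinuousLinearMap.inr_apply, Prod.mk_add_mk, zero_add, add_zero] at hcomp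
    exact hcomp.trans (h α x)
  intro n
  refine iteratedFDeriv_eq_zero_of_dirDeriv b (W := {F | ContDiff ℝ ∞ F ∧
    ∀ α x, dirMultiDeriv e α (List.finRange m) F (x, 0) = 0}) (fun F hF => hF.1) ?_ ?_ n _
    ⟨hF, hslice⟩
  · rintro F ⟨hF, hF0⟩ (i | i)
    · refine ⟨contDiff_dirDeriv hF _, fun α x => ?_⟩
      rw [← dirDeriv_dirMultiDeriv_comm hF]
      have hcomp := congrFun (dirDeriv_comp_affine
        (contDiff_dirMultiDeriv hF e α (List.finRange m))
        (ContinuousLinearMap.inl ℝ (Eu M) (Eu m)) 0 (EuclideanSpace.single i (1 : ℝ))) x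
      simp only [ContinuousLinearMap.inl_apply, add_zero, hF0] at hcomp
      simpa [b, dirDeriv] using hcomp
    · refine ⟨contDiff_dirDeriv hF _, fun α x => ?_⟩
      rw [show b (Sum.inr i) = e i by simp [b, e],
        ← dirMultiDeriv_add_single hF _ _ (List.nodup_finRange _) (List.mem_finRange i)]
      exact hF0 _ _
  · rintro F ⟨-, hF0⟩
    simpa only [dirMultiDeriv_zero] using hF0 0 x

lemma flatAt_transmissionDefect (hq : JointlySmooth q) (ht : ZeroTransmission q) (x : Eu M) :
    FlatAt (transmissionDefect q) (x, 0) :=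
  flatAt_of_multiDeriv_slice_eq_zero (contDiff_transmissionDefect hq)
    (multiDeriv_transmissionDefect_zero hq ht) x

end Transmission

section Circle

variable {M m : ℕ} {q : Eu M → Eu m → ℝ → ℂ} {S : Set (Eu M)}

/-- The chart at infinity of a symbol that is homogeneous of degree `0` and has the transmission
property: near `u = 0` it is the smooth continuation of `q (x, ξ', u⁻¹)`. It is written as a
perturbation of the one-sided continuation by a term that is flat on `u = 0`. -/
def chartAtInfinity (q : Eu M → Eu m → ℝ → ℂ) : Eu M × (Eu m × ℝ) → ℂ := fun p =>
  q p.1 (p.2.2 • p.2.1) 1 +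
    {p : Eu M × (Eu m × ℝ) | p.2.2 < 0}.indicator
      (fun p => transmissionDefect q (p.1, p.2.2 • p.2.1)) p

lemma chartAtInfinity_zero (q : Eu M → Eu m → ℝ → ℂ) (x : Eu M) (η : Eu m) :
    chartAtInfinity q (x, η, 0) = q x 0 1 := by simp [chartAtInfinity]

lemma outsideUnitBall_of_abs_eq_one (ζ : Eu m) {t : ℝ} (ht : |t| = 1) : OutsideUnitBall ζ t := by
  rw [OutsideUnitBall, Real.one_le_sqrt, ← sq_abs t, ht]
  nlinarith [sq_nonneg ‖ζ‖]

lemma chartAtInfinity_eq (hq : HomogeneousZero q) (x : Eu M) (η : Eu m) {u : ℝ} (hu : u ≠ 0)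
    (hu1 : |u| ≤ 1) : chartAtInfinity q (x, η, u) = q x η u⁻¹ := by
  rcases hu.lt_or_gt with hneg | hpos
  · have hscale := hq x (-(u • η)) (-1) (outsideUnitBall_of_abs_eq_one _ (by simp)) (-u)⁻¹
      ((one_le_inv₀ (by linarith)).2 (by rwa [abs_of_neg hneg] at hu1))
    rw [smul_neg, smul_smul, inv_neg, neg_mul, inv_mul_cancel₀ hu, neg_smul, one_smul, neg_neg,
      neg_mul_neg, mul_one] at hscale
    simp [chartAtInfinity, transmissionDefect, hneg, hscale]
  · have hscale := hq x (u • η) 1 (outsideUnitBall_of_abs_eq_one _ (by simp)) u⁻¹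
      ((one_le_inv₀ hpos).2 (by rwa [abs_of_pos hpos] at hu1))
    rw [smul_smul, inv_mul_cancel₀ hu, one_smul, mul_one] at hscale
    simp [chartAtInfinity, hpos.not_gt, hscale]

lemma LocSmoothBdd.chartAtInfinity (hb : LocSmoothBdd S (joint q)) (hq : JointlySmooth q)
    (ht : ZeroTransmission q) (hS : IsOpen S) : LocSmoothBdd S (chartAtInfinity q) := fun v => by
  have hscale : ContDiff ℝ ∞ (fun v : Eu m × ℝ => v.2 • v.1) := contDiff_snd.smul contDiff_fst
  have hright : LocSmoothBdd S (fun p : Eu M × (Eu m × ℝ) => q p.1 (p.2.2 • p.2.1) 1) :=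
    hb.comp_right (γ := fun v : Eu m × ℝ => (v.2 • v.1, (1 : ℝ))) hS
      (hscale.prodMk contDiff_const)
  have hleft : LocSmoothBdd S (fun p : Eu M × (Eu m × ℝ) => q p.1 (-(p.2.2 • p.2.1)) (-1)) :=
    hb.comp_right (γ := fun v : Eu m × ℝ => (-(v.2 • v.1), (-1 : ℝ))) hS
      (hscale.neg.prodMk contDiff_const)
  have hγ : ContDiff ℝ ∞ (fun p : Eu M × (Eu m × ℝ) => (p.1, p.2.2 • p.2.1)) :=
    contDiff_fst.prodMk (hscale.comp contDiff_snd)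
  have hflat (p : Eu M × (Eu m × ℝ)) (hp : p ∈ frontier {p : Eu M × (Eu m × ℝ) | p.2.2 < 0}) :
      FlatAt (fun p => transmissionDefect q (p.1, p.2.2 • p.2.1)) p := by
    have hp0 : p.2.2 = 0 := frontier_lt_subset_eq (f := fun p : Eu M × (Eu m × ℝ) => p.2.2)
      (by fun_prop) continuous_const hp
    refine FlatAt.comp ?_ (contDiff_transmissionDefect hq) hγ
    rw [hp0, zero_smul]
    exact flatAt_transmissionDefect hq ht p.1
  obtain ⟨N, hN, hv, hdefect⟩ := (hleft v).sub (hright v) hS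
  exact (hright v).add
    ⟨N, hN, hv, hdefect.indicator ((contDiff_transmissionDefect hq).comp hγ) hflat⟩ hS

/-- The symbol in the coordinate `φ` on the circle with `ξ_n = cot (φ / 2)`. -/
def circleSymbol (q : Eu M → Eu m → ℝ → ℂ) : Eu M × (Eu m × ℝ) → ℂ := fun p =>
  if Real.sin (p.2.2 / 2) = 0 then q p.1 0 1
  else q p.1 p.2.1 (Real.cos (p.2.2 / 2) / Real.sin (p.2.2 / 2))

lemma circleSymbol_add_two_pi (q : Eu M → Eu m → ℝ → ℂ) (x : Eu M) (η : Eu m) (φ : ℝ) :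
    circleSymbol q (x, η, φ + 2 * Real.pi) = circleSymbol q (x, η, φ) := by
  have hhalf : (φ + 2 * Real.pi) / 2 = φ / 2 + Real.pi := by ring
  simp [circleSymbol, hhalf, Real.sin_add_pi, Real.cos_add_pi]

lemma LocSmoothBddAt.circleSymbol_of_sin_eq_zero {η : Eu m} {φ : ℝ}
    (hb : LocSmoothBdd S (chartAtInfinity q)) (hhom : HomogeneousZero q) (hS : IsOpen S)
    (hsin : Real.sin (φ / 2) = 0) : LocSmoothBddAt S (circleSymbol q) (η, φ) := by
  have hcos : Real.cos (φ / 2) ≠ 0 := fun hcos => by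
    simpa [hsin, hcos] using Real.sin_sq_add_cos_sq (φ / 2)
  let U : Set (Eu m × ℝ) := {v | Real.cos (v.2 / 2) ≠ 0}
  have hU : IsOpen U := isOpen_ne_fun (by fun_prop) continuous_const
  have hγ : ContDiffOn ℝ ∞
      (fun v : Eu m × ℝ => (v.1, Real.sin (v.2 / 2) / Real.cos (v.2 / 2))) U :=
    contDiff_fst.contDiffOn.prodMk
      ((Real.contDiff_sin.comp (contDiff_snd.div_const 2)).contDiffOn.div
        (Real.contDiff_cos.comp (contDiff_snd.div_const 2)).contDiffOn fun v hv => hv)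
  have hsmall : ∀ᶠ v in 𝓝 (η, φ), |Real.sin (v.2 / 2) / Real.cos (v.2 / 2)| < 1 :=
    ((hγ.continuousOn.snd.continuousAt (hU.mem_nhds hcos)).abs).eventually_lt_const
      (by simp [hsin])
  refine ((hb _).comp_right hS hU (w := (η, φ)) hcos hγ).congr hS ?_
  filter_upwards [hsmall, hU.mem_nhds hcos] with v hv hcosv x _
  simp only [circleSymbol]
  split_ifs with hsinv
  · rw [hsinv, zero_div, chartAtInfinity_zero]
  · rw [chartAtInfinity_eq hhom _ _ (div_ne_zero hsinv hcosv) hv.le, inv_div]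

lemma LocSmoothBddAt.circleSymbol_of_sin_ne_zero {η : Eu m} {φ : ℝ}
    (hb : LocSmoothBdd S (joint q)) (hS : IsOpen S) (hsin : Real.sin (φ / 2) ≠ 0) :
    LocSmoothBddAt S (circleSymbol q) (η, φ) := by
  let U : Set (Eu m × ℝ) := {v | Real.sin (v.2 / 2) ≠ 0}
  have hU : IsOpen U := isOpen_ne_fun (by fun_prop) continuous_const
  have hγ : ContDiffOn ℝ ∞
      (fun v : Eu m × ℝ => (v.1, Real.cos (v.2 / 2) / Real.sin (v.2 / 2))) U :=
    contDiff_fst.contDiffOn.prodMk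
      ((Real.contDiff_cos.comp (contDiff_snd.div_const 2)).contDiffOn.div
        (Real.contDiff_sin.comp (contDiff_snd.div_const 2)).contDiffOn fun v hv => hv)
  refine ((hb _).comp_right hS hU (w := (η, φ)) hsin hγ).congr hS ?_
  filter_upwards [hU.mem_nhds hsin] with v hv x _
  exact if_neg hv

lemma LocSmoothBdd.circleSymbol (hb : LocSmoothBdd S (joint q)) (hq : JointlySmooth q)
    (hhom : HomogeneousZero q) (ht : ZeroTransmission q) (hS : IsOpen S) :
    LocSmoothBdd S (circleSymbol q) := fun ⟨_, φ⟩ => by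
  by_cases hsin : Real.sin (φ / 2) = 0
  · exact .circleSymbol_of_sin_eq_zero (hb.chartAtInfinity hq ht hS) hhom hS hsin
  · exact .circleSymbol_of_sin_ne_zero hb hS hsin

end Circle

section HardyKernel

open Complex (I)
open scoped ComplexConjugate

lemma summable_one_div_succ_sq : Summable (fun n : ℕ => 1 / ((n : ℝ) + 1) ^ 2) := by
  simpa using (summable_nat_add_iff 1).2 (Real.summable_one_div_nat_pow.2 one_lt_two)

/-- The term of frequency `k = n + 1` in the Fourier series of `hardyKernel`. -/
def hardyKernelTerm (n : ℕ) (s : ℝ) : ℂ :=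
  -(1 / ((n : ℂ) + 1) ^ 2) * Complex.exp (((n : ℂ) + 1) * I * s)

/-- The kernel `- ∑ e^{iks} / k²`, summed over `k ≥ 1`: the second periodic primitive of the kernel
of the projection onto positive frequencies. -/
def hardyKernel (s : ℝ) : ℂ := ∑' n : ℕ, hardyKernelTerm n s

lemma norm_hardyKernelTerm (n : ℕ) (s : ℝ) : ‖hardyKernelTerm n s‖ = 1 / ((n : ℝ) + 1) ^ 2 := by
  have hphase : ((n : ℂ) + 1) * I * s = (((n : ℝ) + 1) * s : ℝ) * I := by push_cast; ring
  have hn : ‖(n : ℂ) + 1‖ = (n : ℝ) + 1 := by exact_mod_cast Complex.norm_natCast (n + 1)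
  rw [hardyKernelTerm, norm_mul, hphase, Complex.norm_exp_ofReal_mul_I, mul_one, norm_neg,
    norm_div, norm_pow, hn, norm_one]

lemma continuous_hardyKernelTerm (n : ℕ) : Continuous (hardyKernelTerm n) := by
  unfold hardyKernelTerm
  fun_prop

lemma continuous_hardyKernel : Continuous hardyKernel :=
  continuous_tsum continuous_hardyKernelTerm summable_one_div_succ_sq
    fun n s => (norm_hardyKernelTerm n s).le

lemma hasSum_hardyKernel (s : ℝ) : HasSum (fun n => hardyKernelTerm n s) (hardyKernel s) :=
  (Summable.of_norm
    (by simpa only [norm_hardyKernelTerm] using summable_one_div_succ_sq)).hasSum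

lemma eval_bernoulli_two (x : ℝ) :
    ((Polynomial.bernoulli 2).map (algebraMap ℚ ℝ)).eval x = x ^ 2 - x + 1 / 6 := by
  rw [Polynomial.bernoulli_def]
  simp [Finset.sum_range_succ, bernoulli_one, bernoulli_two]
  ring

lemma hasSum_cos_div_succ_sq {s : ℝ} (hs : s ∈ Icc 0 (2 * Real.pi)) :
    HasSum (fun n : ℕ => 1 / ((n : ℝ) + 1) ^ 2 * Real.cos (((n : ℝ) + 1) * s))
      (Real.pi ^ 2 / 6 - Real.pi * s / 2 + s ^ 2 / 4) := by
  have hx : s / (2 * Real.pi) ∈ Icc (0 : ℝ) 1 :=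
    ⟨div_nonneg hs.1 Real.two_pi_pos.le, (div_le_one Real.two_pi_pos).2 hs.2⟩
  have hbernoulli := hasSum_one_div_nat_pow_mul_cos one_ne_zero hx
  simp only [mul_one] at hbernoulli
  rw [eval_bernoulli_two] at hbernoulli
  have hval : (-1) ^ (1 + 1) * (2 * Real.pi) ^ 2 / 2 / (Nat.factorial 2) *
        ((s / (2 * Real.pi)) ^ 2 - s / (2 * Real.pi) + 1 / 6) =
      Real.pi ^ 2 / 6 - Real.pi * s / 2 + s ^ 2 / 4 + ∑ i ∈ Finset.range 1,
        1 / (i : ℝ) ^ 2 * Real.cos (2 * Real.pi * i * (s / (2 * Real.pi))) := by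
    simp [Nat.factorial]
    field_simp
    ring
  rw [hval] at hbernoulli
  refine ((hasSum_nat_add_iff 1).2 hbernoulli).congr_fun fun n => ?_
  push_cast
  congr 2
  field_simp

/-- The parabola `2 Re (hardyKernel s)` on the period `[0, 2π]`. -/
def hardyParabola (s : ℝ) : ℝ := -(Real.pi ^ 2 / 3) + Real.pi * s - s ^ 2 / 2

lemma hardyKernelTerm_add_conj (n : ℕ) (s : ℝ) :
    hardyKernelTerm n s + conj (hardyKernelTerm n s) =
      -2 * ((1 / ((n : ℝ) + 1) ^ 2 * Real.cos (((n : ℝ) + 1) * s) : ℝ) : ℂ) := by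
  rw [Complex.add_conj, hardyKernelTerm,
    show -(1 / ((n : ℂ) + 1) ^ 2) = ((-(1 / ((n : ℝ) + 1) ^ 2) : ℝ) : ℂ) by push_cast; rfl,
    show ((n : ℂ) + 1) * I * s = ((((n : ℝ) + 1) * s : ℝ) : ℂ) * I by push_cast; ring,
    Complex.re_ofReal_mul, Complex.exp_ofReal_mul_I_re]
  push_cast
  ring

lemma hardyKernel_add_conj {s : ℝ} (hs : s ∈ Icc 0 (2 * Real.pi)) :
    hardyKernel s + conj (hardyKernel s) = (hardyParabola s : ℂ) := by
  have hsum := (hasSum_hardyKernel s).add (Complex.hasSum_conj'.2 (hasSum_hardyKernel s))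
  simp_rw [hardyKernelTerm_add_conj] at hsum
  rw [hsum.unique ((Complex.hasSum_ofReal.2 (hasSum_cos_div_succ_sq hs)).mul_left (-2)),
    hardyParabola]
  push_cast
  ring

end HardyKernel

section HardyProjection

open Complex (I)
open scoped ComplexConjugate

/-- The part of a periodic function with positive frequencies, normalized to vanish at `0`. Two
derivatives are moved from the singular projection kernel to `ψ`. -/
def hardyProj (ψ : ℝ → ℂ) (φ : ℝ) : ℂ :=
  (2 * Real.pi : ℂ)⁻¹ * ∫ s in (0 : ℝ)..2 * Real.pi,
    hardyKernel s * (deriv (deriv ψ) (φ - s) - deriv (deriv ψ) (0 - s))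

lemma periodic_deriv {ψ : ℝ → ℂ} {T : ℝ} (h : Function.Periodic ψ T) :
    Function.Periodic (deriv ψ) T := fun x => by
  rw [← deriv_comp_add_const, show (fun x => ψ (x + T)) = ψ from funext h]

lemma integral_comp_sub_left_of_periodic {f : ℝ → ℂ} {T : ℝ} (hf : Function.Periodic f T)
    (φ : ℝ) : ∫ s in (0 : ℝ)..T, f (φ - s) = ∫ s in (0 : ℝ)..T, f s := by
  rw [intervalIntegral.integral_comp_sub_left, sub_zero]
  simpa using hf.intervalIntegral_add_eq (φ - T) 0

lemma hasDerivAt_hardyParabola (s : ℝ) :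
    HasDerivAt (fun s => (hardyParabola s : ℂ)) ((Real.pi - s : ℝ) : ℂ) s := by
  refine HasDerivAt.ofReal_comp ?_
  have hsum := (((hasDerivAt_id s).const_mul Real.pi).const_add (-(Real.pi ^ 2 / 3))).sub
    (((hasDerivAt_id s).pow 2).div_const 2)
  exact hsum.congr_deriv (by simp)

lemma hasDerivAt_primitive_hardyParabola_mul {ψ : ℝ → ℂ} (hψ : ContDiff ℝ 2 ψ) (φ s : ℝ) :
    HasDerivAt (fun s : ℝ => -(hardyParabola s : ℂ) * deriv ψ (φ - s)
        - ((Real.pi - s : ℝ) : ℂ) * ψ (φ - s))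
      (hardyParabola s * deriv (deriv ψ) (φ - s) + ψ (φ - s)) s := by
  have hψ' : ContDiff ℝ 1 (deriv ψ) := hψ.deriv'
  have hlinear : HasDerivAt (fun s : ℝ => ((Real.pi - s : ℝ) : ℂ)) ((-1 : ℝ) : ℂ) s :=
    HasDerivAt.ofReal_comp (by simpa using (hasDerivAt_id s).const_sub Real.pi)
  refine (((hasDerivAt_hardyParabola s).fun_neg.mul
    ((hψ'.differentiable (by simp) (φ - s)).hasDerivAt.comp_const_sub φ s)).sub
    (hlinear.mul
      ((hψ.differentiable (by simp) (φ - s)).hasDerivAt.comp_const_sub φ s))).congr_deriv ?_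
  push_cast
  ring

lemma integral_hardyParabola_mul {ψ : ℝ → ℂ} (hψ : ContDiff ℝ 2 ψ)
    (hp : Function.Periodic ψ (2 * Real.pi)) (φ : ℝ) :
    ∫ s in (0 : ℝ)..2 * Real.pi, hardyParabola s * deriv (deriv ψ) (φ - s) =
      2 * Real.pi * ψ φ - ∫ s in (0 : ℝ)..2 * Real.pi, ψ s := by
  have : Continuous (deriv (deriv ψ)) := hψ.deriv'.continuous_deriv_one
  have hψc := hψ.continuous
  have hparabola : Continuous hardyParabola := by unfold hardyParabola; fun_prop
  have hint₁ : Continuous (fun s : ℝ => hardyParabola s * deriv (deriv ψ) (φ - s)) := by fun_prop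
  have hint₂ : Continuous (fun s : ℝ => ψ (φ - s)) := by fun_prop
  rw [eq_sub_iff_add_eq, ← integral_comp_sub_left_of_periodic hp φ,
    ← intervalIntegral.integral_add (hint₁.intervalIntegrable _ _) (hint₂.intervalIntegrable _ _),
    intervalIntegral.integral_eq_sub_of_hasDerivAt
      (fun s _ => hasDerivAt_primitive_hardyParabola_mul hψ φ s)
      ((hint₁.add hint₂).intervalIntegrable _ _),
    hp.sub_eq φ, (periodic_deriv hp).sub_eq φ]
  simp only [hardyParabola]
  push_cast
  simp
  ring

lemma deriv_conj (ψ : ℝ → ℂ) : deriv (fun s => conj (ψ s)) = fun s => conj (deriv ψ s) :=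
  funext fun _ => deriv.star

lemma hardyProj_add_conj {ψ : ℝ → ℂ} (hψ : ContDiff ℝ 2 ψ)
    (hp : Function.Periodic ψ (2 * Real.pi)) (φ : ℝ) :
    hardyProj ψ φ + conj (hardyProj (fun s => conj (ψ s)) φ) = ψ φ - ψ 0 := by
  have : Continuous (deriv (deriv ψ)) := hψ.deriv'.continuous_deriv_one
  have hkernel := continuous_hardyKernel
  have hparabola : Continuous hardyParabola := by unfold hardyParabola; fun_prop
  have hreal : ∀ s ∈ uIcc 0 (2 * Real.pi),
      hardyKernel s * (deriv (deriv ψ) (φ - s) - deriv (deriv ψ) (0 - s)) +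
          conj (hardyKernel s) * (deriv (deriv ψ) (φ - s) - deriv (deriv ψ) (0 - s)) =
        hardyParabola s * deriv (deriv ψ) (φ - s) - hardyParabola s * deriv (deriv ψ) (0 - s) := by
    intro s hs
    rw [uIcc_of_le Real.two_pi_pos.le] at hs
    rw [← add_mul, hardyKernel_add_conj hs, mul_sub]
  simp only [hardyProj, deriv_conj]
  rw [map_mul, ← intervalIntegral.intervalIntegral_conj]
  simp only [map_mul, map_sub, map_inv₀, Complex.conj_conj, Complex.conj_ofReal, map_ofNat]
  rw [← mul_add, ← intervalIntegral.integral_add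
      ((by fun_prop : Continuous _).intervalIntegrable _ _)
      ((by fun_prop : Continuous _).intervalIntegrable _ _),
    intervalIntegral.integral_congr hreal, intervalIntegral.integral_sub
      ((by fun_prop : Continuous _).intervalIntegrable _ _)
      ((by fun_prop : Continuous _).intervalIntegrable _ _),
    integral_hardyParabola_mul hψ hp, integral_hardyParabola_mul hψ hp]
  have hpi : (Real.pi : ℂ) ≠ 0 := mod_cast Real.pi_ne_zero
  field_simp
  ring

/-- The integral of `g (r) e^{-ikr}` over a period, with `k = n + 1`. -/
def fourierIntegralSucc (g : ℝ → ℂ) (n : ℕ) : ℂ :=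
  ∫ r in (0 : ℝ)..2 * Real.pi, Complex.exp (-((n : ℂ) + 1) * I * r) * g r

lemma norm_fourierIntegralSucc_le {g : ℝ → ℂ} {C : ℝ} (hC : ∀ s, ‖g s‖ ≤ C) (n : ℕ) :
    ‖fourierIntegralSucc g n‖ ≤ C * (2 * Real.pi) := by
  have hexp (r : ℝ) : ‖Complex.exp (-((n : ℂ) + 1) * I * r)‖ = 1 := by
    rw [show -((n : ℂ) + 1) * I * r = ((-((n : ℝ) + 1) * r : ℝ) : ℂ) * I by push_cast; ring]
    exact Complex.norm_exp_ofReal_mul_I _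
  refine (intervalIntegral.norm_integral_le_of_norm_le_const (C := C) fun r _ => ?_).trans_eq ?_
  · rw [norm_mul, hexp, one_mul]
    exact hC r
  · rw [sub_zero, abs_of_pos Real.two_pi_pos]

lemma integral_hardyKernelTerm_mul {g : ℝ → ℂ} (hg : Function.Periodic g (2 * Real.pi)) (n : ℕ)
    (φ : ℝ) : ∫ s in (0 : ℝ)..2 * Real.pi, hardyKernelTerm n s * g (φ - s) =
      -(1 / ((n : ℂ) + 1) ^ 2) * fourierIntegralSucc g n * Complex.exp (φ * I) ^ (n + 1) := by
  have hper : Function.Periodic (fun r : ℝ => Complex.exp (-((n : ℂ) + 1) * I * r) * g r)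
      (2 * Real.pi) := fun r => by
    simp only [hg r]
    rw [show -((n : ℂ) + 1) * I * ((r + 2 * Real.pi : ℝ) : ℂ) =
      -((n : ℂ) + 1) * I * r + ((-((n : ℤ) + 1) : ℤ) : ℂ) * (2 * Real.pi * I) by push_cast; ring,
      Complex.exp_add, Complex.exp_int_mul_two_pi_mul_I, mul_one]
  have hphase (s : ℝ) : Complex.exp (((n : ℂ) + 1) * I * s) =
      Complex.exp (φ * I) ^ (n + 1) * Complex.exp (-((n : ℂ) + 1) * I * ((φ - s : ℝ) : ℂ)) := by
    rw [← Complex.exp_nat_mul, ← Complex.exp_add]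
    congr 1
    push_cast
    ring
  rw [fourierIntegralSucc, ← integral_comp_sub_left_of_periodic hper φ, mul_right_comm,
    ← intervalIntegral.integral_const_mul]
  refine intervalIntegral.integral_congr fun s _ => ?_
  simp only [hardyKernelTerm, hphase s]
  ring

lemma hasSum_integral_hardyKernel_mul {g : ℝ → ℂ} {C : ℝ} (hg : Continuous g)
    (hp : Function.Periodic g (2 * Real.pi)) (hC : ∀ s, ‖g s‖ ≤ C) (φ : ℝ) :
    HasSum (fun n : ℕ => -(1 / ((n : ℂ) + 1) ^ 2) * fourierIntegralSucc g n *
        Complex.exp (φ * I) ^ (n + 1))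
      (∫ s in (0 : ℝ)..2 * Real.pi, hardyKernel s * g (φ - s)) := by
  simp only [← integral_hardyKernelTerm_mul hp]
  refine intervalIntegral.hasSum_integral_of_dominated_convergence
    (fun n _ => 1 / ((n : ℝ) + 1) ^ 2 * C) (fun n => ?_) (fun n => ?_)
    (.of_forall fun s _ => summable_one_div_succ_sq.mul_right C) intervalIntegrable_const
    (.of_forall fun s _ => (hasSum_hardyKernel s).mul_right _)
  · exact ((continuous_hardyKernelTerm n).mul (hg.comp (by fun_prop))).aestronglyMeasurable
  · refine .of_forall fun s _ => ?_
    rw [norm_mul, norm_hardyKernelTerm]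
    gcongr
    exact hC _

lemma diffContOnCl_tsum_pow_sub_one {b : ℕ → ℂ} {u : ℕ → ℝ} (hu : Summable u)
    (hb : ∀ n, ‖b n‖ ≤ u n) :
    DiffContOnCl ℂ (fun w => ∑' n, b n * (w ^ (n + 1) - 1)) (Metric.ball 0 1) := by
  have hterm (n : ℕ) (w : ℂ) (hw : w ∈ Metric.closedBall (0 : ℂ) 1) :
      ‖b n * (w ^ (n + 1) - 1)‖ ≤ u n * 2 := by
    rw [mem_closedBall_zero_iff] at hw
    have htwo : ‖w ^ (n + 1) - 1‖ ≤ 2 := by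
      refine (norm_sub_le _ _).trans ?_
      rw [norm_pow, norm_one]
      linarith [pow_le_one₀ (n := n + 1) (norm_nonneg w) hw]
    rw [norm_mul]
    exact mul_le_mul (hb n) htwo (norm_nonneg _) ((norm_nonneg _).trans (hb n))
  refine ⟨Complex.differentiableOn_tsum_of_summable_norm (hu.mul_right 2) (fun n => by fun_prop)
    Metric.isOpen_ball fun n w hw => hterm n w (Metric.ball_subset_closedBall hw), ?_⟩
  rw [closure_ball _ one_ne_zero]
  exact continuousOn_tsum (fun n => by fun_prop) (hu.mul_right 2) hterm

lemma exists_norm_le_of_periodic {g : ℝ → ℂ} {T : ℝ} (hT : 0 < T) (hg : Continuous g)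
    (hp : Function.Periodic g T) : ∃ C, ∀ s, ‖g s‖ ≤ C := by
  obtain ⟨C, hC⟩ := (isCompact_Icc (a := (0 : ℝ)) (b := T)).exists_bound_of_continuousOn
    hg.continuousOn
  refine ⟨C, fun s => ?_⟩
  obtain ⟨y, hy, hys⟩ := hp.exists_mem_Ico₀ hT s
  exact hys ▸ hC y ⟨hy.1, hy.2.le⟩

lemma hasSum_hardyProj {ψ : ℝ → ℂ} {C : ℝ} (hψ : ContDiff ℝ 2 ψ)
    (hp : Function.Periodic ψ (2 * Real.pi)) (hC : ∀ s, ‖deriv (deriv ψ) s‖ ≤ C) (φ : ℝ) :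
    HasSum (fun n : ℕ => (2 * Real.pi : ℂ)⁻¹ * (-(1 / ((n : ℂ) + 1) ^ 2) *
      fourierIntegralSucc (deriv (deriv ψ)) n) * (Complex.exp (φ * I) ^ (n + 1) - 1))
      (hardyProj ψ φ) := by
  have hψ'' : Continuous (deriv (deriv ψ)) := hψ.deriv'.continuous_deriv_one
  have hkernel := continuous_hardyKernel
  have hsum := hasSum_integral_hardyKernel_mul hψ'' (periodic_deriv (periodic_deriv hp)) hC
  have hdiff := ((hsum φ).sub (hsum 0)).mul_left ((2 * Real.pi : ℂ)⁻¹)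
  rw [← intervalIntegral.integral_sub ((by fun_prop : Continuous _).intervalIntegrable _ _)
    ((by fun_prop : Continuous _).intervalIntegrable _ _)] at hdiff
  simp_rw [← mul_sub] at hdiff
  refine hdiff.congr_fun fun n => ?_
  simp [mul_assoc]

lemma exists_hardyProj_eq_powerSeries {ψ : ℝ → ℂ} (hψ : ContDiff ℝ 2 ψ)
    (hp : Function.Periodic ψ (2 * Real.pi)) :
    ∃ A : ℂ → ℂ, DiffContOnCl ℂ A (Metric.ball 0 1) ∧ A 1 = 0 ∧
      ∀ φ : ℝ, hardyProj ψ φ = A (Complex.exp (φ * I)) := by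
  obtain ⟨C, hC⟩ := exists_norm_le_of_periodic Real.two_pi_pos hψ.deriv'.continuous_deriv_one
    (periodic_deriv (periodic_deriv hp))
  refine ⟨_, diffContOnCl_tsum_pow_sub_one (summable_one_div_succ_sq.mul_left C) fun n => ?_,
    by simp, fun φ => (hasSum_hardyProj hψ hp hC φ).tsum_eq.symm⟩
  have hn : ‖-(1 / ((n : ℂ) + 1) ^ 2)‖ = 1 / ((n : ℝ) + 1) ^ 2 := by
    simpa [hardyKernelTerm] using norm_hardyKernelTerm n 0
  have hpi : ‖(2 * Real.pi : ℂ)⁻¹‖ = (2 * Real.pi)⁻¹ := by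
    rw [norm_inv, norm_mul, Complex.norm_real, Real.norm_of_nonneg Real.pi_pos.le, Complex.norm_two]
  calc ‖(2 * Real.pi : ℂ)⁻¹ * (-(1 / ((n : ℂ) + 1) ^ 2) * fourierIntegralSucc _ n)‖
      = (2 * Real.pi)⁻¹ * (1 / ((n : ℝ) + 1) ^ 2 * ‖fourierIntegralSucc _ n‖) := by
        rw [norm_mul, norm_mul, hn, hpi]
    _ ≤ (2 * Real.pi)⁻¹ * (1 / ((n : ℝ) + 1) ^ 2 * (C * (2 * Real.pi))) := by
        gcongr
        exact norm_fourierIntegralSucc_le hC n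
    _ = C * (1 / ((n : ℝ) + 1) ^ 2) := by field_simp

end HardyProjection

section Uniqueness

open Complex (I)
open scoped ComplexConjugate

lemma re_nonpos_of_forall_mem_frontier {U : Set ℂ} (hU : Bornology.IsBounded U) {G : ℂ → ℂ}
    (hG : DiffContOnCl ℂ G U) (hre : ∀ w ∈ frontier U, (G w).re ≤ 0) {w : ℂ}
    (hw : w ∈ closure U) : (G w).re ≤ 0 := by
  have hexp : ‖Complex.exp (G w)‖ ≤ 1 :=
    Complex.norm_le_of_forall_mem_frontier_norm_le hU
      (Complex.differentiable_exp.diffContOnCl.comp hG (mapsTo_univ _ _))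
      (fun z hz => by simpa [Complex.norm_exp] using hre z hz) hw
  rwa [Complex.norm_exp, Real.exp_le_one_iff] at hexp

lemma eq_of_forall_mem_frontier_re_eq_zero {U : Set ℂ} (hU : Bornology.IsBounded U)
    (hUo : IsOpen U) (hUc : IsPreconnected U) {G : ℂ → ℂ} (hG : DiffContOnCl ℂ G U)
    (hre : ∀ w ∈ frontier U, (G w).re = 0) {w₁ w₂ : ℂ} (hw₁ : w₁ ∈ closure U)
    (hw₂ : w₂ ∈ closure U) : G w₁ = G w₂ := by
  have hle {w : ℂ} (hw : w ∈ closure U) : (G w).re ≤ 0 :=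
    re_nonpos_of_forall_mem_frontier hU hG (fun z hz => (hre z hz).le) hw
  have hge {w : ℂ} (hw : w ∈ closure U) : 0 ≤ (G w).re := by
    simpa using re_nonpos_of_forall_mem_frontier hU hG.neg (fun z hz => by simp [hre z hz]) hw
  obtain ⟨c, hc⟩ | hopen :=
    (hG.differentiableOn.analyticOnNhd hUo).is_constant_or_isOpen hUc
  · have hconst : EqOn G (fun _ => c) (closure U) :=
      (show EqOn G (fun _ => c) U from hc).of_subset_closure hG.continuousOn continuousOn_const
        subset_closure subset_rfl
    rw [hconst hw₁, hconst hw₂]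
  · have hneg : G '' U ⊆ {z | z.re < 0} := by
      rw [← Complex.interior_setOfPred_re_le]
      exact interior_maximal (image_subset_iff.2 fun w hw => hle (subset_closure hw))
        (hopen U subset_rfl hUo)
    obtain ⟨w, hw⟩ : U.Nonempty := closure_nonempty_iff.1 ⟨w₁, hw₁⟩
    exact absurd (hneg (mem_image_of_mem G hw)) (hge (subset_closure hw)).not_gt

lemma eq_zero_of_add_conj_eq_zero {A B : ℂ → ℂ} (hA : DiffContOnCl ℂ A (Metric.ball 0 1))
    (hB : DiffContOnCl ℂ B (Metric.ball 0 1)) (h : ∀ w : ℂ, ‖w‖ = 1 → A w + conj (B w) = 0)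
    (h1 : A 1 = 0) {w : ℂ} (hw : ‖w‖ ≤ 1) : A w = 0 := by
  have hconst {G : ℂ → ℂ} (hG : DiffContOnCl ℂ G (Metric.ball 0 1))
      (hre : ∀ w : ℂ, ‖w‖ = 1 → (G w).re = 0) : G w = G 1 :=
    eq_of_forall_mem_frontier_re_eq_zero Metric.isBounded_ball Metric.isOpen_ball
      (convex_ball (0 : ℂ) 1).isPreconnected hG
      (fun w hw => hre w (by simpa [frontier_ball] using hw))
      (by simpa [closure_ball] using hw) (by simp [closure_ball])
  have hadd : A w + B w = A 1 + B 1 := hconst (hA.add hB) fun w hw => by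
    simpa using congrArg Complex.re (h w hw)
  have hsub : I * (A w - B w) = I * (A 1 - B 1) := hconst ((hA.sub hB).const_smul I) fun w hw => by
    have him := congrArg Complex.im (h w hw)
    simp only [Complex.add_im, Complex.conj_im, Complex.zero_im] at him
    simp only [Pi.smul_apply, Pi.sub_apply, smul_eq_mul, Complex.I_mul_re, Complex.sub_im]
    linarith
  rw [← h1]
  linear_combination (hadd + mul_left_cancel₀ Complex.I_ne_zero hsub) / 2

end Uniqueness

section Cayley

open Complex (I)

/-- The Cayley transform of the lower half-plane to the unit disc. -/
def cayley (z : ℂ) : ℂ := (z + I) / (z - I)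

lemma sub_I_ne_zero {z : ℂ} (hz : z.im ≤ 0) : z - I ≠ 0 := fun h => by
  have him := congrArg Complex.im h
  simp only [Complex.sub_im, Complex.I_im, Complex.zero_im] at him
  linarith

lemma ofReal_sub_I_ne_zero (t : ℝ) : (t : ℂ) - I ≠ 0 := sub_I_ne_zero (by simp)

lemma sq_norm_add_I (z : ℂ) : ‖z + I‖ ^ 2 = ‖z - I‖ ^ 2 + 4 * z.im := by
  rw [← Complex.normSq_eq_norm_sq, ← Complex.normSq_eq_norm_sq, Complex.normSq_apply,
    Complex.normSq_apply]
  simp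
  ring

lemma norm_cayley_le_one {z : ℂ} (hz : z.im ≤ 0) : ‖cayley z‖ ≤ 1 := by
  rw [cayley, norm_div, div_le_one (norm_pos_iff.2 (sub_I_ne_zero hz)),
    ← sq_le_sq₀ (norm_nonneg _) (norm_nonneg _), sq_norm_add_I]
  linarith

lemma norm_cayley_lt_one {z : ℂ} (hz : z.im < 0) : ‖cayley z‖ < 1 := by
  rw [cayley, norm_div, div_lt_one (norm_pos_iff.2 (sub_I_ne_zero hz.le)),
    ← sq_lt_sq₀ (norm_nonneg _) (norm_nonneg _), sq_norm_add_I]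
  linarith

lemma norm_cayley_ofReal_le_one (t : ℝ) : ‖cayley t‖ ≤ 1 := norm_cayley_le_one (by simp)

lemma closure_lowerHalfPlane : closure {z : ℂ | z.im < 0} = {z : ℂ | z.im ≤ 0} :=
  Complex.closure_setOfPred_im_lt 0

lemma differentiableAt_cayley {z : ℂ} (hz : z.im ≤ 0) : DifferentiableAt ℂ cayley z := by
  have hz0 := sub_I_ne_zero hz
  unfold cayley
  fun_prop (disch := assumption)

lemma diffContOnCl_comp_cayley {A : ℂ → ℂ} (hA : DiffContOnCl ℂ A (Metric.ball 0 1)) :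
    DiffContOnCl ℂ (fun z => A (cayley z)) {z : ℂ | z.im < 0} := by
  have hcayley : DiffContOnCl ℂ cayley {z : ℂ | z.im < 0} := by
    refine DifferentiableOn.diffContOnCl fun z hz => ?_
    rw [closure_lowerHalfPlane] at hz
    exact (differentiableAt_cayley hz).differentiableWithinAt
  exact hA.comp hcayley fun z hz => mem_ball_zero_iff.2 (norm_cayley_lt_one hz)

lemma cayley_ofReal_ne_one (t : ℝ) : cayley t ≠ 1 := by
  rw [cayley, Ne, div_eq_one_iff_eq (ofReal_sub_I_ne_zero t)]
  exact fun h => absurd (congrArg Complex.im h) (by norm_num)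

/-- The inverse of the Cayley transform, with the junk value `0` at `1`, the image of infinity. -/
def invCayley (w : ℂ) : ℂ := I * (w + 1) / (w - 1)

lemma invCayley_cayley (t : ℝ) : invCayley (cayley t) = t := by
  rw [invCayley, div_eq_iff (sub_ne_zero.2 (cayley_ofReal_ne_one t)), cayley]
  have ht := ofReal_sub_I_ne_zero t
  field_simp
  ring

lemma im_invCayley (w : ℂ) : (invCayley w).im = (‖w‖ ^ 2 - 1) / ‖w - 1‖ ^ 2 := by
  rw [invCayley, Complex.div_im, ← Complex.normSq_eq_norm_sq, ← Complex.normSq_eq_norm_sq,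
    ← sub_div, Complex.normSq_apply w]
  congr 1
  simp
  ring

lemma im_invCayley_nonpos {w : ℂ} (hw : ‖w‖ ≤ 1) : (invCayley w).im ≤ 0 := by
  rw [im_invCayley]
  exact div_nonpos_of_nonpos_of_nonneg (sub_nonpos.2 (pow_le_one₀ (norm_nonneg w) hw))
    (by positivity)

lemma im_invCayley_neg {w : ℂ} (hw : ‖w‖ < 1) : (invCayley w).im < 0 := by
  have hw1 : w ≠ 1 := by
    rintro rfl
    simp at hw
  have hpos : 0 < ‖w - 1‖ := norm_pos_iff.2 (sub_ne_zero.2 hw1)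
  rw [im_invCayley]
  exact div_neg_of_neg_of_pos (sub_neg.2 (pow_lt_one₀ (norm_nonneg w) hw two_ne_zero))
    (by positivity)

lemma differentiableAt_invCayley {w : ℂ} (hw : w ≠ 1) : DifferentiableAt ℂ invCayley w := by
  have hsub : w - 1 ≠ 0 := sub_ne_zero.2 hw
  unfold invCayley
  fun_prop (disch := assumption)

lemma exists_cayley_ofReal_eq {w : ℂ} (hw : ‖w‖ = 1) (hw1 : w ≠ 1) : ∃ t : ℝ, cayley t = w := by
  have him : (invCayley w).im = 0 := by simp [im_invCayley, hw]
  refine ⟨(invCayley w).re, ?_⟩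
  have ht : ((invCayley w).re : ℂ) = invCayley w := Complex.conj_eq_iff_re.1
    (Complex.conj_eq_iff_im.2 him)
  have hsub : w - 1 ≠ 0 := sub_ne_zero.2 hw1
  rw [cayley, div_eq_iff (ofReal_sub_I_ne_zero _), ht, invCayley]
  field_simp
  ring

/-- The coordinate on the circle of the real point `t`. -/
def circleAngle (t : ℝ) : ℝ := Real.pi - 2 * Real.arctan t

lemma contDiff_circleAngle : ContDiff ℝ ∞ circleAngle :=
  contDiff_const.sub (contDiff_const.mul Real.contDiff_arctan)

lemma circleAngle_div_two (t : ℝ) : circleAngle t / 2 = Real.pi / 2 - Real.arctan t := by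
  rw [circleAngle]
  ring

lemma exp_circleAngle (t : ℝ) : Complex.exp (circleAngle t * I) = cayley t := by
  have hcos : Complex.cos (Real.arctan t) ≠ 0 := mod_cast (Real.cos_arctan_pos t).ne'
  have ht : (t : ℂ) = Complex.sin (Real.arctan t) / Complex.cos (Real.arctan t) := by
    rw [← Complex.tan_eq_sin_div_cos]
    exact_mod_cast (Real.tan_arctan t).symm
  have hangle : ((circleAngle t : ℝ) : ℂ) * I =
      Real.pi * I + (-(Real.arctan t : ℂ) * I + -(Real.arctan t : ℂ) * I) := by
    rw [circleAngle]
    push_cast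
    ring
  rw [cayley, eq_div_iff (ofReal_sub_I_ne_zero t), hangle, Complex.exp_add, Complex.exp_add,
    Complex.exp_pi_mul_I, Complex.exp_mul_I, Complex.cos_neg, Complex.sin_neg, ht]
  have hsq := Complex.sin_sq_add_cos_sq (Real.arctan t)
  generalize Complex.sin (Real.arctan t) = a, Complex.cos (Real.arctan t) = b at hcos hsq ⊢
  field_simp
  linear_combination (a + I * b) * hsq + (b * a ^ 2 * I - 2 * b ^ 2 * a - a ^ 3) * Complex.I_sq

lemma circleSymbol_circleAngle {M m : ℕ} (q : Eu M → Eu m → ℝ → ℂ) (x : Eu M) (η : Eu m)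
    (t : ℝ) : circleSymbol q (x, η, circleAngle t) = q x η t := by
  simp only [circleSymbol, circleAngle_div_two, Real.sin_pi_div_two_sub, Real.cos_pi_div_two_sub,
    (Real.cos_arctan_pos t).ne', if_false]
  rw [← Real.tan_eq_sin_div_cos, Real.tan_arctan]

end Cayley

section Dilation

open scoped ComplexConjugate

/-- The action of the dilation `z ↦ s z` in the disc coordinate. -/
def discDilation (s : ℝ) (w : ℂ) : ℂ := ((s + 1) * w + (s - 1)) / ((s - 1) * w + (s + 1))

variable {s : ℝ}

lemma discDilation_denom_ne_zero (hs : 0 < s) {w : ℂ} (hw : ‖w‖ ≤ 1) :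
    ((s : ℂ) - 1) * w + (s + 1) ≠ 0 := by
  intro h
  have hnorm : |s - 1| * ‖w‖ = s + 1 := by
    have hcongr := congrArg norm (eq_neg_of_add_eq_zero_left h)
    rwa [norm_mul, norm_neg, ← Complex.ofReal_one, ← Complex.ofReal_sub, ← Complex.ofReal_add,
      Complex.norm_real, Complex.norm_real, Real.norm_eq_abs, Real.norm_of_nonneg (by positivity)]
      at hcongr
  have hlt : |s - 1| < s + 1 := abs_lt.2 ⟨by linarith, by linarith⟩
  nlinarith [abs_nonneg (s - 1)]

lemma norm_discDilation_lt_one (hs : 0 < s) {w : ℂ} (hw : ‖w‖ < 1) : ‖discDilation s w‖ < 1 := by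
  have hsq : w.re * w.re + w.im * w.im < 1 := by
    rw [← Complex.normSq_apply, Complex.normSq_eq_norm_sq]
    exact pow_lt_one₀ (norm_nonneg _) hw two_ne_zero
  rw [discDilation, norm_div, div_lt_one (norm_pos_iff.2 (discDilation_denom_ne_zero hs hw.le)),
    ← sq_lt_sq₀ (norm_nonneg _) (norm_nonneg _), ← Complex.normSq_eq_norm_sq,
    ← Complex.normSq_eq_norm_sq, Complex.normSq_apply, Complex.normSq_apply]
  simp
  nlinarith

lemma diffContOnCl_comp_discDilation {A : ℂ → ℂ} (hA : DiffContOnCl ℂ A (Metric.ball 0 1))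
    (hs : 0 < s) : DiffContOnCl ℂ (fun w => A (discDilation s w)) (Metric.ball 0 1) := by
  have hdilation : DiffContOnCl ℂ (discDilation s) (Metric.ball 0 1) := by
    refine DifferentiableOn.diffContOnCl fun w hw => ?_
    rw [closure_ball _ one_ne_zero] at hw
    have hdenom := discDilation_denom_ne_zero hs (mem_closedBall_zero_iff.1 hw)
    unfold discDilation
    exact DifferentiableAt.differentiableWithinAt (by fun_prop (disch := assumption))
  exact hA.comp hdilation fun w hw =>
    mem_ball_zero_iff.2 (norm_discDilation_lt_one hs (mem_ball_zero_iff.1 hw))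

lemma discDilation_one (hs : 0 < s) : discDilation s 1 = 1 := by
  rw [discDilation, div_eq_one_iff_eq (discDilation_denom_ne_zero hs (by simp))]
  ring

lemma discDilation_cayley (hs : 0 < s) (t : ℝ) :
    discDilation s (cayley t) = cayley ((s * t : ℝ) : ℂ) := by
  have ht := ofReal_sub_I_ne_zero t
  have hst := ofReal_sub_I_ne_zero (s * t)
  have hdenom := discDilation_denom_ne_zero hs (norm_cayley_ofReal_le_one t)
  rw [discDilation, div_eq_iff hdenom]
  simp only [cayley] at hdenom ⊢
  push_cast at hst ⊢
  field_simp
  ring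

lemma holomorphicPart_dilation {A B A' B' : ℂ → ℂ} (hA : DiffContOnCl ℂ A (Metric.ball 0 1))
    (hB : DiffContOnCl ℂ B (Metric.ball 0 1)) (hA' : DiffContOnCl ℂ A' (Metric.ball 0 1))
    (hB' : DiffContOnCl ℂ B' (Metric.ball 0 1)) (hA1 : A 1 = 0) (hB1 : B 1 = 0) (hA'1 : A' 1 = 0)
    (hB'1 : B' 1 = 0) (hs : 0 < s)
    (h : ∀ t : ℝ, A' (cayley ((s * t : ℝ) : ℂ)) + conj (B' (cayley ((s * t : ℝ) : ℂ))) =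
      A (cayley t) + conj (B (cayley t))) (t : ℝ) :
    A' (cayley ((s * t : ℝ) : ℂ)) = A (cayley t) := by
  have hcircle (w : ℂ) (hw : ‖w‖ = 1) :
      (A' (discDilation s w) - A w) + conj (B' (discDilation s w) - B w) = 0 := by
    rcases eq_or_ne w 1 with rfl | hw1
    · simp [discDilation_one hs, hA1, hA'1, hB1, hB'1]
    · obtain ⟨t, rfl⟩ := exists_cayley_ofReal_eq hw hw1
      rw [discDilation_cayley hs, map_sub]
      linear_combination h t
  have hzero := eq_zero_of_add_conj_eq_zero ((diffContOnCl_comp_discDilation hA' hs).sub hA)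
    ((diffContOnCl_comp_discDilation hB' hs).sub hB) hcircle
    (by simp [discDilation_one hs, hA1, hA'1]) (norm_cayley_ofReal_le_one t)
  rw [← discDilation_cayley hs]
  exact sub_eq_zero.1 hzero

end Dilation

section Laplace

open Complex (I)
open MeasureTheory FourierTransform SchwartzMap

/-- The one-sided Fourier transform of `φ`, on the closed lower half-plane. -/
def lowerLaplace (φ : 𝓢(ℝ, ℂ)) (z : ℂ) : ℂ :=
  ∫ x in Ioi (0 : ℝ), Complex.exp (-I * x * z) * φ x

lemma norm_exp_neg_I_mul_mul_le {x : ℝ} (hx : 0 ≤ x) {z : ℂ} (hz : z.im ≤ 0) (w : ℂ) :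
    ‖Complex.exp (-I * x * z) * w‖ ≤ ‖w‖ := by
  rw [norm_mul]
  refine mul_le_of_le_one_left (norm_nonneg w) ?_
  rw [Complex.norm_exp, Real.exp_le_one_iff]
  simpa using mul_nonpos_of_nonneg_of_nonpos hx hz

lemma ae_norm_exp_neg_I_mul_mul_le {z : ℂ} (hz : z.im ≤ 0) (φ : ℝ → ℂ) :
    ∀ᵐ x : ℝ ∂volume.restrict (Ioi 0), ‖Complex.exp (-I * x * z) * φ x‖ ≤ ‖φ x‖ :=
  (ae_restrict_iff' measurableSet_Ioi).2 <| Eventually.of_forall fun x hx =>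
    norm_exp_neg_I_mul_mul_le (le_of_lt hx) hz (φ x)

lemma integrableOn_exp_neg_I_mul_mul (φ : 𝓢(ℝ, ℂ)) {z : ℂ} (hz : z.im ≤ 0) :
    IntegrableOn (fun x : ℝ => Complex.exp (-I * x * z) * φ x) (Ioi 0) :=
  Integrable.mono φ.integrable.integrableOn (by fun_prop) (ae_norm_exp_neg_I_mul_mul_le hz φ)

lemma norm_lowerLaplace_le (φ : 𝓢(ℝ, ℂ)) {z : ℂ} (hz : z.im ≤ 0) :
    ‖lowerLaplace φ z‖ ≤ ∫ x in Ioi (0 : ℝ), ‖φ x‖ :=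
  norm_integral_le_of_norm_le φ.integrable.norm.integrableOn (ae_norm_exp_neg_I_mul_mul_le hz φ)

lemma isOpen_lowerHalfPlane : IsOpen {z : ℂ | z.im < 0} :=
  isOpen_lt Complex.continuous_im continuous_const

lemma differentiableAt_lowerLaplace (φ : 𝓢(ℝ, ℂ)) {z : ℂ} (hz : z.im < 0) :
    DifferentiableAt ℂ (lowerLaplace φ) z := by
  have hintegrable : IntegrableOn (fun x : ℝ => ‖x‖ * ‖φ x‖) (Ioi 0) := by
    simpa using (φ.integrable_pow_mul volume 1).integrableOn
  refine ((hasDerivAt_integral_of_dominated_loc_of_deriv_le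
    (μ := volume.restrict (Ioi (0 : ℝ))) (bound := fun x => ‖x‖ * ‖φ x‖)
    (F := fun (z : ℂ) (x : ℝ) => Complex.exp (-I * x * z) * φ x)
    (F' := fun (z : ℂ) (x : ℝ) => Complex.exp (-I * x * z) * (-I * x * φ x))
    (isOpen_lowerHalfPlane.mem_nhds hz) (Eventually.of_forall fun w => by fun_prop)
    (integrableOn_exp_neg_I_mul_mul φ hz.le) (by fun_prop) ?_ hintegrable ?_).2).differentiableAt
  · refine (ae_restrict_iff' measurableSet_Ioi).2 (Eventually.of_forall fun x hx w hw => ?_)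
    simpa using norm_exp_neg_I_mul_mul_le (le_of_lt hx) (le_of_lt hw) (-I * x * φ x)
  · refine Eventually.of_forall fun x w _ => ?_
    have hlin : HasDerivAt (fun w : ℂ => -I * x * w) (-I * x) w := by
      simpa using (hasDerivAt_id w).const_mul (-I * x)
    simpa only [mul_assoc] using hlin.cexp.mul_const (φ x)

lemma continuousOn_lowerLaplace (φ : 𝓢(ℝ, ℂ)) :
    ContinuousOn (lowerLaplace φ) {z : ℂ | z.im ≤ 0} := fun z _ =>
  continuousWithinAt_of_dominated (bound := fun x => ‖φ x‖)
    (Eventually.of_forall fun w => by fun_prop)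
    (by filter_upwards [self_mem_nhdsWithin] with w hw using ae_norm_exp_neg_I_mul_mul_le hw φ)
    φ.integrable.norm.integrableOn (Eventually.of_forall fun x => by fun_prop)

lemma lowerLaplace_derivCLM (φ : 𝓢(ℝ, ℂ)) {z : ℂ} (hz : z.im ≤ 0) :
    lowerLaplace (derivCLM ℂ ℂ φ) z = I * z * lowerLaplace φ z - φ 0 := by
  have hderiv (x : ℝ) : HasDerivAt (fun x : ℝ => Complex.exp (-I * x * z) * φ x)
      (Complex.exp (-I * x * z) * derivCLM ℂ ℂ φ x -
        I * z * (Complex.exp (-I * x * z) * φ x)) x := by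
    have hlin : HasDerivAt (fun x : ℝ => -I * (x : ℂ) * z) (-I * z) x := by
      simpa using ((Complex.ofRealCLM.hasDerivAt (x := x)).const_mul (-I)).mul_const z
    refine (hlin.cexp.mul φ.differentiableAt.hasDerivAt).congr_deriv ?_
    rw [derivCLM_apply]
    ring
  have hint := integrableOn_exp_neg_I_mul_mul (derivCLM ℂ ℂ φ) hz
  have hint' := (integrableOn_exp_neg_I_mul_mul φ hz).const_mul (I * z)
  have hlim : Tendsto (fun x : ℝ => Complex.exp (-I * x * z) * φ x) atTop (𝓝 0) := by
    have hφ : Tendsto φ atTop (𝓝 0) := φ.tendsto_cocompact.mono_left atTop_le_cocompact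
    refine squeeze_zero_norm' ?_ (tendsto_zero_iff_norm_tendsto_zero.1 hφ)
    filter_upwards [eventually_ge_atTop 0] with x hx using norm_exp_neg_I_mul_mul_le hx hz (φ x)
  have hparts := integral_Ioi_of_hasDerivAt_of_tendsto (a := (0 : ℝ))
    (hderiv 0).continuousAt.continuousWithinAt (fun x _ => hderiv x) (hint.sub hint') hlim
  rw [integral_sub hint hint', integral_const_mul] at hparts
  simp only [Complex.ofReal_zero, mul_zero, zero_mul, Complex.exp_zero, one_mul, zero_sub]
    at hparts
  unfold lowerLaplace
  linear_combination hparts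

lemma exists_norm_mul_lowerLaplace_le (φ : 𝓢(ℝ, ℂ)) :
    ∃ C : ℝ, ∀ z : ℂ, z.im ≤ 0 → ‖z‖ * ‖lowerLaplace φ z‖ ≤ C := by
  refine ⟨(∫ x in Ioi (0 : ℝ), ‖derivCLM ℂ ℂ φ x‖) + ‖φ 0‖, fun z hz => ?_⟩
  calc ‖z‖ * ‖lowerLaplace φ z‖
      = ‖lowerLaplace (derivCLM ℂ ℂ φ) z + φ 0‖ := by
        rw [lowerLaplace_derivCLM φ hz, sub_add_cancel, norm_mul, norm_mul, Complex.norm_I, one_mul]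
    _ ≤ _ := (norm_add_le _ _).trans (by gcongr; exact norm_lowerLaplace_le _ hz)

/-- The one-sided transform in the disc coordinate; it vanishes at `1`, the image of infinity. -/
def discLaplace (φ : 𝓢(ℝ, ℂ)) (w : ℂ) : ℂ :=
  if w = 1 then 0 else lowerLaplace φ (invCayley w)

lemma discLaplace_one (φ : 𝓢(ℝ, ℂ)) : discLaplace φ 1 = 0 := if_pos rfl

lemma discLaplace_of_ne_one (φ : 𝓢(ℝ, ℂ)) {w : ℂ} (hw : w ≠ 1) :
    discLaplace φ w = lowerLaplace φ (invCayley w) := if_neg hw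

lemma discLaplace_cayley (φ : 𝓢(ℝ, ℂ)) (t : ℝ) :
    discLaplace φ (cayley t) = lowerLaplace φ t := by
  rw [discLaplace_of_ne_one φ (cayley_ofReal_ne_one t), invCayley_cayley]

lemma discLaplace_eventuallyEq (φ : 𝓢(ℝ, ℂ)) {w : ℂ} (hw : w ≠ 1) :
    discLaplace φ =ᶠ[𝓝 w] lowerLaplace φ ∘ invCayley := by
  filter_upwards [isOpen_ne.mem_nhds hw] with z hz using discLaplace_of_ne_one φ hz

lemma differentiableAt_discLaplace (φ : 𝓢(ℝ, ℂ)) {w : ℂ} (hw : ‖w‖ < 1) :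
    DifferentiableAt ℂ (discLaplace φ) w := by
  have hw1 : w ≠ 1 := by
    rintro rfl
    simp at hw
  exact (discLaplace_eventuallyEq φ hw1).differentiableAt_iff.2
    ((differentiableAt_lowerLaplace φ (im_invCayley_neg hw)).comp w
      (differentiableAt_invCayley hw1))

lemma exists_norm_discLaplace_le (φ : 𝓢(ℝ, ℂ)) :
    ∃ C : ℝ, ∀ᶠ w in 𝓝[Metric.closedBall (0 : ℂ) 1] 1, ‖discLaplace φ w‖ ≤ C * ‖w - 1‖ := by
  obtain ⟨C, hC⟩ := exists_norm_mul_lowerLaplace_le φ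
  refine ⟨C, ?_⟩
  have hfar : ∀ᶠ w in 𝓝 (1 : ℂ), 1 < ‖w + 1‖ :=
    (by fun_prop : ContinuousAt (fun w : ℂ => ‖w + 1‖) 1).eventually_const_lt (by norm_num)
  filter_upwards [self_mem_nhdsWithin, mem_nhdsWithin_of_mem_nhds hfar] with w hw hw2
  rcases eq_or_ne w 1 with rfl | hw1
  · simp [discLaplace_one]
  · have hpos : 0 < ‖w - 1‖ := norm_pos_iff.2 (sub_ne_zero.2 hw1)
    have hdecay := hC _ (im_invCayley_nonpos (mem_closedBall_zero_iff.1 hw))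
    rw [invCayley, norm_div, norm_mul, Complex.norm_I, one_mul, div_mul_eq_mul_div,
      div_le_iff₀ hpos] at hdecay
    rw [discLaplace_of_ne_one φ hw1]
    exact (le_mul_of_one_le_left (norm_nonneg _) hw2.le).trans hdecay

lemma continuousOn_discLaplace (φ : 𝓢(ℝ, ℂ)) :
    ContinuousOn (discLaplace φ) (Metric.closedBall 0 1) := by
  intro w hw
  rcases eq_or_ne w 1 with rfl | hw1
  · obtain ⟨C, hC⟩ := exists_norm_discLaplace_le φ
    have hlim : Tendsto (fun w : ℂ => C * ‖w - 1‖) (𝓝 1) (𝓝 0) :=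
      (by fun_prop : Continuous fun w : ℂ => C * ‖w - 1‖).tendsto' 1 0 (by simp)
    rw [ContinuousWithinAt, discLaplace_one]
    exact squeeze_zero_norm' hC (hlim.mono_left nhdsWithin_le_nhds)
  · have hcomp : ContinuousWithinAt (lowerLaplace φ ∘ invCayley) (Metric.closedBall 0 1) w :=
      (continuousOn_lowerLaplace φ _ (im_invCayley_nonpos (mem_closedBall_zero_iff.1 hw))).comp
        (differentiableAt_invCayley hw1).continuousAt.continuousWithinAt
        fun z hz => im_invCayley_nonpos (mem_closedBall_zero_iff.1 hz)
    exact hcomp.congr_of_eventuallyEq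
      (mem_nhdsWithin_of_mem_nhds (discLaplace_eventuallyEq φ hw1))
      (discLaplace_of_ne_one φ hw1)

lemma diffContOnCl_discLaplace (φ : 𝓢(ℝ, ℂ)) :
    DiffContOnCl ℂ (discLaplace φ) (Metric.ball 0 1) :=
  ⟨fun _ hw => (differentiableAt_discLaplace φ
    (mem_ball_zero_iff.1 hw)).differentiableWithinAt, by
    rw [closure_ball _ one_ne_zero]
    exact continuousOn_discLaplace φ⟩

lemma lowerLaplace_eq_fourier (φ : 𝓢(ℝ, ℂ)) (t : ℝ) :
    lowerLaplace φ t = 𝓕 ((Ioi (0 : ℝ)).indicator φ) ((2 * Real.pi)⁻¹ * t) := by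
  rw [Real.fourier_real_eq_integral_exp_smul, lowerLaplace, ← integral_indicator measurableSet_Ioi]
  congr 1
  ext x
  by_cases hx : x ∈ Ioi (0 : ℝ)
  · have hpi : (Real.pi : ℂ) ≠ 0 := by exact_mod_cast Real.pi_ne_zero
    rw [indicator_of_mem hx, indicator_of_mem hx, smul_eq_mul]
    congr 2
    push_cast
    field_simp
  · rw [indicator_of_notMem hx, indicator_of_notMem hx, smul_zero]

lemma integrable_pow_smul_indicator (φ : 𝓢(ℝ, ℂ)) (n : ℕ) :
    Integrable fun x : ℝ => x ^ n • (Ioi (0 : ℝ)).indicator φ x := by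
  have hind : (fun x : ℝ => x ^ n • (Ioi (0 : ℝ)).indicator φ x) =
      (Ioi (0 : ℝ)).indicator fun x => x ^ n • φ x := by
    ext x
    exact (indicator_smul_apply (Ioi (0 : ℝ)) (fun x => x ^ n) φ x).symm
  rw [hind]
  refine Integrable.indicator ?_ measurableSet_Ioi
  refine (φ.integrable_pow_mul volume n).mono (by fun_prop) (Eventually.of_forall fun x => ?_)
  simp

lemma contDiff_fourier_indicator (φ : 𝓢(ℝ, ℂ)) : ContDiff ℝ ∞ (𝓕 ((Ioi (0 : ℝ)).indicator φ)) :=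
  Real.contDiff_fourier (N := ⊤) fun n _ => by
    simpa [norm_smul] using (integrable_pow_smul_indicator φ n).norm

lemma contDiff_lowerLaplace (φ : 𝓢(ℝ, ℂ)) : ContDiff ℝ ∞ fun t : ℝ => lowerLaplace φ t := by
  simp only [lowerLaplace_eq_fourier]
  exact (contDiff_fourier_indicator φ).comp (contDiff_const.mul contDiff_id)

lemma exists_norm_iteratedDeriv_lowerLaplace_le (φ : 𝓢(ℝ, ℂ)) (n : ℕ) :
    ∃ C : ℝ, ∀ t : ℝ, ‖iteratedDeriv n (fun t : ℝ => lowerLaplace φ t) t‖ ≤ C := by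
  set f : ℝ → ℂ := (Ioi (0 : ℝ)).indicator φ with hf
  refine ⟨|(2 * Real.pi)⁻¹ ^ n| * ∫ x : ℝ, ‖(-2 * Real.pi * I * (x : ℂ)) ^ n • f x‖, fun t => ?_⟩
  have hscale := congrFun (iteratedDeriv_comp_const_smul (f := 𝓕 f) (n := n)
    ((contDiff_fourier_indicator φ).of_le (mod_cast le_top)) (2 * Real.pi)⁻¹) t
  simp only [lowerLaplace_eq_fourier]
  rw [← hf, hscale, norm_smul, Real.norm_eq_abs, Real.iteratedDeriv_fourier (N := ⊤)
    (fun n _ => integrable_pow_smul_indicator φ n) (mod_cast le_top)]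
  gcongr
  exact VectorFourier.norm_fourierIntegral_le_integral_norm _ _ _ _ _

end Laplace

section Borel

variable {F : Type*} [NormedAddCommGroup F] [NormedSpace ℝ F]

lemma exists_norm_iteratedDeriv_le_of_hasCompactSupport {h : ℝ → F} (hh : ContDiff ℝ ∞ h)
    (hsupp : HasCompactSupport h) (k : ℕ) : ∃ C, ∀ x, ‖iteratedDeriv k h x‖ ≤ C := by
  simp only [← norm_iteratedFDeriv_eq_norm_iteratedDeriv]
  exact (hsupp.iteratedFDeriv (𝕜 := ℝ) k).exists_bound_of_continuous
    (hh.continuous_iteratedFDeriv (mod_cast le_top))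

/-- A smooth cutoff on `ℝ`, equal to `1` on `[-1, 1]` and supported in `[-2, 2]`. -/
def smoothCutoff : ContDiffBump (0 : ℝ) := ⟨1, 2, one_pos, by norm_num⟩

/-- The monomial `sⁿ` cut off smoothly, the building block of Borel's series. -/
def cutoffMonomial (n : ℕ) (s : ℝ) : ℝ := s ^ n * smoothCutoff s

lemma contDiff_cutoffMonomial (n : ℕ) : ContDiff ℝ ∞ (cutoffMonomial n) :=
  (contDiff_id.pow n).mul smoothCutoff.contDiff

lemma hasCompactSupport_cutoffMonomial (n : ℕ) : HasCompactSupport (cutoffMonomial n) :=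
  smoothCutoff.hasCompactSupport.mul_left

lemma iteratedDeriv_cutoffMonomial_zero (n k : ℕ) :
    iteratedDeriv k (cutoffMonomial n) 0 = if k = n then (n.factorial : ℝ) else 0 := by
  have hpow : cutoffMonomial n =ᶠ[𝓝 0] fun s => s ^ n := by
    filter_upwards [smoothCutoff.eventuallyEq_one] with s hs
    simp [cutoffMonomial, hs]
  rw [hpow.iteratedDeriv_eq, iteratedDeriv_fun_pow_zero]
  split_ifs <;> simp

/-- The term `sⁿ c / n!` of a Taylor series at `0`, cut off smoothly at scale `1 / L`. -/
def borelTerm (n : ℕ) (c : F) (L s : ℝ) : F :=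
  cutoffMonomial n (L * s) • ((n.factorial * L ^ n : ℝ)⁻¹ • c)

lemma contDiff_borelTerm (n : ℕ) (c : F) (L : ℝ) : ContDiff ℝ ∞ (borelTerm n c L) :=
  ((contDiff_cutoffMonomial n).comp (contDiff_const.mul contDiff_id)).smul contDiff_const

lemma iteratedDeriv_borelTerm (n k : ℕ) (c : F) (L s : ℝ) :
    iteratedDeriv k (borelTerm n c L) s =
      (L ^ k * iteratedDeriv k (cutoffMonomial n) (L * s)) •
        ((n.factorial * L ^ n : ℝ)⁻¹ • c) := by
  have hscaled : ContDiff ℝ k fun s => cutoffMonomial n (L * s) :=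
    ((contDiff_cutoffMonomial n).comp (contDiff_const.mul contDiff_id)).of_le (mod_cast le_top)
  have hscale := congrFun (iteratedDeriv_comp_const_smul
    ((contDiff_cutoffMonomial n).of_le (mod_cast le_top : (k : WithTop ℕ∞) ≤ ∞)) L) s
  rw [smul_eq_mul] at hscale
  rw [← hscale]
  exact iteratedDeriv_smul_const hscaled.contDiffAt _

lemma iteratedDeriv_borelTerm_zero (n k : ℕ) (c : F) {L : ℝ} (hL : L ≠ 0) :
    iteratedDeriv k (borelTerm n c L) 0 = if k = n then c else 0 := by
  rw [iteratedDeriv_borelTerm, mul_zero, iteratedDeriv_cutoffMonomial_zero]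
  split_ifs with hk
  · have : (n.factorial : ℝ) ≠ 0 := mod_cast n.factorial_ne_zero
    rw [hk, smul_smul, mul_comm (L ^ n), mul_inv_cancel₀ (by positivity), one_smul]
  · simp

lemma borelTerm_eq_zero (n : ℕ) (c : F) {L : ℝ} (hL : 1 ≤ L) {s : ℝ}
    (hs : s ∉ Metric.closedBall (0 : ℝ) 2) : borelTerm n c L s = 0 := by
  rw [mem_closedBall_zero_iff, not_le] at hs
  have hcutoff : smoothCutoff (L * s) = 0 := smoothCutoff.zero_of_le_dist <| by
    rw [dist_zero_right, norm_mul, Real.norm_of_nonneg (by positivity)]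
    exact hs.le.trans (le_mul_of_one_le_left (norm_nonneg _) hL)
  simp [borelTerm, cutoffMonomial, hcutoff]

lemma exists_norm_iteratedDeriv_borelTerm_le (n : ℕ) (c : F) :
    ∃ L : ℝ, 1 ≤ L ∧ ∀ k < n, ∀ s, ‖iteratedDeriv k (borelTerm n c L) s‖ ≤ (1 / 2) ^ n := by
  choose B hB using fun k => exists_norm_iteratedDeriv_le_of_hasCompactSupport
    (contDiff_cutoffMonomial n) (hasCompactSupport_cutoffMonomial n) k
  have hB0 (k : ℕ) : 0 ≤ B k := (norm_nonneg _).trans (hB k 0)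
  set L : ℝ := 1 + 2 ^ n * ‖c‖ * ∑ k ∈ Finset.range n, B k
  have hL : 1 ≤ L := le_add_of_nonneg_right
    (mul_nonneg (by positivity) (Finset.sum_nonneg fun k _ => hB0 k))
  refine ⟨L, hL, fun k hk s => ?_⟩
  have hBL : 2 ^ n * ‖c‖ * B k ≤ L := by
    have hBsum : B k ≤ ∑ k ∈ Finset.range n, B k :=
      Finset.single_le_sum (fun k _ => hB0 k) (Finset.mem_range.2 hk)
    calc 2 ^ n * ‖c‖ * B k ≤ 2 ^ n * ‖c‖ * ∑ k ∈ Finset.range n, B k := by gcongr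
      _ ≤ L := le_add_of_nonneg_left zero_le_one
  have hfac : (1 : ℝ) ≤ n.factorial := mod_cast n.factorial_pos
  rw [iteratedDeriv_borelTerm, norm_smul, norm_smul, norm_mul, norm_inv,
    Real.norm_of_nonneg (by positivity : (0 : ℝ) ≤ L ^ k),
    Real.norm_of_nonneg (by positivity : (0 : ℝ) ≤ n.factorial * L ^ n)]
  calc L ^ k * ‖iteratedDeriv k (cutoffMonomial n) (L * s)‖ * ((n.factorial * L ^ n)⁻¹ * ‖c‖)
      ≤ L ^ k * B k * ((1 * L ^ n)⁻¹ * ‖c‖) := by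
        have hBk := hB0 k
        gcongr
        exact hB k _
    _ = L ^ k * (2 ^ n * ‖c‖ * B k) / (2 ^ n * L ^ n) := by field_simp
    _ ≤ L ^ k * L / (2 ^ n * L ^ n) := by gcongr
    _ ≤ L ^ n / (2 ^ n * L ^ n) := by
        rw [← pow_succ]
        gcongr
        exact hk
    _ = (1 / 2) ^ n := by
        rw [one_div, inv_pow]
        field_simp

lemma exists_contDiff_iteratedDeriv_eq [CompleteSpace F] (c : ℕ → F) :
    ∃ b : ℝ → F, ContDiff ℝ ∞ b ∧ HasCompactSupport b ∧ ∀ n, iteratedDeriv n b 0 = c n := by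
  choose L hL hsmall using fun n => exists_norm_iteratedDeriv_borelTerm_le n (c n)
  let T (n : ℕ) : ℝ → F := borelTerm n (c n) (L n)
  have hT (n : ℕ) : ContDiff ℝ ∞ (T n) := contDiff_borelTerm n (c n) (L n)
  have hTzero (n : ℕ) {s : ℝ} (hs : s ∉ Metric.closedBall (0 : ℝ) 2) : T n s = 0 :=
    borelTerm_eq_zero n (c n) (hL n) hs
  choose B hB using fun n => exists_norm_iteratedDeriv_le_of_hasCompactSupport (hT n)
    (HasCompactSupport.intro (isCompact_closedBall (0 : ℝ) 2) fun _ => hTzero n)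
  let v (k n : ℕ) : ℝ := (1 / 2) ^ n + if n ∈ Finset.range (k + 1) then B n k else 0
  have hv (k : ℕ) : Summable (v k) :=
    (summable_geometric_of_lt_one (by norm_num) (by norm_num)).add
      (summable_of_ne_finset_zero fun n hn => if_neg hn)
  have hTv (k n : ℕ) (s : ℝ) : ‖iteratedFDeriv ℝ k (T n) s‖ ≤ v k n := by
    rw [norm_iteratedFDeriv_eq_norm_iteratedDeriv]
    by_cases hn : n ∈ Finset.range (k + 1)
    · simpa only [v, if_pos hn] using (hB n k s).trans (le_add_of_nonneg_left (by positivity))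
    · simpa only [v, if_neg hn, add_zero] using hsmall n k (by simpa using hn) s
  refine ⟨fun s => ∑' n, T n s,
    contDiff_tsum (N := ⊤) hT (fun k _ => hv k) (fun k n s _ => hTv k n s),
    HasCompactSupport.intro (isCompact_closedBall (0 : ℝ) 2) fun s hs => by simp [hTzero _ hs],
    fun k => ?_⟩
  have hsum : Summable fun n => iteratedFDeriv ℝ k (T n) 0 :=
    Summable.of_norm_bounded (hv k) fun n => hTv k n 0
  have hderiv (n : ℕ) : iteratedFDeriv ℝ k (T n) 0 (fun _ => 1) = if k = n then c n else 0 := by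
    rw [← iteratedDeriv_eq_iteratedFDeriv]
    exact iteratedDeriv_borelTerm_zero n k (c n) (by linarith [hL n])
  rw [iteratedDeriv_eq_iteratedFDeriv, iteratedFDeriv_tsum_apply (N := ⊤) hT (fun k _ => hv k)
    (fun k n s _ => hTv k n s) (mod_cast le_top)]
  have happly := (ContinuousMultilinearMap.apply ℝ (fun _ : Fin k => ℝ) F fun _ => 1).map_tsum hsum
  simp only [ContinuousMultilinearMap.apply_apply, hderiv] at happly
  rw [happly, tsum_ite_eq' k c]

end Borel

section RapidDecay

variable {F : Type*} [NormedAddCommGroup F] [NormedSpace ℝ F]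

lemma abs_mul_norm_deriv_le {h : ℝ → F} (hh : Differentiable ℝ h)
    (hh' : Differentiable ℝ (deriv h)) {K : ℝ} (hK : ∀ t, ‖deriv (deriv h) t‖ ≤ K) (t ε : ℝ) :
    |ε| * ‖deriv h t‖ ≤ ‖h (t + ε)‖ + ‖h t‖ + K * |ε| * |ε| := by
  have hK0 : 0 ≤ K := (norm_nonneg _).trans (hK 0)
  let R (s : ℝ) : F := h s - s • deriv h t
  have hR (s : ℝ) : HasDerivAt R (deriv h s - deriv h t) s := by
    simpa only [one_smul] using
      (hh s).hasDerivAt.fun_sub ((hasDerivAt_id' s).smul_const (deriv h t))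
  have hlip (s : ℝ) (hs : s ∈ uIcc t (t + ε)) : ‖deriv h s - deriv h t‖ ≤ K * |ε| := by
    refine (convex_univ.norm_image_sub_le_of_norm_hasDerivWithin_le
      (fun x _ => (hh' x).hasDerivAt.hasDerivWithinAt) (fun x _ => hK x) (mem_univ t)
      (mem_univ s)).trans ?_
    gcongr
    rw [Real.norm_eq_abs]
    simpa using abs_sub_left_of_mem_uIcc hs
  have hmean : ‖R (t + ε) - R t‖ ≤ K * |ε| * |ε| := by
    simpa using (convex_uIcc t (t + ε)).norm_image_sub_le_of_norm_hasDerivWithin_le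
      (fun x _ => (hR x).hasDerivWithinAt) hlip left_mem_uIcc right_mem_uIcc
  calc |ε| * ‖deriv h t‖ = ‖h (t + ε) - h t - (R (t + ε) - R t)‖ := by
        rw [← Real.norm_eq_abs, ← norm_smul]
        congr 1
        simp only [R, add_smul]
        abel
    _ ≤ _ := (norm_sub_le _ _).trans (add_le_add (norm_sub_le _ _) hmean)

lemma exists_abs_eq_abs_le_abs_add (t : ℝ) {δ : ℝ} (hδ : 0 ≤ δ) :
    ∃ ε : ℝ, |ε| = δ ∧ |t| ≤ |t + ε| := by
  rcases le_total 0 t with ht | ht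
  · refine ⟨δ, abs_of_nonneg hδ, ?_⟩
    rw [abs_of_nonneg ht, abs_of_nonneg (by linarith)]
    linarith
  · refine ⟨-δ, by rw [abs_neg, abs_of_nonneg hδ], ?_⟩
    rw [abs_of_nonpos ht, abs_of_nonpos (by linarith)]
    linarith

lemma exists_abs_pow_mul_norm_deriv_le {h : ℝ → F} (hh : Differentiable ℝ h)
    (hh' : Differentiable ℝ (deriv h)) (hdec : ∀ N : ℕ, ∃ C, ∀ t : ℝ, |t| ^ N * ‖h t‖ ≤ C)
    {K₁ K₂ : ℝ} (h₁ : ∀ t, ‖deriv h t‖ ≤ K₁) (h₂ : ∀ t, ‖deriv (deriv h) t‖ ≤ K₂) (N : ℕ) :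
    ∃ C, ∀ t : ℝ, |t| ^ N * ‖deriv h t‖ ≤ C := by
  obtain ⟨C, hC⟩ := hdec (2 * N)
  refine ⟨max K₁ (2 * C + K₂), fun t => ?_⟩
  rcases le_total |t| 1 with ht | ht
  · exact ((mul_le_of_le_one_left (norm_nonneg _) (pow_le_one₀ (abs_nonneg t) ht)).trans
      (h₁ t)).trans (le_max_left _ _)
  have : 0 < |t| := one_pos.trans_le ht
  -- the step `|t| ^ (-N)` balances the two sides of the interpolation inequality
  obtain ⟨ε, hε, htε⟩ := exists_abs_eq_abs_le_abs_add t (by positivity : 0 ≤ (|t| ^ N)⁻¹)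
  have hsmall (s : ℝ) (hs : |t| ≤ |s|) : (|t| ^ N) ^ 2 * ‖h s‖ ≤ C := by
    rw [← pow_mul, mul_comm N]
    exact (by gcongr : _ ≤ |s| ^ (2 * N) * ‖h s‖).trans (hC s)
  refine le_trans ?_ (le_max_right _ _)
  calc |t| ^ N * ‖deriv h t‖ = (|t| ^ N) ^ 2 * (|ε| * ‖deriv h t‖) := by
        rw [hε]
        field_simp
    _ ≤ (|t| ^ N) ^ 2 * (‖h (t + ε)‖ + ‖h t‖ + K₂ * |ε| * |ε|) := by
        gcongr
        exact abs_mul_norm_deriv_le hh hh' h₂ t ε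
    _ = (|t| ^ N) ^ 2 * ‖h (t + ε)‖ + (|t| ^ N) ^ 2 * ‖h t‖ + K₂ := by
        rw [hε]
        field_simp
    _ ≤ 2 * C + K₂ := by linarith [hsmall _ htε, hsmall t le_rfl]

open SchwartzMap in
lemma exists_schwartzMap_of_rapidDecay {h : ℝ → F} (hh : ContDiff ℝ ∞ h)
    (hdec : ∀ N : ℕ, ∃ C, ∀ t : ℝ, |t| ^ N * ‖h t‖ ≤ C)
    (hbdd : ∀ n : ℕ, ∃ C, ∀ t, ‖iteratedDeriv n h t‖ ≤ C) : ∃ r : 𝓢(ℝ, F), ∀ t, r t = h t := by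
  have hdiff (n : ℕ) : Differentiable ℝ (iteratedDeriv n h) :=
    hh.differentiable_iteratedDeriv n (mod_cast WithTop.coe_lt_top n)
  have hderiv (n : ℕ) : ∀ N : ℕ, ∃ C, ∀ t : ℝ, |t| ^ N * ‖iteratedDeriv n h t‖ ≤ C := by
    induction n with
    | zero => simpa using hdec
    | succ n ih =>
      obtain ⟨K₁, hK₁⟩ := hbdd (n + 1)
      obtain ⟨K₂, hK₂⟩ := hbdd (n + 2)
      have hdiff' := hdiff (n + 1)
      simp only [iteratedDeriv_succ] at hK₁ hK₂ hdiff' ⊢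
      exact exists_abs_pow_mul_norm_deriv_le (hdiff n) hdiff' ih hK₁ hK₂
  refine ⟨⟨h, hh, fun k n => ?_⟩, fun t => rfl⟩
  obtain ⟨C, hC⟩ := hderiv n k
  exact ⟨C, fun x => by
    rw [norm_iteratedFDeriv_eq_norm_iteratedDeriv, Real.norm_eq_abs]
    exact hC x⟩

end RapidDecay

section CircleTransform

open Complex (I)
open MeasureTheory FourierTransform SchwartzMap
open scoped ComplexConjugate

lemma apply_circleAngle_inv_of_periodic {α : Type*} {G : ℝ → α}
    (hp : Function.Periodic G (2 * Real.pi)) {u : ℝ} (hu : u ≠ 0) :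
    G (circleAngle u⁻¹) = G (2 * Real.arctan u) := by
  rcases hu.lt_or_gt with hu | hu
  · rw [circleAngle, Real.arctan_inv_of_neg hu, ← hp (2 * Real.arctan u)]
    congr 1
    ring
  · rw [circleAngle, Real.arctan_inv_of_pos hu]
    congr 1
    ring

lemma one_sub_cos_circleAngle (t : ℝ) : 1 - Real.cos (circleAngle t) = 2 / (1 + t ^ 2) := by
  rw [circleAngle, Real.cos_pi_sub, Real.cos_two_mul, Real.cos_sq_arctan]
  ring

lemma hasDerivAt_circleAngle (t : ℝ) :
    HasDerivAt circleAngle (-(1 - Real.cos (circleAngle t))) t := by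
  refine (((Real.hasDerivAt_arctan t).const_mul 2).const_sub Real.pi).congr_deriv ?_
  rw [one_sub_cos_circleAngle]
  ring

lemma exists_norm_iteratedDeriv_comp_circleAngle_le {G : ℝ → ℂ} (hG : ContDiff ℝ ∞ G)
    (hp : Function.Periodic G (2 * Real.pi)) (n : ℕ) :
    ∃ C : ℝ, ∀ t, ‖iteratedDeriv n (fun t => G (circleAngle t)) t‖ ≤ C := by
  induction n generalizing G with
  | zero =>
    obtain ⟨C, hC⟩ := exists_norm_le_of_periodic Real.two_pi_pos hG.continuous hp
    exact ⟨C, fun t => by simpa using hC _⟩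
  | succ n ih =>
    have hderiv : deriv (fun t => G (circleAngle t)) = fun t =>
        (fun φ : ℝ => -(1 - Real.cos φ) • deriv G φ) (circleAngle t) := by
      ext t
      exact ((hG.differentiable (by simp) _).hasDerivAt.scomp t (hasDerivAt_circleAngle t)).deriv
    rw [iteratedDeriv_succ', hderiv]
    refine ih (G := fun φ : ℝ => -(1 - Real.cos φ) • deriv G φ) ?_ fun φ => ?_
    · exact ((contDiff_const.sub Real.contDiff_cos).neg).smul (contDiff_infty_iff_deriv.1 hG).2
    · simp only [periodic_deriv hp φ, Real.cos_add_two_pi]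

lemma iterate_derivCLM_apply (φ : 𝓢(ℝ, ℂ)) (n : ℕ) (x : ℝ) :
    ((derivCLM ℂ ℂ)^[n] φ) x = iteratedDeriv n φ x := by
  induction n generalizing x with
  | zero => simp
  | succ n ih =>
    rw [Function.iterate_succ_apply', derivCLM_apply, iteratedDeriv_succ, funext ih]

lemma lowerLaplace_expansion (φ : 𝓢(ℝ, ℂ)) {t : ℝ} (ht : t ≠ 0) (N : ℕ) :
    lowerLaplace φ t = ∑ j ∈ Finset.range N, iteratedDeriv j φ 0 * ((I * t)⁻¹) ^ (j + 1) +
      ((I * t)⁻¹) ^ N * lowerLaplace ((derivCLM ℂ ℂ)^[N] φ) t := by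
  induction N with
  | zero => simp
  | succ N ih =>
    have hIt : I * (t : ℂ) ≠ 0 := mul_ne_zero Complex.I_ne_zero (mod_cast ht)
    have hcancel : ((I * t)⁻¹) ^ (N + 1) * (I * t * lowerLaplace ((derivCLM ℂ ℂ)^[N] φ) t) =
        ((I * t)⁻¹) ^ N * lowerLaplace ((derivCLM ℂ ℂ)^[N] φ) t := by
      rw [pow_succ, mul_assoc, inv_mul_cancel_left₀ hIt]
    rw [ih, Finset.sum_range_succ, Function.iterate_succ_apply',
      lowerLaplace_derivCLM _ (by simp), iterate_derivCLM_apply, mul_sub, hcancel]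
    ring

/-- The Taylor coefficients at `0` that `φ` needs for `lowerLaplace φ t` to have the asymptotic
expansion of `g (1 / t)` as `t → ±∞`. -/
def transformJet (g : ℝ → ℂ) (j : ℕ) : ℂ :=
  I ^ (j + 1) / (j + 1).factorial * iteratedDeriv (j + 1) g 0

lemma taylorWithinEval_eq_sum_transformJet {g : ℝ → ℂ} (hg : g 0 = 0) (N : ℕ) (t : ℝ) :
    taylorWithinEval g N univ 0 t⁻¹ =
      ∑ j ∈ Finset.range N, transformJet g j * ((I * t)⁻¹) ^ (j + 1) := by
  rw [taylor_within_apply, Finset.sum_range_succ']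
  simp only [iteratedDerivWithin_univ, iteratedDeriv_zero, hg, smul_zero, add_zero, sub_zero]
  refine Finset.sum_congr rfl fun j _ => ?_
  have hI := pow_ne_zero (j + 1) Complex.I_ne_zero
  rw [transformJet, Complex.real_smul, mul_inv, mul_pow, inv_pow I]
  push_cast
  field_simp

lemma eventually_abs_pow_mul_norm_sub_lowerLaplace_le {g : ℝ → ℂ} (hg : ContDiff ℝ ∞ g)
    (hg0 : g 0 = 0) {b : 𝓢(ℝ, ℂ)} (hb : ∀ j, iteratedDeriv j b 0 = transformJet g j) (N : ℕ) :
    ∃ C, ∀ᶠ t : ℝ in Bornology.cobounded ℝ, |t| ^ N * ‖g t⁻¹ - lowerLaplace b t‖ ≤ C := by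
  set K := ∫ x in Ioi (0 : ℝ), ‖((derivCLM ℂ ℂ)^[N] b) x‖
  refine ⟨1 + K, ?_⟩
  have htaylor := tendsto_inv₀_cobounded (α := ℝ) |>.eventually
    ((taylor_isLittleO_univ (x₀ := 0) (hg.of_le (mod_cast le_top : (N : WithTop ℕ∞) ≤ ∞))).bound
      one_pos)
  filter_upwards [htaylor, Bornology.eventually_ne_cobounded (0 : ℝ)] with t ht ht0
  have : 0 < |t| := abs_pos.2 ht0
  have hsplit : g t⁻¹ - lowerLaplace b t = (g t⁻¹ - taylorWithinEval g N univ 0 t⁻¹) -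
      ((I * t)⁻¹) ^ N * lowerLaplace ((derivCLM ℂ ℂ)^[N] b) t := by
    rw [taylorWithinEval_eq_sum_transformJet hg0, lowerLaplace_expansion b ht0 N]
    simp only [hb]
    ring
  have hremainder : ‖g t⁻¹ - taylorWithinEval g N univ 0 t⁻¹‖ ≤ (|t| ^ N)⁻¹ := by
    simpa [norm_pow, norm_inv] using ht
  have htail : ‖((I * (t : ℂ))⁻¹) ^ N * lowerLaplace ((derivCLM ℂ ℂ)^[N] b) t‖ ≤
      (|t| ^ N)⁻¹ * K := by
    rw [norm_mul, norm_pow, norm_inv, norm_mul, Complex.norm_I, one_mul, Complex.norm_real,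
      Real.norm_eq_abs, inv_pow]
    gcongr
    exact norm_lowerLaplace_le _ (by simp)
  calc |t| ^ N * ‖g t⁻¹ - lowerLaplace b t‖ ≤ |t| ^ N * ((|t| ^ N)⁻¹ + (|t| ^ N)⁻¹ * K) := by
        rw [hsplit]
        gcongr
        exact (norm_sub_le _ _).trans (add_le_add hremainder htail)
    _ = 1 + K := by field_simp

lemma exists_forall_le_of_eventually_cobounded {f : ℝ → ℝ} (hf : Continuous f) {C : ℝ}
    (hC : ∀ᶠ t in Bornology.cobounded ℝ, f t ≤ C) : ∃ C', ∀ t, f t ≤ C' := by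
  rw [Metric.cobounded_eq_cocompact, eventually_iff, mem_cocompact] at hC
  obtain ⟨T, hTc, hT⟩ := hC
  obtain ⟨D, hD⟩ := hTc.exists_bound_of_continuousOn hf.continuousOn
  refine ⟨max D C, fun t => ?_⟩
  by_cases ht : t ∈ T
  · exact (le_abs_self _).trans ((hD t ht).trans (le_max_left _ _))
  · exact (hT ht : f t ≤ C).trans (le_max_right _ _)

lemma exists_comp_circleAngle_eq_lowerLaplace_add {G : ℝ → ℂ} (hG : ContDiff ℝ ∞ G)
    (hp : Function.Periodic G (2 * Real.pi)) (hG0 : G 0 = 0) :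
    ∃ b r : 𝓢(ℝ, ℂ), ∀ t : ℝ, G (circleAngle t) = lowerLaplace b t + r t := by
  set g : ℝ → ℂ := fun u => G (2 * Real.arctan u)
  have hg : ContDiff ℝ ∞ g := hG.comp (contDiff_const.mul Real.contDiff_arctan)
  have hg0 : g 0 = 0 := by simp [g, hG0]
  obtain ⟨b₀, hb₀, hsupp, hjet⟩ := exists_contDiff_iteratedDeriv_eq (transformJet g)
  let b : 𝓢(ℝ, ℂ) := hsupp.toSchwartzMap hb₀
  have hGc : ContDiff ℝ ∞ fun t => G (circleAngle t) := hG.comp contDiff_circleAngle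
  have hb : ContDiff ℝ ∞ fun t : ℝ => lowerLaplace b t := contDiff_lowerLaplace b
  have hsub := hGc.sub hb
  obtain ⟨r, hr⟩ : ∃ r : 𝓢(ℝ, ℂ), ∀ t, r t = G (circleAngle t) - lowerLaplace b t := by
    refine exists_schwartzMap_of_rapidDecay hsub (fun N => ?_) fun n => ?_
    · obtain ⟨C, hC⟩ := eventually_abs_pow_mul_norm_sub_lowerLaplace_le hg hg0 (b := b) hjet N
      refine exists_forall_le_of_eventually_cobounded
        ((continuous_abs.pow N).mul hsub.continuous.norm) (C := C) ?_
      filter_upwards [hC, Bornology.eventually_ne_cobounded (0 : ℝ)] with t ht ht0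
      have hinv := apply_circleAngle_inv_of_periodic hp (inv_ne_zero ht0)
      rw [inv_inv] at hinv
      rwa [hinv]
    · obtain ⟨C, hC⟩ := exists_norm_iteratedDeriv_comp_circleAngle_le hG hp n
      obtain ⟨D, hD⟩ := exists_norm_iteratedDeriv_lowerLaplace_le b n
      refine ⟨C + D, fun t => ?_⟩
      rw [iteratedDeriv_fun_sub (hGc.of_le (mod_cast le_top)).contDiffAt
        (hb.of_le (mod_cast le_top)).contDiffAt]
      exact (norm_sub_le _ _).trans (add_le_add (hC t) (hD t))
  exact ⟨b, r, fun t => by rw [hr, add_sub_cancel]⟩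

/-- The reflection `s ↦ conj (φ (-s))` of a Schwartz function. -/
def schwartzConjNeg (φ : 𝓢(ℝ, ℂ)) : 𝓢(ℝ, ℂ) :=
  postcompCLM (𝕜 := ℝ) (Complex.conjCLE : ℂ →L[ℝ] ℂ)
    (compCLMOfContinuousLinearEquiv ℝ (ContinuousLinearEquiv.neg ℝ) φ)

lemma schwartzConjNeg_apply (φ : 𝓢(ℝ, ℂ)) (s : ℝ) : schwartzConjNeg φ s = conj (φ (-s)) := rfl

lemma exists_eq_integral_exp_neg_I_mul_mul (r : 𝓢(ℝ, ℂ)) :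
    ∃ ρ : 𝓢(ℝ, ℂ), ∀ t : ℝ, r t = ∫ s : ℝ, Complex.exp (-I * s * t) * ρ s := by
  have hpi : 2 * Real.pi ≠ 0 := Real.two_pi_pos.ne'
  let scale : ℝ ≃L[ℝ] ℝ := ContinuousLinearEquiv.unitsEquivAut ℝ (Units.mk0 (2 * Real.pi) hpi)
  let r' : 𝓢(ℝ, ℂ) := compCLMOfContinuousLinearEquiv ℂ scale r
  let ρ : 𝓢(ℝ, ℂ) := 𝓕⁻ r'
  refine ⟨ρ, fun t => ?_⟩
  have hρ : 𝓕 ρ = r' := FourierTransform.fourier_fourierInv_eq r'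
  have hfourier : 𝓕 (ρ : ℝ → ℂ) (t / (2 * Real.pi)) = r t := by
    rw [← SchwartzMap.fourier_coe, hρ]
    change r (t / (2 * Real.pi) * (2 * Real.pi)) = r t
    rw [div_mul_cancel₀ _ hpi]
  rw [← hfourier, Real.fourier_real_eq_integral_exp_smul]
  congr 1
  ext s
  have hpi' : (Real.pi : ℂ) ≠ 0 := by exact_mod_cast Real.pi_ne_zero
  rw [smul_eq_mul]
  congr 2
  push_cast
  field_simp

lemma integral_exp_neg_I_mul_mul (ρ : 𝓢(ℝ, ℂ)) (t : ℝ) :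
    ∫ s : ℝ, Complex.exp (-I * s * t) * ρ s =
      lowerLaplace ρ t + conj (lowerLaplace (schwartzConjNeg ρ) t) := by
  have hint : Integrable fun s : ℝ => Complex.exp (-I * s * t) * ρ s := by
    refine ρ.integrable.mono (by fun_prop) (Eventually.of_forall fun s => ?_)
    rw [norm_mul, Complex.norm_exp]
    simp
  have hneg := integral_comp_neg_Ioi 0 fun s : ℝ => Complex.exp (-I * s * t) * ρ s
  rw [neg_zero] at hneg
  rw [← intervalIntegral.integral_Iic_add_Ioi (b := 0) hint.integrableOn hint.integrableOn,
    add_comm, ← hneg, lowerLaplace, lowerLaplace, ← integral_conj]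
  congr 2
  ext s
  rw [schwartzConjNeg_apply, map_mul, ← Complex.exp_conj]
  simp

lemma lowerLaplace_add (φ ψ : 𝓢(ℝ, ℂ)) {z : ℂ} (hz : z.im ≤ 0) :
    lowerLaplace (φ + ψ) z = lowerLaplace φ z + lowerLaplace ψ z := by
  simp only [lowerLaplace, add_apply, mul_add]
  exact integral_add (integrableOn_exp_neg_I_mul_mul φ hz) (integrableOn_exp_neg_I_mul_mul ψ hz)

lemma periodic_of_eq_comp_exp {α : Type*} {G : ℝ → α} {A : ℂ → α}
    (h : ∀ φ : ℝ, G φ = A (Complex.exp (φ * I))) : Function.Periodic G (2 * Real.pi) := fun φ => by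
  rw [h, h, Complex.ofReal_add, add_mul, Complex.ofReal_mul, Complex.ofReal_ofNat,
    Complex.exp_add, Complex.exp_two_pi_mul_I, mul_one]

lemma memHPlus_comp_circleAngle {G : ℝ → ℂ} {A : ℂ → ℂ} (hG : ContDiff ℝ ∞ G)
    (hA : DiffContOnCl ℂ A (Metric.ball 0 1)) (hA1 : A 1 = 0)
    (hGA : ∀ φ : ℝ, G φ = A (Complex.exp (φ * I))) : MemHPlus fun t => G (circleAngle t) := by
  obtain ⟨b, r, hbr⟩ := exists_comp_circleAngle_eq_lowerLaplace_add hG (periodic_of_eq_comp_exp hGA)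
    (by simp [hGA, hA1])
  obtain ⟨ρ, hρ⟩ := exists_eq_integral_exp_neg_I_mul_mul r
  have hsplit (t : ℝ) : A (cayley t) = lowerLaplace b t +
      (lowerLaplace ρ t + conj (lowerLaplace (schwartzConjNeg ρ) t)) := by
    rw [← exp_circleAngle, ← hGA, hbr, hρ, integral_exp_neg_I_mul_mul]
  have hcircle (w : ℂ) (hw : ‖w‖ = 1) : (A w - discLaplace b w - discLaplace ρ w) +
      conj (-discLaplace (schwartzConjNeg ρ) w) = 0 := by
    rcases eq_or_ne w 1 with rfl | hw1
    · simp [discLaplace_one, hA1]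
    · obtain ⟨t, rfl⟩ := exists_cayley_ofReal_eq hw hw1
      simp only [discLaplace_cayley, map_neg]
      linear_combination hsplit t
  have hzero (t : ℝ) : A (cayley t) - discLaplace b (cayley t) - discLaplace ρ (cayley t) = 0 :=
    eq_zero_of_add_conj_eq_zero
      ((hA.sub (diffContOnCl_discLaplace b)).sub (diffContOnCl_discLaplace ρ))
      (diffContOnCl_discLaplace (schwartzConjNeg ρ)).neg hcircle (by simp [discLaplace_one, hA1])
      (norm_cayley_ofReal_le_one t)
  refine ⟨b + ρ, fun t => ?_⟩
  calc G (circleAngle t) = A (cayley t) := by rw [hGA, exp_circleAngle]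
    _ = discLaplace b (cayley t) + discLaplace ρ (cayley t) := by linear_combination hzero t
    _ = lowerLaplace (b + ρ) t := by
      rw [discLaplace_cayley, discLaplace_cayley, lowerLaplace_add _ _ (by simp)]

end CircleTransform

section CircleFactor

open Complex (I)
open scoped ComplexConjugate

variable {M m : ℕ}

lemma exists_disc_decomposition {ψ : ℝ → ℂ} (hψ : ContDiff ℝ 2 ψ)
    (hp : Function.Periodic ψ (2 * Real.pi)) :
    ∃ A B : ℂ → ℂ, DiffContOnCl ℂ A (Metric.ball 0 1) ∧ DiffContOnCl ℂ B (Metric.ball 0 1) ∧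
      A 1 = 0 ∧ B 1 = 0 ∧ (∀ φ : ℝ, hardyProj ψ φ = A (Complex.exp (φ * I))) ∧
      ∀ φ : ℝ, A (Complex.exp (φ * I)) + conj (B (Complex.exp (φ * I))) = ψ φ - ψ 0 := by
  obtain ⟨A, hA, hA1, hAψ⟩ := exists_hardyProj_eq_powerSeries hψ hp
  obtain ⟨B, hB, hB1, hBψ⟩ := exists_hardyProj_eq_powerSeries (ψ := fun s => conj (ψ s))
    (Complex.conjCLE.contDiff.comp hψ) fun s => congrArg conj (hp s)
  exact ⟨A, B, hA, hB, hA1, hB1, hAψ, fun φ => by rw [← hAψ, ← hBψ, hardyProj_add_conj hψ hp]⟩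

lemma hardyProj_dilation {ψ ψ' : ℝ → ℂ} (hψ : ContDiff ℝ 2 ψ)
    (hp : Function.Periodic ψ (2 * Real.pi)) (hψ' : ContDiff ℝ 2 ψ')
    (hp' : Function.Periodic ψ' (2 * Real.pi)) {s : ℝ} (hs : 0 < s) (h0 : ψ' 0 = ψ 0)
    (h : ∀ t, ψ' (circleAngle (s * t)) = ψ (circleAngle t)) (t : ℝ) :
    hardyProj ψ' (circleAngle (s * t)) = hardyProj ψ (circleAngle t) := by
  obtain ⟨A, B, hA, hB, hA1, hB1, hproj, hsum⟩ := exists_disc_decomposition hψ hp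
  obtain ⟨A', B', hA', hB', hA'1, hB'1, hproj', hsum'⟩ := exists_disc_decomposition hψ' hp'
  rw [hproj, hproj', exp_circleAngle, exp_circleAngle]
  refine holomorphicPart_dilation hA hB hA' hB' hA1 hB1 hA'1 hB'1 hs (fun t => ?_) t
  rw [← exp_circleAngle, ← exp_circleAngle, hsum, hsum', h, h0]

/-- The projection `hardyProj`, acting in the last variable. -/
def hardyProjLast (F : Eu M × (Eu m × ℝ) → ℂ) : Eu M × (Eu m × ℝ) → ℂ := fun p =>
  hardyProj (fun s => F (p.1, p.2.1, s)) p.2.2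

/-- The function of `(x, η, φ)` and `s` whose integral against `hardyKernel s` defines
`hardyProjLast F` up to the factor `1 / 2π`. -/
def hardyIntegrand (F : Eu M × (Eu m × ℝ) → ℂ) : Eu M × ((Eu m × ℝ) × ℝ) → ℂ := fun p =>
  (dirDeriv (dirXin M m))^[2] F (p.1, p.2.1.1, p.2.1.2 - p.2.2) -
    (dirDeriv (dirXin M m))^[2] F (p.1, p.2.1.1, 0 - p.2.2)

variable {F : Eu M × (Eu m × ℝ) → ℂ} {S : Set (Eu M)}

lemma hardyProjLast_eq_integral_hardyIntegrand (hF : ContDiff ℝ ∞ F) (p : Eu M × (Eu m × ℝ)) :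
    hardyProjLast F p = (2 * Real.pi : ℂ)⁻¹ *
      ∫ s in (0 : ℝ)..2 * Real.pi, hardyKernel s * hardyIntegrand F (p.1, (p.2, s)) := by
  have hderiv : deriv (deriv fun s => F (p.1, p.2.1, s)) =
      fun s => (dirDeriv (dirXin M m))^[2] F (p.1, p.2.1, s) := by
    ext s
    rw [← iteratedDeriv_slice_xin hF, iteratedDeriv_succ, iteratedDeriv_one]
  simp only [hardyProjLast, hardyProj, hderiv, hardyIntegrand]

lemma continuous_hardyIntegrand (hF : ContDiff ℝ ∞ F) : Continuous (hardyIntegrand F) := by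
  have hderiv := (contDiff_iterate_dirDeriv hF (dirXin M m) 2).continuous
  unfold hardyIntegrand
  fun_prop

lemma integral_hardyKernel_mul {H : ℝ → ℂ} (hH : Continuous H) (a b : ℝ) :
    ∫ s in a..b, hardyKernel s * H s =
      (∫ s in a..b, (hardyKernel s).re • H s) + I * ∫ s in a..b, (hardyKernel s).im • H s := by
  have hre : Continuous fun s => (hardyKernel s).re • H s := by
    have := continuous_hardyKernel
    fun_prop
  have him : Continuous fun s => I * ((hardyKernel s).im • H s) := by
    have := continuous_hardyKernel
    fun_prop
  rw [← intervalIntegral.integral_const_mul, ← intervalIntegral.integral_add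
    (hre.intervalIntegrable _ _) (him.intervalIntegrable _ _)]
  congr 1
  ext s
  rw [Complex.real_smul, Complex.real_smul]
  linear_combination (-(H s)) * Complex.re_add_im (hardyKernel s)

lemma LocSmoothBdd.dirDeriv (hF : LocSmoothBdd S F) (hS : IsOpen S) (w : Eu M × (Eu m × ℝ)) :
    LocSmoothBdd S (dirDeriv w F) :=
  fun v => (hF v).fderiv_apply hS w

lemma LocSmoothBdd.hardyIntegrand (hb : LocSmoothBdd S F) (hS : IsOpen S) :
    LocSmoothBdd S (hardyIntegrand F) := by
  have hderiv := (hb.dirDeriv hS (dirXin M m)).dirDeriv hS (dirXin M m)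
  exact fun v => LocSmoothBddAt.sub
    (hderiv.comp_right (γ := fun v : (Eu m × ℝ) × ℝ => (v.1.1, v.1.2 - v.2)) hS (by fun_prop) v)
    (hderiv.comp_right (γ := fun v : (Eu m × ℝ) × ℝ => (v.1.1, 0 - v.2)) hS (by fun_prop) v) hS

lemma LocSmoothBdd.hardyProjLast (hb : LocSmoothBdd S F) (hF : ContDiff ℝ ∞ F) (hS : IsOpen S) :
    LocSmoothBdd S (hardyProjLast F) := by
  have hsplit := fun p : Eu M × (Eu m × ℝ) =>
    (hardyProjLast_eq_integral_hardyIntegrand hF p).trans (congrArg _ (integral_hardyKernel_mul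
      ((continuous_hardyIntegrand hF).comp (by fun_prop : Continuous fun s => (p.1, (p.2, s))))
        0 (2 * Real.pi)))
  have hintegral {κ : ℝ → ℝ} (hκ : Continuous κ) (v : Eu m × ℝ) : LocSmoothBddAt S
      (fun p : Eu M × (Eu m × ℝ) =>
        ∫ s in (0 : ℝ)..2 * Real.pi, κ s • _root_.hardyIntegrand F (p.1, (p.2, s))) v :=
    .integral (fun s _ => hb.hardyIntegrand hS (v, s)) hS (hκ.intervalIntegrable _ _)
  rw [funext hsplit]
  exact fun v => (LocSmoothBddAt.const _).mul
    ((hintegral (Complex.continuous_re.comp continuous_hardyKernel) v).add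
      ((LocSmoothBddAt.const _).mul
        (hintegral (Complex.continuous_im.comp continuous_hardyKernel) v) hS) hS) hS

lemma contDiff_hardyProjLast (hF : ContDiff ℝ ∞ F) : ContDiff ℝ ∞ (hardyProjLast F) :=
  contDiff_of_locSmoothBdd_ball fun R =>
    (locSmoothBdd_ball_of_contDiff hF R).hardyProjLast hF Metric.isOpen_ball

/-- Smooth functions `G` on the circle, depending on parameters, whose values for a parameter extend
holomorphically to the disc, avoiding `-1`, and vanish at `1`, and that are homogeneous of degree
`0` in the coordinate `circleAngle`: the factors of the symbol are `1 + G` and its conjugate. -/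
structure CircleFactor (G : Eu M × (Eu m × ℝ) → ℂ) : Prop where
  contDiff : ContDiff ℝ ∞ G
  extends_disc : ∀ x η, ∃ A : ℂ → ℂ, DiffContOnCl ℂ A (Metric.ball 0 1) ∧ A 1 = 0 ∧
    (∀ w, A w ≠ -1) ∧ ∀ φ : ℝ, G (x, η, φ) = A (Complex.exp (φ * I))
  homogeneous : ∀ (x : Eu M) (η : Eu m) (t : ℝ), 1 ≤ ‖η‖ → ∀ s : ℝ, 1 ≤ s →
    G (x, s • η, circleAngle (s * t)) = G (x, η, circleAngle t)

/-- The properties of the logarithm of the symbol on the circle that the factorization needs. -/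
structure CircleLog (Ψ : Eu M × (Eu m × ℝ) → ℂ) : Prop where
  contDiff : ContDiff ℝ ∞ Ψ
  periodic : ∀ x η, Function.Periodic (fun φ => Ψ (x, η, φ)) (2 * Real.pi)
  at_zero : ∀ x η η', Ψ (x, η, 0) = Ψ (x, η', 0)
  homogeneous : ∀ (x : Eu M) (η : Eu m) (t : ℝ), 1 ≤ ‖η‖ → ∀ s : ℝ, 1 ≤ s →
    Ψ (x, s • η, circleAngle (s * t)) = Ψ (x, η, circleAngle t)

/-- The factor that belongs to the part of `Ψ` with positive frequencies, minus `1`. -/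
def expHardy (Ψ : Eu M × (Eu m × ℝ) → ℂ) : Eu M × (Eu m × ℝ) → ℂ := fun p =>
  Complex.exp (hardyProjLast Ψ p) - 1

lemma LocSmoothBdd.expHardy (hb : LocSmoothBdd S F) (hF : ContDiff ℝ ∞ F) (hS : IsOpen S) :
    LocSmoothBdd S (expHardy F) :=
  fun v => ((hb.hardyProjLast hF hS v).comp_contDiff hS Complex.contDiff_exp).sub (.const 1) hS

lemma CircleLog.conj {Ψ : Eu M × (Eu m × ℝ) → ℂ} (h : CircleLog Ψ) :
    CircleLog fun p => conj (Ψ p) where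
  contDiff := Complex.conjCLE.contDiff.comp h.contDiff
  periodic x η φ := congrArg _ (h.periodic x η φ)
  at_zero x η η' := congrArg _ (h.at_zero x η η')
  homogeneous x η t hη s hs := congrArg _ (h.homogeneous x η t hη s hs)

namespace CircleLog

variable {Ψ : Eu M × (Eu m × ℝ) → ℂ}

lemma contDiff_slice (h : CircleLog Ψ) (x : Eu M) (η : Eu m) :
    ContDiff ℝ 2 fun φ : ℝ => Ψ (x, η, φ) :=
  (h.contDiff.comp (by fun_prop)).of_le (mod_cast le_top : ((2 : ℕ∞) : WithTop ℕ∞) ≤ ∞)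

lemma circleFactor (h : CircleLog Ψ) : CircleFactor (expHardy Ψ) where
  contDiff := (contDiff_hardyProjLast h.contDiff).cexp.sub contDiff_const
  extends_disc x η := by
    obtain ⟨A, hA, hA1, hAψ⟩ :=
      exists_hardyProj_eq_powerSeries (h.contDiff_slice x η) (h.periodic x η)
    refine ⟨fun w => Complex.exp (A w) - 1, ?_, by simp [hA1], fun w hw => ?_, fun φ => ?_⟩
    · exact (Complex.differentiable_exp.diffContOnCl.comp hA (mapsTo_univ _ _)).sub_const 1
    · exact Complex.exp_ne_zero (A w) (by linear_combination hw)
    · rw [expHardy, hardyProjLast, hAψ]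
  homogeneous x η t hη s hs := by
    simp only [expHardy, hardyProjLast]
    rw [hardyProj_dilation (h.contDiff_slice x η) (h.periodic x η) (h.contDiff_slice x (s • η))
      (h.periodic x (s • η)) (one_pos.trans_le hs) (h.at_zero x _ _)
      (fun t => h.homogeneous x η t hη s hs)]

lemma expHardy_mul_conj (h : CircleLog Ψ) (x : Eu M) (η : Eu m) (φ : ℝ) :
    (1 + expHardy Ψ (x, η, φ)) *
        starRingEnd ℂ (1 + expHardy (fun p => starRingEnd ℂ (Ψ p)) (x, η, φ)) =
      Complex.exp (Ψ (x, η, φ) - Ψ (x, η, 0)) := by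
  simp only [expHardy, hardyProjLast, add_sub_cancel]
  rw [← Complex.exp_conj, ← Complex.exp_add,
    hardyProj_add_conj (h.contDiff_slice x η) (h.periodic x η) φ]

end CircleLog

lemma CircleFactor.invertibleHolomorphicExtension {G : Eu M × (Eu m × ℝ) → ℂ}
    (h : CircleFactor G) (x : Eu M) (η : Eu m) :
    InvertibleHolomorphicExtension {z : ℂ | z.im < 0} fun t => 1 + G (x, η, circleAngle t) := by
  obtain ⟨A, hA, -, hne, hAG⟩ := h.extends_disc x η
  refine ⟨fun z => 1 + A (cayley z), (diffContOnCl_comp_cayley hA).const_add 1, fun t => ?_,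
    fun z _ hz => hne _ (by linear_combination hz)⟩
  simp only [hAG, exp_circleAngle]

lemma InvertibleHolomorphicExtension.conj {u : ℝ → ℂ}
    (h : InvertibleHolomorphicExtension {z : ℂ | z.im < 0} u) :
    InvertibleHolomorphicExtension {z : ℂ | 0 < z.im} fun t => conj (u t) := by
  obtain ⟨g, hg, hgu, hne⟩ := h
  have hcl : closure {z : ℂ | 0 < z.im} = {z : ℂ | 0 ≤ z.im} := Complex.closure_setOfPred_lt_im 0
  have hcont := hg.continuousOn
  rw [closure_lowerHalfPlane] at hcont hne
  refine ⟨fun z => starRingEnd ℂ (g (starRingEnd ℂ z)), ⟨fun z hz => ?_, ?_⟩, fun t => ?_,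
    fun z hz hz0 => ?_⟩
  · have hdiff : DifferentiableAt ℂ g (starRingEnd ℂ z) :=
      hg.differentiableAt isOpen_lowerHalfPlane (by simpa using hz)
    simpa [Function.comp_def] using hdiff.star_star.differentiableWithinAt
  · rw [hcl]
    exact Complex.continuous_conj.comp_continuousOn (hcont.comp
      Complex.continuous_conj.continuousOn fun z (hz : 0 ≤ z.im) => by simpa using hz)
  · simp [hgu]
  · rw [hcl] at hz
    exact hne (starRingEnd ℂ z) (by simpa using hz) (by simpa using hz0)

end CircleFactor

section CircleLogSymbol

open Complex (I)

variable {M m : ℕ} {θ : ℝ} {q : Eu M → Eu m → ℝ → ℂ}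

/-- The logarithm of the symbol on the circle, up to an additive constant, for the branch that is
cut along the ray of argument `θ`. -/
def circleLogSymbol (θ : ℝ) (q : Eu M → Eu m → ℝ → ℂ) : Eu M × (Eu m × ℝ) → ℂ := fun p =>
  Complex.log (-Complex.exp (-(θ * I)) * circleSymbol q p)

lemma neg_exp_mul_mem_slitPlane {z : ℂ} (h : ∀ r : ℝ, 0 ≤ r → z ≠ r * Complex.exp (θ * I)) :
    -Complex.exp (-(θ * I)) * z ∈ Complex.slitPlane := by
  rw [Complex.mem_slitPlane_iff]
  by_contra! hc
  set w := -Complex.exp (-(θ * I)) * z with hw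
  have hreal : (w.re : ℂ) = w := Complex.ext (by simp) (by simp [hc.2])
  refine h (-w.re) (by linarith [hc.1]) ?_
  rw [Complex.ofReal_neg, hreal, hw, Complex.exp_neg]
  field_simp

lemma exists_circleSymbol_eq (q : Eu M → Eu m → ℝ → ℂ) (p : Eu M × (Eu m × ℝ)) :
    ∃ η t, circleSymbol q p = q p.1 η t := by
  unfold circleSymbol
  split_ifs
  exacts [⟨_, _, rfl⟩, ⟨_, _, rfl⟩]

lemma rotated_circleSymbol_mem_slitPlane (hray : AvoidsRay θ q) (p : Eu M × (Eu m × ℝ)) :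
    -Complex.exp (-(θ * I)) * circleSymbol q p ∈ Complex.slitPlane := by
  obtain ⟨η, t, h⟩ := exists_circleSymbol_eq q p
  rw [h]
  exact neg_exp_mul_mem_slitPlane (hray p.1 η t)

lemma circleSymbol_zero (q : Eu M → Eu m → ℝ → ℂ) (x : Eu M) (η : Eu m) :
    circleSymbol q (x, η, 0) = q x 0 1 := by
  simp [circleSymbol]

lemma mul_exp_circleLogSymbol_sub (hray : AvoidsRay θ q) (x : Eu M) (η : Eu m) (t : ℝ) :
    q x 0 1 * Complex.exp
      (circleLogSymbol θ q (x, η, circleAngle t) - circleLogSymbol θ q (x, η, 0)) = q x η t := by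
  have hne (p) := Complex.slitPlane_ne_zero (rotated_circleSymbol_mem_slitPlane hray p)
  have hs₀ : q x 0 1 ≠ 0 := circleSymbol_zero q x η ▸ right_ne_zero_of_mul (hne (x, η, 0))
  simp only [circleLogSymbol]
  rw [Complex.exp_sub, Complex.exp_log (hne _), Complex.exp_log (hne _), circleSymbol_circleAngle,
    circleSymbol_zero, mul_div_mul_left _ _ (neg_ne_zero.2 (Complex.exp_ne_zero _)),
    mul_div_cancel₀ _ hs₀]

lemma LocSmoothBdd.circleLogSymbol {S : Set (Eu M)} (hb : LocSmoothBdd S (joint q))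
    (hq : JointlySmooth q) (hhom : HomogeneousZero q) (ht : ZeroTransmission q)
    (hray : AvoidsRay θ q) (hS : IsOpen S) {c : ℝ} (hc : 0 < c)
    (hlow : ∀ x ∈ S, ∀ η t, c ≤ ‖q x η t‖) : LocSmoothBdd S (circleLogSymbol θ q) := by
  refine fun v => ((LocSmoothBddAt.const _).mul (hb.circleSymbol hq hhom ht hS v) hS).log hS
    (fun x _ v => rotated_circleSymbol_mem_slitPlane hray (x, v)) hc
    (Eventually.of_forall fun v' x hx => ?_)
  obtain ⟨η, t, h⟩ := exists_circleSymbol_eq q (x, v')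
  rw [norm_mul, norm_neg, Complex.norm_exp, h]
  simpa using hlow x hx η t

lemma circleLog_circleLogSymbol (hq : JointlySmooth q) (hhom : HomogeneousZero q)
    (ht : ZeroTransmission q) (hray : AvoidsRay θ q) : CircleLog (circleLogSymbol θ q) where
  contDiff := by
    have hcircle : ContDiff ℝ ∞ (circleSymbol q) := contDiff_of_locSmoothBdd_ball fun R =>
      (locSmoothBdd_ball_of_contDiff hq R).circleSymbol hq hhom ht Metric.isOpen_ball
    exact contDiff_iff_contDiffAt.2 fun p =>
      ((Complex.contDiffAt_log (rotated_circleSymbol_mem_slitPlane hray p)).restrict_scalars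
        ℝ).comp p (contDiff_const.mul hcircle).contDiffAt
  periodic x η φ := by simp only [circleLogSymbol, circleSymbol_add_two_pi]
  at_zero x η η' := by simp only [circleLogSymbol, circleSymbol_zero]
  homogeneous x η t hη s hs := by
    have houtside : OutsideUnitBall η t := by
      rw [OutsideUnitBall, Real.one_le_sqrt]
      nlinarith [sq_nonneg t]
    simp only [circleLogSymbol, circleSymbol_circleAngle]
    rw [hhom x η t houtside s hs]

end CircleLogSymbol

section SymbolPairs

variable {M m : ℕ} {S : Set (Eu M)}

lemma dirDeriv_eq_deriv_line {P : Type} [NormedAddCommGroup P] [NormedSpace ℝ P] {F : P → ℂ}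
    (hF : ContDiff ℝ ∞ F) (v p : P) : dirDeriv v F p = deriv (fun r : ℝ => F (p + r • v)) 0 :=
  (hF.differentiable (by simp) p).lineDeriv_eq_fderiv.symm

lemma deriv_last {g : Eu M × (Eu m × ℝ) → ℂ} (hg : ContDiff ℝ ∞ g) (x : Eu M) (η : Eu m)
    (u : ℝ) : deriv (fun s : ℝ => g (x, η, s)) u = dirDeriv (dirXin M m) g (x, η, u) := by
  simpa only [iteratedDeriv_one, Function.iterate_one] using iteratedDeriv_slice_xin hg 1 x η u

lemma hasDerivAt_last {g : Eu M × (Eu m × ℝ) → ℂ} (hg : ContDiff ℝ ∞ g) (x : Eu M) (η : Eu m)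
    (u : ℝ) : HasDerivAt (fun s : ℝ => g (x, η, s)) (dirDeriv (dirXin M m) g (x, η, u)) u := by
  rw [← deriv_last hg]
  exact ((hg.comp (by fun_prop : ContDiff ℝ ∞ fun s : ℝ => (x, η, s))).differentiable
    (by simp) u).hasDerivAt

/-- The difference quotient `(g(x, η, u) - g(x, η, 0)) / u`, in the integral form that is smooth
across `u = 0`. -/
def lastQuotient (g : Eu M × (Eu m × ℝ) → ℂ) : Eu M × (Eu m × ℝ) → ℂ := fun p =>
  ∫ r in (0 : ℝ)..1, dirDeriv (dirXin M m) g (p.1, (p.2.1, r * p.2.2))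

lemma mul_lastQuotient {g : Eu M × (Eu m × ℝ) → ℂ} (hg : ContDiff ℝ ∞ g) (x : Eu M) (η : Eu m)
    (u : ℝ) : (u : ℂ) * lastQuotient g (x, η, u) = g (x, η, u) - g (x, η, 0) := by
  have hderiv : ∀ r : ℝ, HasDerivAt (fun r : ℝ => g (x, η, r * u))
      ((u : ℂ) * dirDeriv (dirXin M m) g (x, (η, r * u))) r := fun r => by
    simpa [Function.comp_def] using
      (hasDerivAt_last hg x η (r * u)).scomp r ((hasDerivAt_id r).mul_const u)
  have hcont : Continuous fun r : ℝ => (u : ℂ) * dirDeriv (dirXin M m) g (x, (η, r * u)) := by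
    have := (contDiff_dirDeriv hg (dirXin M m)).continuous
    fun_prop
  have hftc := intervalIntegral.integral_eq_sub_of_hasDerivAt (a := 0) (b := 1)
    (fun r _ => hderiv r) (hcont.intervalIntegrable _ _)
  rw [intervalIntegral.integral_const_mul] at hftc
  simpa [lastQuotient] using hftc

lemma LocSmoothBdd.lastQuotient {g : Eu M × (Eu m × ℝ) → ℂ} (h : LocSmoothBdd S g)
    (hS : IsOpen S) : LocSmoothBdd S (lastQuotient g) := fun v => by
  have hF (s : ℝ) : LocSmoothBddAt S (fun p : Eu M × ((Eu m × ℝ) × ℝ) =>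
      _root_.dirDeriv (dirXin M m) g (p.1, (p.2.1.1, p.2.2 * p.2.1.2))) (v, s) :=
    (h.dirDeriv hS _).comp_right (γ := fun v : (Eu m × ℝ) × ℝ => (v.1.1, v.2 * v.1.2)) hS
      (by fun_prop) _
  unfold _root_.lastQuotient
  simpa only [one_smul] using LocSmoothBddAt.integral (k := fun _ => 1)
    (fun s _ => hF s) hS (continuous_const.intervalIntegrable 0 1)

lemma contDiff_lastQuotient {g : Eu M × (Eu m × ℝ) → ℂ} (hg : ContDiff ℝ ∞ g) :
    ContDiff ℝ ∞ (lastQuotient g) :=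
  contDiff_of_locSmoothBdd_ball fun R =>
    (locSmoothBdd_ball_of_contDiff hg R).lastQuotient Metric.isOpen_ball

lemma contDiff_last : ContDiff ℝ ∞ fun p : Eu M × (Eu m × ℝ) => (p.2.2 : ℂ) :=
  Complex.ofRealCLM.contDiff.comp (contDiff_snd.comp contDiff_snd)

lemma locSmoothBdd_last (hS : IsOpen S) :
    LocSmoothBdd S fun p : Eu M × (Eu m × ℝ) => (p.2.2 : ℂ) :=
  LocSmoothBdd.of_snd hS (γ := fun v : Eu m × ℝ => (v.2 : ℂ))
    (Complex.ofRealCLM.contDiff.comp contDiff_snd)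

/-- A function `a(x, η, t)` that is homogeneous of degree `d` in `(η, t)` for `‖η‖ > 1`, together
with the function `g(x, η, u) = a(x, η, 1/u)` that extends it smoothly to `u = 0`, where it
vanishes; all derivatives are bounded uniformly for `x ∈ S`. This is the class of functions on which
`h_{-1}(t ·)` and the derivatives act, with the expected change of `d`. -/
structure SymbolPair (S : Set (Eu M)) (d : ℤ) (a g : Eu M × (Eu m × ℝ) → ℂ) : Prop where
  contDiff : ContDiff ℝ ∞ a
  contDiff_inv : ContDiff ℝ ∞ g
  bdd : LocSmoothBdd S a
  bdd_inv : LocSmoothBdd S g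
  inv_eq : ∀ (x : Eu M) (η : Eu m) (u : ℝ), u ≠ 0 → g (x, η, u) = a (x, η, u⁻¹)
  inv_zero : ∀ (x : Eu M) (η : Eu m), g (x, η, 0) = 0
  homogeneous : ∀ (x : Eu M) (η : Eu m) (t : ℝ), 1 < ‖η‖ → ∀ s : ℝ, 1 ≤ s →
    a (x, s • η, s * t) = (s : ℂ) ^ d * a (x, η, t)

namespace SymbolPair

variable {d : ℤ} {a g : Eu M × (Eu m × ℝ) → ℂ}

lemma dirDeriv_inv_eq (h : SymbolPair S d a g) (v : Eu M) (w : Eu m) (x : Eu M) (η : Eu m)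
    {u : ℝ} (hu : u ≠ 0) : dirDeriv (v, w, 0) g (x, η, u) = dirDeriv (v, w, 0) a (x, η, u⁻¹) := by
  rw [dirDeriv_eq_deriv_line h.contDiff, dirDeriv_eq_deriv_line h.contDiff_inv]
  congr 1
  ext r
  simpa using h.inv_eq (x + r • v) (η + r • w) u hu

lemma dirDeriv_inv_zero (h : SymbolPair S d a g) (v : Eu M) (w : Eu m) (x : Eu M) (η : Eu m) :
    dirDeriv (v, w, 0) g (x, η, 0) = 0 := by
  have hline : (fun r : ℝ => g ((x, η, 0) + r • (v, w, 0))) = fun _ => 0 := by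
    ext r
    simpa using h.inv_zero (x + r • v) (η + r • w)
  rw [dirDeriv_eq_deriv_line h.contDiff_inv, hline, deriv_const]

lemma homogeneous_dirDeriv (h : SymbolPair S d a g) (w : Eu m) (τ : ℝ) (x : Eu M) (η : Eu m)
    (t : ℝ) (hη : 1 < ‖η‖) (s : ℝ) (hs : 1 ≤ s) :
    dirDeriv (0, w, τ) a (x, s • η, s * t) =
      (s : ℂ) ^ (d - 1) * dirDeriv (0, w, τ) a (x, η, t) := by
  have hs0 : (s : ℂ) ≠ 0 := mod_cast (one_pos.trans_le hs).ne'
  have hhom : (fun r : ℝ => a ((x, s • η, s * t) + (s * r) • (0, w, τ))) =ᶠ[𝓝 0]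
      fun r => (s : ℂ) ^ d * a ((x, η, t) + r • (0, w, τ)) := by
    have hcont : ContinuousAt (fun r : ℝ => ‖η + r • w‖) 0 := by fun_prop
    filter_upwards [hcont.eventually_const_lt (by simpa using hη)] with r hr
    simp only [Prod.smul_mk, Prod.mk_add_mk, smul_zero, add_zero, smul_eq_mul]
    rw [← h.homogeneous x (η + r • w) (t + r * τ) hr s hs, smul_add, smul_smul, mul_add, mul_assoc]
  have hscaled : deriv (fun r : ℝ => a ((x, s • η, s * t) + (s * r) • (0, w, τ))) 0 =
      (s : ℂ) * dirDeriv (0, w, τ) a (x, s • η, s * t) := by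
    have hmul := deriv_comp_mul_left s (fun r : ℝ => a ((x, s • η, s * t) + r • (0, w, τ))) 0
    rw [mul_zero] at hmul
    rw [dirDeriv_eq_deriv_line h.contDiff, hmul, Complex.real_smul]
  have hdiff : DifferentiableAt ℝ (fun r : ℝ => a ((x, η, t) + r • (0, w, τ))) 0 :=
    (h.contDiff.comp (by fun_prop)).differentiable (by simp) 0
  have hderiv := hhom.deriv_eq
  rw [hscaled, deriv_const_mul _ hdiff, ← dirDeriv_eq_deriv_line h.contDiff] at hderiv
  rw [zpow_sub_one₀ hs0]
  field_simp
  rwa [mul_comm]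

lemma dirX (h : SymbolPair S d a g) (hS : IsOpen S) (i : Fin M) :
    SymbolPair S d (dirDeriv (dirX M m i) a) (dirDeriv (dirX M m i) g) where
  contDiff := contDiff_dirDeriv h.contDiff _
  contDiff_inv := contDiff_dirDeriv h.contDiff_inv _
  bdd := h.bdd.dirDeriv hS _
  bdd_inv := h.bdd_inv.dirDeriv hS _
  inv_eq x η _ hu := h.dirDeriv_inv_eq _ 0 x η hu
  inv_zero x η := h.dirDeriv_inv_zero _ 0 x η
  homogeneous x η t hη s hs := by
    have hline : (fun r : ℝ => a ((x, s • η, s * t) + r • _root_.dirX M m i)) =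
        fun r => (s : ℂ) ^ d * a ((x, η, t) + r • _root_.dirX M m i) := by
      ext r
      simpa [_root_.dirX] using h.homogeneous (x + r • EuclideanSpace.single i 1) η t hη s hs
    rw [dirDeriv_eq_deriv_line h.contDiff, dirDeriv_eq_deriv_line h.contDiff, hline,
      deriv_const_mul]
    exact (h.contDiff.comp (by fun_prop)).differentiable (by simp) 0

lemma dirXi (h : SymbolPair S d a g) (hS : IsOpen S) (i : Fin m) :
    SymbolPair S (d - 1) (dirDeriv (dirXi M m i) a) (dirDeriv (dirXi M m i) g) where
  contDiff := contDiff_dirDeriv h.contDiff _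
  contDiff_inv := contDiff_dirDeriv h.contDiff_inv _
  bdd := h.bdd.dirDeriv hS _
  bdd_inv := h.bdd_inv.dirDeriv hS _
  inv_eq x η _ hu := h.dirDeriv_inv_eq 0 _ x η hu
  inv_zero x η := h.dirDeriv_inv_zero 0 _ x η
  homogeneous := h.homogeneous_dirDeriv _ 0

lemma dirDeriv_xin_inv (h : SymbolPair S d a g) (x : Eu M) (η : Eu m) {u : ℝ} (hu : u ≠ 0) :
    dirDeriv (dirXin M m) a (x, η, u⁻¹) =
      -((u : ℂ) * ((u : ℂ) * dirDeriv (dirXin M m) g (x, η, u))) := by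
  have hev : (fun t : ℝ => a (x, η, t)) =ᶠ[𝓝 u⁻¹] fun t => g (x, η, t⁻¹) := by
    filter_upwards [isOpen_ne.mem_nhds (inv_ne_zero hu)] with t ht
    rw [h.inv_eq x η t⁻¹ (inv_ne_zero ht), inv_inv]
  have hg := hasDerivAt_last h.contDiff_inv x η u
  rw [← inv_inv u] at hg
  have hchain := (hg.scomp u⁻¹ (hasDerivAt_inv (inv_ne_zero hu))).deriv
  simp only [Function.comp_def] at hchain
  rw [← deriv_last h.contDiff, hev.deriv_eq, hchain, inv_inv, Complex.real_smul]
  push_cast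
  field_simp

lemma dirXin (h : SymbolPair S d a g) (hS : IsOpen S) :
    SymbolPair S (d - 1) (dirDeriv (dirXin M m) a)
      (fun p => -((p.2.2 : ℂ) * ((p.2.2 : ℂ) * dirDeriv (dirXin M m) g p))) where
  contDiff := contDiff_dirDeriv h.contDiff _
  contDiff_inv :=
    (contDiff_last.mul (contDiff_last.mul (contDiff_dirDeriv h.contDiff_inv _))).neg
  bdd := h.bdd.dirDeriv hS _
  bdd_inv v := by
    have hmul := (locSmoothBdd_last hS v).mul ((locSmoothBdd_last hS v).mul
      (h.bdd_inv.dirDeriv hS (_root_.dirXin M m) v) hS) hS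
    simpa using (LocSmoothBddAt.const (0 : ℂ)).sub hmul hS
  inv_eq x η _ hu := (h.dirDeriv_xin_inv x η hu).symm
  inv_zero x η := by simp
  homogeneous := h.homogeneous_dirDeriv 0 1

lemma mul_lastQuotient_inv (h : SymbolPair S d a g) (x : Eu M) (η : Eu m) {u : ℝ} (hu : u ≠ 0) :
    (u : ℂ) * lastQuotient g (x, η, u) = a (x, η, u⁻¹) := by
  rw [mul_lastQuotient h.contDiff_inv, h.inv_zero, sub_zero, h.inv_eq x η u hu]

lemma lastQuotient_eq (h : SymbolPair S d a g) (x : Eu M) (η : Eu m) {u : ℝ} (hu : u ≠ 0) :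
    lastQuotient g (x, η, u) = (u : ℂ)⁻¹ * a (x, η, u⁻¹) := by
  rw [← h.mul_lastQuotient_inv x η hu, inv_mul_cancel_left₀ (mod_cast hu)]

lemma homogeneous_lastQuotient_zero (h : SymbolPair S d a g) (x : Eu M) (η : Eu m)
    (hη : 1 < ‖η‖) (s : ℝ) (hs : 1 ≤ s) :
    lastQuotient g (x, s • η, 0) = (s : ℂ) ^ (d + 1) * lastQuotient g (x, η, 0) := by
  have hs0 : s ≠ 0 := (one_pos.trans_le hs).ne'
  have hs0' : (s : ℂ) ≠ 0 := mod_cast hs0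
  have hq := (contDiff_lastQuotient h.contDiff_inv).continuous
  have hext : (fun u : ℝ => lastQuotient g (x, s • η, s⁻¹ * u)) =
      fun u => (s : ℂ) ^ (d + 1) * lastQuotient g (x, η, u) := by
    refine Continuous.ext_on (dense_compl_singleton (0 : ℝ)) (by fun_prop) (by fun_prop)
      fun u (hu : u ≠ 0) => ?_
    have hu' : (u : ℂ) ≠ 0 := mod_cast hu
    rw [h.lastQuotient_eq x _ (mul_ne_zero (inv_ne_zero hs0) hu), h.lastQuotient_eq x _ hu,
      mul_inv, inv_inv, h.homogeneous x η u⁻¹ hη s hs, zpow_add_one₀ hs0']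
    push_cast
    field_simp
  simpa only [mul_zero] using congrFun hext 0

lemma mul_last (h : SymbolPair S d a g) (hS : IsOpen S) :
    SymbolPair S (d + 1) (fun p => (p.2.2 : ℂ) * a p - lastQuotient g (p.1, p.2.1, 0))
      (fun p => lastQuotient g p - lastQuotient g (p.1, p.2.1, 0)) := by
  have hq := contDiff_lastQuotient h.contDiff_inv
  have hqb := h.bdd_inv.lastQuotient hS
  have hq₀ : ContDiff ℝ ∞ fun p : Eu M × (Eu m × ℝ) => lastQuotient g (p.1, p.2.1, 0) :=
    hq.comp (by fun_prop)
  have hqb₀ : LocSmoothBdd S fun p : Eu M × (Eu m × ℝ) => lastQuotient g (p.1, p.2.1, 0) :=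
    hqb.comp_right (γ := fun v : Eu m × ℝ => (v.1, (0 : ℝ))) hS (by fun_prop)
  refine ⟨(contDiff_last.mul h.contDiff).sub hq₀, hq.sub hq₀,
    fun v => ((locSmoothBdd_last hS v).mul (h.bdd v) hS).sub (hqb₀ v) hS,
    fun v => (hqb v).sub (hqb₀ v) hS, fun x η u hu => ?_, fun x η => sub_self _,
    fun x η t hη s hs => ?_⟩
  · rw [h.lastQuotient_eq x η hu, Complex.ofReal_inv]
  · have hs0 : (s : ℂ) ≠ 0 := mod_cast (one_pos.trans_le hs).ne'
    rw [h.homogeneous_lastQuotient_zero x η hη s hs, h.homogeneous x η t hη s hs,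
      zpow_add_one₀ hs0]
    push_cast
    ring

lemma memH_neg_one (h : SymbolPair S d a g) (x : Eu M) (η : Eu m) :
    MemH (-1) fun t => a (x, η, t) := by
  refine ⟨h.contDiff.comp (by fun_prop), fun u => lastQuotient g (x, η, u),
    ((contDiff_lastQuotient h.contDiff_inv).comp (by fun_prop)).contDiffOn, fun u _ hu => ?_⟩
  simp only [h.lastQuotient_eq x η hu, zpow_neg_one]

lemma exists_iterate_dirDeriv {v : Eu M × (Eu m × ℝ)} {c : ℤ}
    (hv : ∀ {d a g}, SymbolPair S d a g → ∃ g', SymbolPair S (d - c) (dirDeriv v a) g')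
    (h : SymbolPair S d a g) (n : ℕ) :
    ∃ g', SymbolPair S (d - n * c) ((dirDeriv v)^[n] a) g' := by
  induction n with
  | zero => exact ⟨g, by simpa using h⟩
  | succ n ih =>
    obtain ⟨g', hg'⟩ := ih
    rw [Function.iterate_succ_apply',
      show d - ((n + 1 : ℕ) : ℤ) * c = d - n * c - c by push_cast; ring]
    exact hv hg'

lemma exists_dirMultiDeriv {ι : Type} {e : ι → Eu M × (Eu m × ℝ)} {c : ℤ}
    (he : ∀ i {d a g}, SymbolPair S d a g → ∃ g', SymbolPair S (d - c) (dirDeriv (e i) a) g')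
    (h : SymbolPair S d a g) (α : ι → ℕ) (l : List ι) :
    ∃ g', SymbolPair S (d - (l.map α).sum * c) (dirMultiDeriv e α l a) g' := by
  induction l with
  | nil => exact ⟨g, by simpa [dirMultiDeriv] using h⟩
  | cons i l ih =>
    obtain ⟨g', hg'⟩ := ih
    rw [show d - ((i :: l).map α).sum * c = d - (l.map α).sum * c - (α i : ℤ) * c by
      rw [List.map_cons, List.sum_cons]; push_cast; ring]
    exact hg'.exists_iterate_dirDeriv (he i) (α i)

lemma exists_jointDeriv (h : SymbolPair S d a g) (hS : IsOpen S) (β : Fin M → ℕ)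
    (α : Fin m → ℕ) (k : ℕ) :
    ∃ g', SymbolPair S (d - k - (∑ i, α i : ℕ)) (jointDeriv β α k a) g' := by
  obtain ⟨g₁, h₁⟩ := h.exists_iterate_dirDeriv (c := 1) (fun h => ⟨_, h.dirXin hS⟩) k
  obtain ⟨g₂, h₂⟩ := h₁.exists_dirMultiDeriv (c := 1) (fun i _ _ _ h => ⟨_, h.dirXi hS i⟩) α
    (List.finRange m)
  obtain ⟨g₃, h₃⟩ := h₂.exists_dirMultiDeriv (c := 0)
    (fun i _ _ _ h => ⟨_, by rw [sub_zero]; exact h.dirX hS i⟩) β (List.finRange M)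
  rw [mul_one, mul_one, mul_zero, sub_zero, ← Fin.sum_univ_def] at h₃
  exact ⟨g₃, h₃⟩

end SymbolPair

end SymbolPairs

section Estimates

open MeasureTheory

variable {M m : ℕ} {S : Set (Eu M)}

/-- The function `(1 + t²)^{-1/2}`, which dominates the functions of `t` to be estimated in
`L₂`. -/
def invBracket (t : ℝ) : ℝ := (Real.sqrt (1 + t ^ 2))⁻¹

lemma continuous_invBracket : Continuous invBracket :=
  Continuous.inv₀ (by fun_prop) fun t => (Real.sqrt_pos.2 (by positivity)).ne'

lemma invBracket_nonneg (t : ℝ) : 0 ≤ invBracket t := by unfold invBracket; positivity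

lemma one_le_two_mul_invBracket {t : ℝ} (ht : |t| ≤ 1) : 1 ≤ 2 * invBracket t := by
  rw [invBracket, ← div_eq_mul_inv, one_le_div (Real.sqrt_pos.2 (by positivity)),
    Real.sqrt_le_left (by norm_num)]
  nlinarith [sq_abs t, abs_nonneg t]

lemma abs_inv_le_two_mul_invBracket {t : ℝ} (ht : 1 ≤ |t|) : |t⁻¹| ≤ 2 * invBracket t := by
  rw [abs_inv, invBracket, ← div_eq_mul_inv, le_div_iff₀ (Real.sqrt_pos.2 (by positivity)),
    inv_mul_le_iff₀ (one_pos.trans_le ht), Real.sqrt_le_left (by positivity)]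
  nlinarith [sq_abs t]

lemma memLp_invBracket : MemLp invBracket 2 := by
  rw [memLp_two_iff_integrable_sq continuous_invBracket.aestronglyMeasurable]
  refine integrable_inv_one_add_sq.congr (Eventually.of_forall fun t => ?_)
  simp only [invBracket]
  rw [inv_pow, Real.sq_sqrt (by positivity)]

lemma eLpNorm_invBracket_comp {s : ℝ} (hs : 0 < s) :
    eLpNorm (fun t => invBracket (s⁻¹ * t)) 2 volume =
      ENNReal.ofReal (s ^ (1 / 2 : ℝ)) * eLpNorm invBracket 2 volume := by
  have hmap := eLpNorm_map_measure (p := 2) (μ := volume) (f := fun t : ℝ => s⁻¹ * t)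
    (g := invBracket) continuous_invBracket.aestronglyMeasurable (by fun_prop)
  rw [Real.map_volume_mul_left (inv_ne_zero hs.ne'), inv_inv, abs_of_pos hs,
    eLpNorm_smul_measure_of_ne_top (by simp)] at hmap
  rw [← Function.comp_def invBracket, ← hmap, smul_eq_mul,
    ENNReal.ofReal_rpow_of_nonneg hs.le (by norm_num)]
  simp

lemma exists_scaling (η : Eu m) : ∃ (s : ℝ) (η₀ : Eu m), 1 ≤ s ∧ ‖η₀‖ ≤ 2 ∧ η = s • η₀ ∧
    (s = 1 ∨ 1 < ‖η₀‖) ∧ s ≤ bracket η ∧ bracket η ≤ 3 * s := by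
  rcases le_total ‖η‖ 2 with hsmall | hlarge
  · refine ⟨1, η, le_rfl, hsmall, (one_smul _ _).symm, Or.inl rfl, ?_, ?_⟩
    · rw [bracket, Real.one_le_sqrt]
      nlinarith [sq_nonneg ‖η‖]
    · rw [bracket, Real.sqrt_le_left (by norm_num)]
      nlinarith [norm_nonneg η]
  · have hnorm : ‖(‖η‖ / 2)⁻¹ • η‖ = 2 := by
      rw [norm_smul, norm_inv, Real.norm_of_nonneg (by positivity)]
      have : ‖η‖ ≠ 0 := by linarith
      field_simp
    refine ⟨‖η‖ / 2, (‖η‖ / 2)⁻¹ • η, by linarith, hnorm.le, ?_, Or.inr (by rw [hnorm]; norm_num),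
      Real.le_sqrt_of_sq_le (by nlinarith), ?_⟩
    · rw [smul_inv_smul₀ (by linarith)]
    · rw [bracket, Real.sqrt_le_left (by positivity)]
      nlinarith

lemma rpow_le_three_rpow_abs_mul_rpow {s b : ℝ} (e : ℝ) (hs : 0 < s) (hsb : s ≤ b)
    (hbs : b ≤ 3 * s) : s ^ e ≤ 3 ^ |e| * b ^ e := by
  have hb : 0 < b := hs.trans_le hsb
  rcases le_total 0 e with he | he
  · calc s ^ e ≤ b ^ e := Real.rpow_le_rpow hs.le hsb he
      _ ≤ 3 ^ |e| * b ^ e := le_mul_of_one_le_left (by positivity)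
        (Real.one_le_rpow (by norm_num) (abs_nonneg e))
  · have h3s : 3 ^ e * s ^ e ≤ b ^ e := by
      rw [← Real.mul_rpow (by norm_num) hs.le]
      exact Real.rpow_le_rpow_of_nonpos hb hbs he
    rw [abs_of_nonpos he]
    calc s ^ e = 3 ^ (-e) * (3 ^ e * s ^ e) := by
          rw [← mul_assoc, ← Real.rpow_add (by norm_num)]; simp
      _ ≤ 3 ^ (-e) * b ^ e := by gcongr

lemma LocSmoothBdd.exists_norm_le {F : Eu M × (Eu m × ℝ) → ℂ} (h : LocSmoothBdd S F)
    (hS : IsOpen S) {K : Set (Eu m × ℝ)} (hK : IsCompact K) :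
    ∃ C : ℝ, ∀ x ∈ S, ∀ v ∈ K, ‖F (x, v)‖ ≤ C := by
  obtain ⟨N, -, hKN, hN⟩ := exists_isOpen_smoothBddOn_prod hS hK fun v _ => h v
  obtain ⟨C, hC⟩ := hN.exists_norm_le
  exact ⟨C, fun x hx v hv => hC (x, v) (mk_mem_prod hx (hKN hv))⟩

namespace SymbolPair

variable {d : ℤ} {a g : Eu M × (Eu m × ℝ) → ℂ}

-- For `|t| ≥ 1` the decay comes from `a(x, η, t) = t⁻¹ * lastQuotient g (x, η, t⁻¹)`.
lemma exists_norm_le_invBracket (h : SymbolPair S d a g) (hS : IsOpen S) :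
    ∃ C : ℝ, 0 ≤ C ∧ ∀ x ∈ S, ∀ η : Eu m, ‖η‖ ≤ 2 → ∀ t, ‖a (x, η, t)‖ ≤ C * invBracket t := by
  have hK : IsCompact (Metric.closedBall (0 : Eu m) 2 ×ˢ Icc (-1 : ℝ) 1) :=
    (isCompact_closedBall _ _).prod isCompact_Icc
  obtain ⟨C₁, hC₁⟩ := h.bdd.exists_norm_le hS hK
  obtain ⟨C₂, hC₂⟩ := (h.bdd_inv.lastQuotient hS).exists_norm_le hS hK
  refine ⟨max 0 (max C₁ C₂) * 2, by positivity, fun x hx η hη t => ?_⟩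
  have hmem {u : ℝ} (hu : |u| ≤ 1) : (η, u) ∈ Metric.closedBall (0 : Eu m) 2 ×ˢ Icc (-1 : ℝ) 1 :=
    mk_mem_prod (by simpa using hη) (abs_le.1 hu)
  rw [mul_assoc]
  rcases le_total |t| 1 with ht | ht
  · calc ‖a (x, η, t)‖ ≤ max 0 (max C₁ C₂) := le_max_of_le_right
          (le_max_of_le_left (hC₁ x hx _ (hmem ht)))
      _ ≤ max 0 (max C₁ C₂) * (2 * invBracket t) :=
          le_mul_of_one_le_right (le_max_left _ _) (one_le_two_mul_invBracket ht)
  · have ht0 : t ≠ 0 := by rintro rfl; norm_num at ht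
    have htinv : |t⁻¹| ≤ 1 := by rw [abs_inv]; exact inv_le_one_of_one_le₀ ht
    have hquot : ‖lastQuotient g (x, η, t⁻¹)‖ ≤ max 0 (max C₁ C₂) :=
      le_max_of_le_right (le_max_of_le_right (hC₂ x hx _ (hmem htinv)))
    rw [← inv_inv t, ← h.mul_lastQuotient_inv x η (inv_ne_zero ht0), norm_mul, mul_comm,
      Complex.norm_real, Real.norm_eq_abs, inv_inv]
    gcongr
    exact abs_inv_le_two_mul_invBracket ht

lemma norm_le_zpow_mul_invBracket (h : SymbolPair S d a g) {C : ℝ} {x : Eu M}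
    (hC : ∀ η : Eu m, ‖η‖ ≤ 2 → ∀ t, ‖a (x, η, t)‖ ≤ C * invBracket t) {s : ℝ} (hs : 1 ≤ s)
    {η₀ : Eu m} (hη₀ : ‖η₀‖ ≤ 2) (hcase : s = 1 ∨ 1 < ‖η₀‖) (t : ℝ) :
    ‖a (x, s • η₀, t)‖ ≤ s ^ d * C * ‖invBracket (s⁻¹ * t)‖ := by
  have hs0 : 0 < s := one_pos.trans_le hs
  have hhom : a (x, s • η₀, t) = (s : ℂ) ^ d * a (x, η₀, s⁻¹ * t) := by
    rcases hcase with rfl | hη₁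
    · simp
    · rw [← h.homogeneous x η₀ _ hη₁ s hs, mul_inv_cancel_left₀ hs0.ne']
  rw [hhom, norm_mul, norm_zpow, Complex.norm_real, Real.norm_of_nonneg hs0.le,
    Real.norm_of_nonneg (invBracket_nonneg _), mul_assoc]
  gcongr
  exact hC η₀ hη₀ _

lemma exists_eLpNorm_le (h : SymbolPair S d a g) (hS : IsOpen S) :
    ∃ C : ℝ, ∀ x ∈ S, ∀ η : Eu m, eLpNorm (fun t : ℝ => a (x, η, t)) 2 volume ≤
      ENNReal.ofReal (C * bracket η ^ ((d : ℝ) + 1 / 2)) := by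
  obtain ⟨C, hC0, hC⟩ := h.exists_norm_le_invBracket hS
  set K : ℝ := (eLpNorm invBracket 2 volume).toReal
  have hK : eLpNorm invBracket 2 volume = ENNReal.ofReal K :=
    (ENNReal.ofReal_toReal memLp_invBracket.eLpNorm_ne_top).symm
  have : 0 ≤ K := ENNReal.toReal_nonneg
  refine ⟨C * K * 3 ^ |(d : ℝ) + 1 / 2|, fun x hx η => ?_⟩
  obtain ⟨s, η₀, hs1, hη₀, hη, hcase, hsb, hbs⟩ := exists_scaling η
  have hs : 0 < s := one_pos.trans_le hs1
  have hle (t : ℝ) : ‖a (x, η, t)‖ ≤ s ^ d * C * ‖invBracket (s⁻¹ * t)‖ :=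
    hη ▸ h.norm_le_zpow_mul_invBracket (hC x hx) hs1 hη₀ hcase t
  refine (eLpNorm_le_mul_eLpNorm_of_ae_le_mul (Eventually.of_forall hle) 2).trans ?_
  rw [eLpNorm_invBracket_comp hs, hK, ← ENNReal.ofReal_mul (by positivity),
    ← ENNReal.ofReal_mul (by positivity)]
  refine ENNReal.ofReal_le_ofReal ?_
  have hpow := rpow_le_three_rpow_abs_mul_rpow ((d : ℝ) + 1 / 2) hs hsb hbs
  rw [Real.rpow_add hs, Real.rpow_intCast] at hpow
  calc s ^ d * C * (s ^ (1 / 2 : ℝ) * K) = C * K * (s ^ d * s ^ (1 / 2 : ℝ)) := by ring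
    _ ≤ C * K * (3 ^ |(d : ℝ) + 1 / 2| * bracket η ^ ((d : ℝ) + 1 / 2)) := by gcongr
    _ = _ := by ring

end SymbolPair

lemma hMinusOne_eq {f : ℝ → ℂ} {p : Polynomial ℂ}
    (hp : MemH (-1) fun t => f t - p.eval (t : ℂ)) :
    hMinusOne f = fun t => f t - p.eval (t : ℂ) := by
  have hex : ∃ p : Polynomial ℂ, MemH (-1) (fun t => f t - p.eval (t : ℂ)) := ⟨p, hp⟩
  rw [hMinusOne, dif_pos hex, polynomialPart_unique hex.choose_spec hp]

lemma SymbolPair.exists_pow_mul_sub_eval {f : Eu M → Eu m → ℝ → ℂ} {g : Eu M × (Eu m × ℝ) → ℂ}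
    (h : SymbolPair S 0 (joint f) g) (hS : IsOpen S) (k : ℕ) :
    ∃ a g', SymbolPair S k a g' ∧ ∀ x η, ∃ p : Polynomial ℂ, ∀ t : ℝ,
      a (x, η, t) = (t : ℂ) ^ k * f x η t - p.eval (t : ℂ) := by
  induction k with
  | zero => exact ⟨joint f, g, by simpa using h, fun x η => ⟨0, fun t => by simp [joint]⟩⟩
  | succ k ih =>
    obtain ⟨a, g', hag, hp⟩ := ih
    refine ⟨_, _, by simpa using hag.mul_last hS, fun x η => ?_⟩
    obtain ⟨p, hp⟩ := hp x η
    refine ⟨Polynomial.X * p + Polynomial.C (lastQuotient g' (x, η, 0)), fun t => ?_⟩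
    simp only [hp, Polynomial.eval_add, Polynomial.eval_mul, Polynomial.eval_X, Polynomial.eval_C]
    ring

lemma SymbolPair.exists_hMinusOneMul {f : Eu M → Eu m → ℝ → ℂ} {g : Eu M × (Eu m × ℝ) → ℂ}
    (h : SymbolPair S 0 (joint f) g) (hS : IsOpen S) (k : ℕ) :
    ∃ g', SymbolPair S k (joint (hMinusOneMul k f)) g' := by
  obtain ⟨a, g', hag, hp⟩ := h.exists_pow_mul_sub_eval hS k
  suffices ha : joint (hMinusOneMul k f) = a from ⟨g', ha ▸ hag⟩
  ext ⟨x, η, t⟩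
  obtain ⟨p, hp⟩ := hp x η
  have hmem := hag.memH_neg_one x η
  simp only [hp] at hmem
  simp only [joint, hMinusOneMul, hMinusOne_eq hmem, hp]

namespace CircleFactor

variable {G : Eu M × (Eu m × ℝ) → ℂ}

lemma symbolPair (h : CircleFactor G) (hb : LocSmoothBdd S G) (hS : IsOpen S) :
    SymbolPair S 0 (joint fun x η t => G (x, η, circleAngle t))
      (fun p => G (p.1, p.2.1, 2 * Real.arctan p.2.2)) where
  contDiff := h.contDiff.comp (contDiff_fst.prodMk ((contDiff_fst.comp contDiff_snd).prodMk
    (contDiff_circleAngle.comp (contDiff_snd.comp contDiff_snd))))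
  contDiff_inv := h.contDiff.comp (contDiff_fst.prodMk ((contDiff_fst.comp contDiff_snd).prodMk
    (contDiff_const.mul (Real.contDiff_arctan.comp (contDiff_snd.comp contDiff_snd)))))
  bdd := hb.comp_right (γ := fun v : Eu m × ℝ => (v.1, circleAngle v.2)) hS
    (contDiff_fst.prodMk (contDiff_circleAngle.comp contDiff_snd))
  bdd_inv := hb.comp_right (γ := fun v : Eu m × ℝ => (v.1, 2 * Real.arctan v.2)) hS
    (contDiff_fst.prodMk (contDiff_const.mul (Real.contDiff_arctan.comp contDiff_snd)))
  inv_eq x η u hu := by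
    obtain ⟨A, -, -, -, hA⟩ := h.extends_disc x η
    exact (apply_circleAngle_inv_of_periodic (periodic_of_eq_comp_exp hA) hu).symm
  inv_zero x η := by
    obtain ⟨A, -, hA1, -, hA⟩ := h.extends_disc x η
    simp [hA, hA1]
  homogeneous x η t hη s hs := by
    simpa [joint] using h.homogeneous x η t hη.le s hs

lemma smoothHPlusValued (h : CircleFactor G) :
    SmoothHPlusValued fun x η t => G (x, η, circleAngle t) := by
  have hpair : SymbolPair (Metric.ball 0 1) 0 _ _ :=
    h.symbolPair (locSmoothBdd_ball_of_contDiff h.contDiff 1) Metric.isOpen_ball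
  refine ⟨hpair.contDiff, fun x η => ?_, fun k => ?_⟩
  · obtain ⟨A, hA, hA1, -, hAG⟩ := h.extends_disc x η
    exact memHPlus_comp_circleAngle (G := fun φ => G (x, η, φ)) (h.contDiff.comp (by fun_prop))
      hA hA1 hAG
  · obtain ⟨g', hg'⟩ := hpair.exists_hMinusOneMul Metric.isOpen_ball k
    exact hg'.contDiff

lemma exists_seminormHPlus_le (h : CircleFactor G) (hb : LocSmoothBdd S G) (hS : IsOpen S)
    (β : Fin M → ℕ) (α : Fin m → ℕ) (k k' : ℕ) :
    ∃ C : ℝ, ∀ x ∈ S, ∀ η, seminormHPlus β α k k' (fun x η t => G (x, η, circleAngle t)) x η ≤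
      ENNReal.ofReal (C * bracket η ^ ((0 : ℝ) + 1 / 2 - k + k' - (∑ i, α i : ℕ) : ℝ)) := by
  obtain ⟨g', hg'⟩ := (h.symbolPair hb hS).exists_hMinusOneMul hS k'
  obtain ⟨g'', hg''⟩ := hg'.exists_jointDeriv hS β α k
  obtain ⟨C, hC⟩ := hg''.exists_eLpNorm_le hS
  refine ⟨C, fun x hx η => ?_⟩
  have hexp : (0 : ℝ) + 1 / 2 - k + k' - (∑ i, α i : ℕ) =
      (((k' : ℤ) - k - (∑ i, α i : ℕ) : ℤ) : ℝ) + 1 / 2 := by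
    push_cast
    ring
  simp only [hexp, seminormHPlus, symDeriv_eq_jointDeriv hg'.contDiff]
  exact hC x hx η

lemma memSHPlus (h : CircleFactor G) (hb : LocSmoothBdd univ G) :
    MemSHPlus 0 fun x η t => G (x, η, circleAngle t) := by
  refine ⟨h.smoothHPlusValued, fun β α k k' => ?_⟩
  obtain ⟨C, hC⟩ := h.exists_seminormHPlus_le hb isOpen_univ β α k k'
  exact ⟨C, fun x η => hC x (mem_univ x) η⟩

-- The admissible constants at `x` form an up-set, so that a partition of unity glues the constants
-- found on balls to a continuous function.
lemma memSHPlusLoc (h : CircleFactor G) :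
    MemSHPlusLoc 0 fun x η t => G (x, η, circleAngle t) := by
  refine ⟨h.smoothHPlusValued, fun β α k k' => ?_⟩
  let T (x : Eu M) : Set ℝ :=
    {C | ∀ η, seminormHPlus β α k k' (fun x η t => G (x, η, circleAngle t)) x η ≤
      ENNReal.ofReal (C * bracket η ^ ((0 : ℝ) + 1 / 2 - k + k' - (∑ i, α i : ℕ) : ℝ))}
  have hconvex (x : Eu M) : Convex ℝ (T x) := by
    refine OrdConnected.convex ⟨fun c hc c' _ y hy η => (hc η).trans ?_⟩
    exact ENNReal.ofReal_le_ofReal (mul_le_mul_of_nonneg_right hy.1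
      (Real.rpow_nonneg (Real.sqrt_nonneg _) _))
  have hlocal (x : Eu M) : ∃ C, ∀ᶠ y in 𝓝 x, C ∈ T y := by
    obtain ⟨C, hC⟩ := h.exists_seminormHPlus_le
      (locSmoothBdd_ball_of_contDiff h.contDiff (‖x‖ + 1)) Metric.isOpen_ball β α k k'
    refine ⟨C, ?_⟩
    filter_upwards [Metric.isOpen_ball.mem_nhds
      (by simp : x ∈ Metric.ball (0 : Eu M) (‖x‖ + 1))] with y hy η
    exact hC y hy η
  obtain ⟨C, hC⟩ := exists_continuous_forall_mem_convex_of_local_const hconvex hlocal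
  exact ⟨C, C.continuous, hC⟩

end CircleFactor

end Estimates

section Factorization

open scoped ComplexConjugate

variable {M m : ℕ} {Ψ : Eu M × (Eu m × ℝ) → ℂ}

lemma LocSmoothBdd.conj {S : Set (Eu M)} (hb : LocSmoothBdd S Ψ) (hS : IsOpen S) :
    LocSmoothBdd S fun p => conj (Ψ p) :=
  fun v => (hb v).clm_comp hS (Complex.conjCLE : ℂ →L[ℝ] ℂ)

lemma CircleLog.memSHPlus_expHardy (h : CircleLog Ψ) (hb : LocSmoothBdd univ Ψ) :
    MemSHPlus 0 fun x η t => expHardy Ψ (x, η, circleAngle t) :=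
  h.circleFactor.memSHPlus (hb.expHardy h.contDiff isOpen_univ)

end Factorization

end

theorem theorem2p6_general (M m : ℕ) (θ : ℝ) (q : Eu M → Eu m → ℝ → ℂ)
    (hq : JointlySmooth q) (hhom : HomogeneousZero q) (htrans : ZeroTransmission q)
    (hray : AvoidsRay θ q) :
    ∃ qm qp f g : Eu M → Eu m → ℝ → ℂ,
      (∀ x η t, q x η t = q x 0 1 * qm x η t * qp x η t) ∧
      (∀ x η, InvertibleHolomorphicExtension {z : ℂ | z.im < 0} (qp x η)) ∧
      (∀ x η, InvertibleHolomorphicExtension {z : ℂ | 0 < z.im} (qm x η)) ∧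
      (∀ x η t, qp x η t = 1 + f x η t) ∧
      (∀ x η t, (starRingEnd ℂ) (qm x η t) = 1 + g x η t) ∧
      MemSHPlusLoc 0 f ∧ HomogeneousZeroTangential f ∧
      MemSHPlusLoc 0 g ∧ HomogeneousZeroTangential g ∧
      (IsSymbol 0 q → (∃ c : ℝ, 0 < c ∧ ∀ x η t, c ≤ ‖q x η t‖) →
        MemSHPlus 0 f ∧ MemSHPlus 0 g) := by
  have hΨ := circleLog_circleLogSymbol hq hhom htrans hray
  have hF := hΨ.circleFactor
  have hG := hΨ.conj.circleFactor
  set F := expHardy (circleLogSymbol θ q)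
  set G := expHardy fun p => (starRingEnd ℂ) (circleLogSymbol θ q p)
  refine ⟨fun x η t => (starRingEnd ℂ) (1 + G (x, η, circleAngle t)),
    fun x η t => 1 + F (x, η, circleAngle t), fun x η t => F (x, η, circleAngle t),
    fun x η t => G (x, η, circleAngle t), fun x η t => ?_, hF.invertibleHolomorphicExtension,
    fun x η => (hG.invertibleHolomorphicExtension x η).conj, fun _ _ _ => rfl,
    fun _ _ _ => Complex.conj_conj _, hF.memSHPlusLoc, hF.homogeneous, hG.memSHPlusLoc,
    hG.homogeneous, ?_⟩
  · rw [mul_assoc, mul_comm ((starRingEnd ℂ) _), hΨ.expHardy_mul_conj,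
      mul_exp_circleLogSymbol_sub hray]
  · rintro hsym ⟨c, hc, hlow⟩
    have hb : LocSmoothBdd univ (circleLogSymbol θ q) :=
      (hsym.locSmoothBdd_joint le_rfl).circleLogSymbol hq hhom htrans hray isOpen_univ hc
        fun x _ => hlow x
    exact ⟨hΨ.memSHPlus_expHardy hb, hΨ.conj.memSHPlus_expHardy (hb.conj isOpen_univ)⟩

theorem theorem2p6 (m : ℕ) (θ : ℝ) (q : Eu (m + 1) → Eu m → ℝ → ℂ)
    (hq : IsSymbolLoc 0 q) (hhom : HomogeneousZero q) (htrans : ZeroTransmission q)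
    (hray : AvoidsRay θ q) :
    ∃ qm qp f g : Eu (m + 1) → Eu m → ℝ → ℂ,
      (∀ x η t, q x η t = q x 0 1 * qm x η t * qp x η t) ∧
      (∀ x η, InvertibleHolomorphicExtension {z : ℂ | z.im < 0} (qp x η)) ∧
      (∀ x η, InvertibleHolomorphicExtension {z : ℂ | 0 < z.im} (qm x η)) ∧
      (∀ x η t, qp x η t = 1 + f x η t) ∧
      (∀ x η t, (starRingEnd ℂ) (qm x η t) = 1 + g x η t) ∧
      MemSHPlusLoc 0 f ∧ HomogeneousZeroTangential f ∧
      MemSHPlusLoc 0 g ∧ HomogeneousZeroTangential g ∧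
      (IsSymbol 0 q → (∃ c : ℝ, 0 < c ∧ ∀ x η t, c ≤ ‖q x η t‖) →
        MemSHPlus 0 f ∧ MemSHPlus 0 g) :=
  theorem2p6_general (m + 1) m θ q hq.1 hhom htrans hray
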